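/- **Setting.** Let $L,\nu,T>0$, $D=[0,L]^2$. Let $H$ be the space of $L$-periodic vector fields in $L^2(D)^2$ with mean zero and weakly vanishing divergence, with the inner product $(\cdot,\cdot)$ and norm $|\cdot|$ of $L^2(D)^2$, let $V=H\cap W^{1,2}$ (periodic Sobolev space), and let $A=-\Delta$ with $\mathrm{Dom}(A)=H\cap W^{2,2}$. Let $(\zeta_j)_{j\ge1}$ be an orthonormal basis of $H$ with $\zeta_j\in\mathrm{Dom}(A)$, $A\zeta_j=\lambda_j\zeta_j$, and let $A^{1/2}u=\sum_j\lambda_j^{1/2}(u,\zeta_j)\zeta_j$ for $u\in V$. Let $q_j>0$ with $\mathrm{Tr}(Q):=\sum_jq_j<\infty$ and $\sum_j\lambda_jq_j<\infty$, and let $W(t)=\sum_j\sqrt{q_j}\,\beta_j(t)\zeta_j$, where $(\beta_j)_{j\ge1}$ are independent adapted real Brownian motions on a filtered probability space $(\Omega,\mathcal F,(\mathcal F_t)_{t\ge0},\mathbb P)$ whose increments after any time $s$ are jointly independent of $\mathcal F_s$. Set $\tilde\alpha_0=\nu/\mathrm{Tr}(Q)$. For $N\ge1$ put $t_l=lT/N$.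 Given an $\mathcal F_0$-measurable $V$-valued $u_0$, a solution of the fully implicit time Euler scheme is a family of $V$-valued random variables $u^0=u_0,u^1,\dots,u^N$, with $u^l$ being $\mathcal F_{t_l}$-measurable, such that for $l=1,\dots,N$, almost surely, for all $\phi\in V$, $$(u^l-u^{l-1},\phi)+\tfrac TN\Big[\nu(A^{1/2}u^l,A^{1/2}\phi)+\int_D\big((u^l\cdot\nabla)u^l\big)\cdot\phi\,dx\Big]=(W(t_l)-W(t_{l-1}),\phi).$$ **Theorem.** (i) Let $u_0\in V$ be deterministic. For every $0<\alpha<\tilde\alpha_0$ there is a constant $C_1(\alpha)>0$ such that for all $N$ large enough every solution of the scheme satisfies $$\mathbb E\Big[\exp\Big(\alpha\max_{0\le l\le N}|A^{1/2}u^l|^2\Big)\Big]\le C_1(\alpha)<\infty.\qquad(1)$$ For every $\beta<\tilde\alpha_0/2$ there is a constant $C_2(\beta)>0$ such that for all $N$ large enough every solution of the scheme satisfies $u^l\in\mathrm{Dom}(A)$ a.s. for $1\le l\le N$ and $$\mathbb E\Big[\exp\Big(\beta\max_{0\le n\le N}\Big[|A^{1/2}u^n|^2+\nu\frac TN\sum_{l=1}^n|Au^l|^2\Big]\Big)\Big]\le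 C_2(\beta)<\infty.\qquad(2)$$ (ii) Let $u_0$ be random, $\mathcal F_0$-measurable, $V$-valued, with $\mathbb E[\exp(\gamma_0|A^{1/2}u_0|^2)]<\infty$ for some $\gamma_0>0$. Then for every $0<\alpha<\tilde\alpha_0\gamma_0/(\gamma_0+\tilde\alpha_0)$ there is a constant $C_1(\alpha)>0$ such that (1) holds for all $N$ large enough, and for every $0<\beta<\tilde\alpha_0\gamma_0/(2\gamma_0+\tilde\alpha_0)$ there is a constant $C_2(\beta)>0$ such that (2) (with $u^l\in\mathrm{Dom}(A)$ a.s. for $1\le l\le N$) holds for all $N$ large enough, again for every solution of the scheme. -/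

import Mathlib

open MeasureTheory ProbabilityTheory Filter
open scoped NNReal RealInnerProductSpace

noncomputable section

namespace NavierStokes2D

/-! ### Periodic vector fields on the square -/

/-- The square `D = [0, L]²`. -/
def cell (L : ℝ) : Set (Fin 2 → ℝ) := Set.Icc 0 (fun _ => L)

/-- `𝕃² = L²(D)²`: square integrable vector fields on `D` with values in the Euclidean plane
(periodic fields being identified with their restriction to the periodicity cell `D`). -/
abbrev L2 (L : ℝ) : Type :=
  Lp (EuclideanSpace ℝ (Fin 2)) 2 ((volume : Measure (Fin 2 → ℝ)).restrict (cell L))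

/-- Smooth functions on `ℝ²` that are `L`-periodic in both coordinate directions. -/
structure IsTest (L : ℝ) (φ : (Fin 2 → ℝ) → ℝ) : Prop where
  smooth : ContDiff ℝ (⊤ : ℕ∞) φ
  periodic : ∀ x i, φ (x + Pi.single i L) = φ x

/-- Classical partial derivative `∂ᵢ φ`. -/
def pderiv (i : Fin 2) (φ : (Fin 2 → ℝ) → ℝ) (x : Fin 2 → ℝ) : ℝ :=
  fderiv ℝ φ x (Pi.single i 1)

/-- `g` is the weak derivative `∂ᵢ u` of the `L`-periodic vector field `u`. -/
def HasWeakDeriv {L : ℝ} (i : Fin 2) (u g : L2 L) : Prop :=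
  ∀ φ : (Fin 2 → ℝ) → ℝ, IsTest L φ →
    ∫ x in cell L, pderiv i φ x • u x = - ∫ x in cell L, φ x • g x

open Classical in
/-- The weak derivative `∂ᵢ u` (set to `0` if `u` has none in `𝕃²`). -/
def weakDeriv {L : ℝ} (i : Fin 2) (u : L2 L) : L2 L :=
  if h : ∃ g, HasWeakDeriv i u g then h.choose else 0

theorem L2.integrable {L : ℝ} (u : L2 L) : IntegrableOn (fun x => u x) (cell L) := by
  have : IsFiniteMeasure ((volume : Measure (Fin 2 → ℝ)).restrict (cell L)) :=
    ⟨by simpa [cell] using (isCompact_Icc (a := (0 : Fin 2 → ℝ)) (b := fun _ => L)).measure_lt_top⟩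
  exact (Lp.memLp u).integrable (by norm_num)

theorem L2.integrable_div {L : ℝ} (u : L2 L) {φ : (Fin 2 → ℝ) → ℝ} (hφ : IsTest L φ) :
    IntegrableOn (fun x => ∑ i, u x i * pderiv i φ x) (cell L) := by
  refine integrable_finsetSum _ fun i _ => ?_
  have h1 : IntegrableOn (fun x => u x i) (cell L) :=
    (EuclideanSpace.proj (𝕜 := ℝ) i).integrable_comp u.integrable
  have h2 : Continuous (pderiv i φ) :=
    (hφ.smooth.continuous_fderiv (by simp)).clm_apply continuous_const
  exact h1.mul_continuousOn h2.continuousOn isCompact_Icc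

/-- The space `H` of periodic square integrable vector fields with mean zero and with weakly
vanishing divergence, a closed subspace of `𝕃²` with the inner product of `𝕃²`. -/
def H (L : ℝ) : Submodule ℝ (L2 L) where
  carrier := {u | ∫ x in cell L, u x = 0 ∧
    ∀ φ : (Fin 2 → ℝ) → ℝ, IsTest L φ → ∫ x in cell L, ∑ i, u x i * pderiv i φ x = 0}
  zero_mem' := by
    have h := Lp.coeFn_zero (EuclideanSpace ℝ (Fin 2)) 2
      ((volume : Measure (Fin 2 → ℝ)).restrict (cell L))
    refine ⟨?_, fun φ _ => ?_⟩
    · rw [integral_congr_ae h]; simp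
    · rw [integral_congr_ae (g := fun _ => (0 : ℝ))]
      · simp
      · filter_upwards [h] with x hx
        refine Finset.sum_eq_zero fun i _ => ?_
        have h0 : (0 : L2 L) x i = 0 := by rw [hx]; rfl
        exact mul_eq_zero_of_left h0 _
  add_mem' := by
    rintro u v ⟨hu, hu'⟩ ⟨hv, hv'⟩
    have h := Lp.coeFn_add u v
    refine ⟨?_, fun φ hφ => ?_⟩
    · rw [integral_congr_ae h]
      simp only [Pi.add_apply]
      rw [integral_add u.integrable v.integrable, hu, hv, add_zero]
    · rw [integral_congr_ae (g := fun x =>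
        (∑ i, u x i * pderiv i φ x) + ∑ i, v x i * pderiv i φ x)]
      · rw [integral_add (u.integrable_div hφ) (v.integrable_div hφ), hu' φ hφ, hv' φ hφ, add_zero]
      · filter_upwards [h] with x hx
        simp only [hx, Pi.add_apply, PiLp.add_apply, add_mul, Finset.sum_add_distrib]
  smul_mem' := by
    rintro c u ⟨hu, hu'⟩
    have h := Lp.coeFn_smul c u
    refine ⟨?_, fun φ hφ => ?_⟩
    · rw [integral_congr_ae h]
      simp only [Pi.smul_apply]
      rw [integral_smul, hu, smul_zero]
    · rw [integral_congr_ae (g := fun x => c * ∑ i, u x i * pderiv i φ x)]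
      · rw [integral_const_mul, hu' φ hφ, mul_zero]
      · filter_upwards [h] with x hx
        simp only [hx, Pi.smul_apply, PiLp.smul_apply, smul_eq_mul, Finset.mul_sum, mul_assoc]

/-- `V = H ∩ 𝕎^{1,2}`: the fields in `H` with weak first derivatives in `𝕃²`. -/
def V (L : ℝ) : Set (H L) := {u | ∀ i, ∃ g, HasWeakDeriv i (u : L2 L) g}

/-- `Dom A = H ∩ 𝕎^{2,2}`: the fields in `H` with weak first and second derivatives in `𝕃²`. -/
def domA (L : ℝ) : Set (H L) :=
  {u | ∀ i, ∃ g, HasWeakDeriv i (u : L2 L) g ∧ ∀ j, ∃ h, HasWeakDeriv j g h}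

/-- The Stokes operator `A u = -Δ u`, meaningful for `u ∈ Dom A`. -/
def stokes {L : ℝ} (u : H L) : L2 L := - ∑ i, weakDeriv i (weakDeriv i (u : L2 L))

/-- The trilinear form `b(u, v, w) = ∫_D ((u · ∇) v) · w dx`. -/
def trilinear {L : ℝ} (u v w : H L) : ℝ :=
  ∫ x in cell L, ∑ i, ∑ j, (u : L2 L) x i * (weakDeriv i (v : L2 L)) x j * (w : L2 L) x j

/-- The orthonormal basis `ζ` of `H` consists of eigenfunctions of `A`, with eigenvalues `lam`
(listed in any order). -/
structure IsEigenbasis {L : ℝ} (ζ : HilbertBasis ℕ ℝ (H L)) (lam : ℕ → ℝ) : Prop where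
  mem_domA : ∀ j, ζ j ∈ domA L
  eigen : ∀ j, stokes (ζ j) = lam j • (ζ j : L2 L)

/-- The square root `A^{1/2} u = ∑ⱼ √λⱼ (u, ζⱼ) ζⱼ` of the Stokes operator, whose domain is `V`. -/
def sqrtStokes {L : ℝ} (ζ : HilbertBasis ℕ ℝ (H L)) (lam : ℕ → ℝ) (u : H L) : H L :=
  ∑' j, (√(lam j) * ⟪ζ j, u⟫) • ζ j

/-! ### The noise -/

/-- `bm` is a sequence of independent one-dimensional Brownian motions on the filtered probability
space `(Ω, ℱ, P)`: they are adapted, and their increments after time `s` are jointly independent of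
`ℱ s`. -/
structure IsBrownianSequence {Ω : Type*} {mΩ : MeasurableSpace Ω} (P : Measure Ω)
    (ℱ : Filtration ℝ≥0 mΩ) (bm : ℕ → ℝ≥0 → Ω → ℝ) : Prop where
  brownian : ∀ j, IsBrownianReal (bm j) P
  indep : iIndepFun (fun j ω (t : ℝ≥0) => bm j t ω) P
  adapted : ∀ j t, Measurable[ℱ t] (bm j t)
  indep_past : ∀ s t, s ≤ t →
    Indep (⨆ j, MeasurableSpace.comap (fun ω => bm j t ω - bm j s ω) inferInstance) (ℱ s) P

/-- The `Q`-Wiener process `W(t) = ∑ⱼ √qⱼ βⱼ(t) ζⱼ`, where `Q ζⱼ = qⱼ ζⱼ`. -/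
def wiener {L : ℝ} (ζ : HilbertBasis ℕ ℝ (H L)) (q : ℕ → ℝ) {Ω : Type*}
    (bm : ℕ → ℝ≥0 → Ω → ℝ) (t : ℝ≥0) (ω : Ω) : H L :=
  ∑' j, (√(q j) * bm j t ω) • ζ j

/-- `Tr Q = ∑ⱼ qⱼ`. -/
def traceQ (q : ℕ → ℝ) : ℝ := ∑' j, q j

/-! ### The fully implicit time Euler scheme -/

/-- The grid point `t_l = l T / N`. -/
def gridTime (T : ℝ≥0) (N l : ℕ) : ℝ≥0 := l * T / N

/-- `u 0, …, u N` is a solution of the fully implicit time Euler scheme (projected on divergence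
free fields) with `N` time steps and initial condition `u₀`: each `u l` is a `V`-valued random
variable, measurable with respect to `ℱ (t_l)`, `u 0 = u₀`, and for `l = 1, …, N`, almost surely,
`(uˡ - uˡ⁻¹, φ) + T/N [ν (A^{1/2} uˡ, A^{1/2} φ) + ⟨(uˡ · ∇) uˡ, φ⟩] = (W(t_l) - W(t_{l-1}), φ)`
for all `φ ∈ V`. -/
structure IsEulerScheme {L : ℝ} (ζ : HilbertBasis ℕ ℝ (H L)) (lam q : ℕ → ℝ) (ν : ℝ) (T : ℝ≥0)
    {Ω : Type*} {mΩ : MeasurableSpace Ω} (P : Measure Ω) (ℱ : Filtration ℝ≥0 mΩ)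
    (bm : ℕ → ℝ≥0 → Ω → ℝ) (u₀ : Ω → H L) (N : ℕ) (u : ℕ → Ω → H L) : Prop where
  init : u 0 = u₀
  adapted : ∀ l ≤ N, StronglyMeasurable[ℱ (gridTime T N l)] (u l)
  mem_V : ∀ l ≤ N, ∀ᵐ ω ∂P, u l ω ∈ V L
  step : ∀ l, 1 ≤ l → l ≤ N → ∀ᵐ ω ∂P, ∀ φ ∈ V L,
    ⟪u l ω - u (l - 1) ω, φ⟫ +
        (T / N : ℝ) * (ν * ⟪sqrtStokes ζ lam (u l ω), sqrtStokes ζ lam φ⟫ +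
          trilinear (u l ω) (u l ω) φ) =
      ⟪wiener ζ q bm (gridTime T N l) ω - wiener ζ q bm (gridTime T N (l - 1)) ω, φ⟫

/-- `max_{0 ≤ l ≤ N} |A^{1/2} uˡ|²`. -/
def maxGrad {L : ℝ} (ζ : HilbertBasis ℕ ℝ (H L)) (lam : ℕ → ℝ) (N : ℕ) (u : ℕ → H L) : ℝ :=
  (Finset.range (N + 1)).sup' Finset.nonempty_range_add_one
    fun l => ‖sqrtStokes ζ lam (u l)‖ ^ 2

/-- `max_{0 ≤ n ≤ N} [|A^{1/2} uⁿ|² + ν T/N ∑_{l=1}^n |A uˡ|²]`. -/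
def maxGradDiss {L : ℝ} (ζ : HilbertBasis ℕ ℝ (H L)) (lam : ℕ → ℝ) (ν : ℝ) (T : ℝ≥0) (N : ℕ)
    (u : ℕ → H L) : ℝ :=
  (Finset.range (N + 1)).sup' Finset.nonempty_range_add_one
    fun n => ‖sqrtStokes ζ lam (u n)‖ ^ 2 +
      ν * (T / N : ℝ) * ∑ l ∈ Finset.Icc 1 n, ‖stokes (u l)‖ ^ 2

/-- There is a constant `C > 0` such that for all large `N`, every solution `u⁰, …, uᴺ` of the
Euler scheme satisfies `E exp(α max_{0 ≤ l ≤ N} |A^{1/2} uˡ|²) ≤ C`. -/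
def GradExpMoment {L : ℝ} (ζ : HilbertBasis ℕ ℝ (H L)) (lam q : ℕ → ℝ) (ν : ℝ) (T : ℝ≥0)
    {Ω : Type*} {mΩ : MeasurableSpace Ω} (P : Measure Ω) (ℱ : Filtration ℝ≥0 mΩ)
    (bm : ℕ → ℝ≥0 → Ω → ℝ) (u₀ : Ω → H L) (α : ℝ) : Prop :=
  ∃ C : ℝ, 0 < C ∧ ∀ᶠ N : ℕ in atTop, ∀ u : ℕ → Ω → H L,
    IsEulerScheme ζ lam q ν T P ℱ bm u₀ N u →
      Integrable (fun ω => Real.exp (α * maxGrad ζ lam N fun l => u l ω)) P ∧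
      ∫ ω, Real.exp (α * maxGrad ζ lam N fun l => u l ω) ∂P ≤ C

/-- There is a constant `C > 0` such that for all large `N`, every solution `u⁰, …, uᴺ` of the
Euler scheme has `uˡ ∈ Dom A` a.s. for `l = 1, …, N` and satisfies
`E exp(β max_{0 ≤ n ≤ N} [|A^{1/2} uⁿ|² + ν T/N ∑_{l=1}^n |A uˡ|²]) ≤ C`. -/
def GradDissExpMoment {L : ℝ} (ζ : HilbertBasis ℕ ℝ (H L)) (lam q : ℕ → ℝ) (ν : ℝ) (T : ℝ≥0)
    {Ω : Type*} {mΩ : MeasurableSpace Ω} (P : Measure Ω) (ℱ : Filtration ℝ≥0 mΩ)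
    (bm : ℕ → ℝ≥0 → Ω → ℝ) (u₀ : Ω → H L) (β : ℝ) : Prop :=
  ∃ C : ℝ, 0 < C ∧ ∀ᶠ N : ℕ in atTop, ∀ u : ℕ → Ω → H L,
    IsEulerScheme ζ lam q ν T P ℱ bm u₀ N u →
      (∀ l, 1 ≤ l → l ≤ N → ∀ᵐ ω ∂P, u l ω ∈ domA L) ∧
      Integrable (fun ω => Real.exp (β * maxGradDiss ζ lam ν T N fun l => u l ω)) P ∧
      ∫ ω, Real.exp (β * maxGradDiss ζ lam ν T N fun l => u l ω) ∂P ≤ C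

end NavierStokes2D

end

/-!
The proof rests on one deterministic inequality for an implicit Euler step and on a maximal
inequality for exponential supermartingales.

**Energy at the level of the gradient.** In two dimensions the transport term of the vorticity
equation drops out of the enstrophy balance: `b(v, v, A v) = 0` for smooth divergence free periodic
`v`, because `((v · ∇) v) · Δ v` is a divergence (`integral_advection_mul_laplacian`). Testing the
scheme formally with `A uˡ` therefore gives, with `w` the noise increment and `h` the time step,
`|A^{1/2} uˡ|² + 2 ν h |A uˡ|² ≤ |A^{1/2} (uˡ⁻¹ + w)|²`. A solution is only known to lie in `V`, so
the scheme is tested with the spectral truncation `y` of `A uˡ` instead. All truncations are Fourier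
multipliers (`fc_multiplier`), and the vorticity identity for the truncated field, the bounds
`‖v‖_∞ ≤ C |A v|` and `‖y‖_∞ ≤ C √n |y|` for frequencies of size up to `√n`, and the smallness of
the tail of the gradient of `uˡ` show that the nonlinear term is `o(|y|² + |y|)`
(`exists_bound_tri`). This yields both `uˡ ∈ Dom A` and the energy inequality
(`euler_step_energy`).

**Exponential moments.** In the eigenbasis the right-hand side above is
`|A^{1/2} uˡ⁻¹|² + ∑ⱼ (λⱼ qⱼ Dⱼ² + 2 λⱼ √qⱼ uⱼ Dⱼ)`, where `uⱼ` are the modes of `uˡ⁻¹` and `Dⱼ` are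
independent centred Gaussian variables of variance `h`, independent of the past. The quadratic part
costs `O(h)` per step. The conditional exponential moment of order `a` of the linear part is
compensated by subtracting `∑ⱼ Wⱼ uⱼ²`, where `Wⱼ` is slightly larger than `2 a h λⱼ² qⱼ`
(`lintegral_mul_exp_noiseIncr_le`). From the second step on `Wⱼ = σ h λⱼ²` is used, which is paid
for by the part `σ h |A uˡ⁻¹|²` of the dissipation of the previous step and is large enough as soon
as `2 a Tr Q < σ` and `h` is small; in the first step `Wⱼ` is a multiple of `h λⱼ` and raises the
coefficient of `|A^{1/2} u₀|²` to `1 + O(h)`. The compensated increments are thus the increments of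
an exponential supermartingale, whose running maximum has exponential moments of every order `b < a`
(`lintegral_exp_runMax_le`). It remains to split the exponential of the sum of the initial energy
and of the running maximum by convexity, which is possible if `α / γ₀ + α / b < 1`.

Of the dissipation `2 ν` the part `ρ = 2 ν - σ` is left for the left-hand side, so that the moments
are finite for `α / γ₀ + 2 α Tr Q / (2 ν - ρ) < 1` (`exists_expMoment_maxGradDiss_le`). The bound on
the gradient is the case `ρ = 0`, the bound including the dissipation the case `ρ = ν`, and a
deterministic initial value has exponential moments of all orders `γ₀`.
-/

noncomputable section

namespace NavierStokes2D

open scoped ComplexConjugate ENNReal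

/-! ### Fourier series on the periodicity cell -/

section UnitTorus

attribute [local instance] instMeasureSpaceUnitAddCircle
  instIsAddHaarMeasureUnitAddCircleVolume instIsProbabilityMeasureUnitAddCircleVolume

/-- The character `x ↦ exp (2πi k·x / L)` of the torus `ℝ² / Lℤ²`. -/
def fourierChar (L : ℝ) (k : Fin 2 → ℤ) (x : Fin 2 → ℝ) : ℂ :=
  Complex.exp (((2 * Real.pi / L * ∑ i, (k i : ℝ) * x i : ℝ) : ℂ) * Complex.I)

/-- The Fourier coefficient of `f` at `k`, normalised so that `f = ∑ₖ fcoef L f k • fourierChar L k`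
in `L²` of the cell. -/
def fcoef (L : ℝ) (f : (Fin 2 → ℝ) → ℂ) (k : Fin 2 → ℤ) : ℂ :=
  ((L : ℂ) ^ 2)⁻¹ * ∫ x in cell L, conj (fourierChar L k x) * f x

/-- The section of the quotient map `x ↦ x / L` from the plane to the unit torus with values in
`(0, L]²`. -/
def torusSection (L : ℝ) (y : UnitAddTorus (Fin 2)) : Fin 2 → ℝ :=
  L • ((UnitAddTorus.measurableEquivPiIoc (0 : Fin 2 → ℝ) y : _) : Fin 2 → ℝ)

theorem norm_fourierChar (L : ℝ) (k : Fin 2 → ℤ) (x : Fin 2 → ℝ) : ‖fourierChar L k x‖ = 1 :=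
  Complex.norm_exp_ofReal_mul_I _

theorem continuous_fourierChar (L : ℝ) (k : Fin 2 → ℤ) : Continuous (fourierChar L k) := by
  unfold fourierChar; fun_prop

theorem measurable_torusSection (L : ℝ) : Measurable (torusSection L) :=
  (measurable_subtype_coe.comp
    (UnitAddTorus.measurableEquivPiIoc (0 : Fin 2 → ℝ)).measurable).const_smul L

theorem mFourier_eq_fourierChar {L : ℝ} (hL : 0 < L) (k : Fin 2 → ℤ) (y : UnitAddTorus (Fin 2)) :
    UnitAddTorus.mFourier k y = fourierChar L k (torusSection L y) := by
  have h : ∀ i, y i = (((UnitAddTorus.measurableEquivPiIoc (0 : Fin 2 → ℝ) y : _) :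
      Fin 2 → ℝ) i : UnitAddCircle) := fun i => by
    conv_lhs => rw [← (UnitAddTorus.measurableEquivPiIoc (0 : Fin 2 → ℝ)).symm_apply_apply y]
    rfl
  simp only [UnitAddTorus.mFourier, ContinuousMap.coe_mk, fourierChar, torusSection]
  set z := ((UnitAddTorus.measurableEquivPiIoc (0 : Fin 2 → ℝ) y : _) : Fin 2 → ℝ)
  simp only [h, fourier_coe_apply, Fin.prod_univ_two, Fin.sum_univ_two, ← Complex.exp_add]
  congr 1
  have : (L : ℂ) ≠ 0 := by exact_mod_cast hL.ne'
  simp only [Pi.smul_apply, smul_eq_mul]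
  push_cast
  field_simp

/-- The section carries the normalised Haar measure to the normalised Lebesgue measure of the cell,
which transfers the Fourier series of the unit torus to the cell. -/
theorem map_torusSection {L : ℝ} (hL : 0 < L) :
    (volume : Measure (UnitAddTorus (Fin 2))).map (torusSection L) =
      ENNReal.ofReal ((L ^ 2)⁻¹) • (volume : Measure (Fin 2 → ℝ)).restrict (cell L) := by
  have hS : MeasurableSet {x : Fin 2 → ℝ | ∀ i,
      x i ∈ Set.Ioc ((0 : Fin 2 → ℝ) i) ((0 : Fin 2 → ℝ) i + 1)} :=
    MeasurableSet.univ_pi' fun i => measurableSet_Ioc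
  have h1 : (volume : Measure (UnitAddTorus (Fin 2))).map (fun y =>
      ((UnitAddTorus.measurableEquivPiIoc (0 : Fin 2 → ℝ) y : _) : Fin 2 → ℝ)) =
      volume.restrict {x : Fin 2 → ℝ | ∀ i,
        x i ∈ Set.Ioc ((0 : Fin 2 → ℝ) i) ((0 : Fin 2 → ℝ) i + 1)} := by
    have hm := (UnitAddTorus.measurePreserving_equivPiIoc (0 : Fin 2 → ℝ)).map_eq
    have hc := Measure.map_map (μ := (volume : Measure (UnitAddTorus (Fin 2))))
      (g := (Subtype.val : {x : Fin 2 → ℝ // ∀ i,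
        x i ∈ Set.Ioc ((0 : Fin 2 → ℝ) i) ((0 : Fin 2 → ℝ) i + 1)} → _))
      measurable_subtype_coe (UnitAddTorus.measurableEquivPiIoc (0 : Fin 2 → ℝ)).measurable
    rw [hm] at hc
    exact hc.symm.trans (map_comap_subtype_coe hS volume)
  have hsm : Measurable fun x : Fin 2 → ℝ => L • x := measurable_const_smul L
  have h2 : torusSection L = (fun x : Fin 2 → ℝ => L • x) ∘ fun y =>
      ((UnitAddTorus.measurableEquivPiIoc (0 : Fin 2 → ℝ) y : _) : Fin 2 → ℝ) := rfl
  have hE : Measurable fun y : UnitAddTorus (Fin 2) =>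
      ((UnitAddTorus.measurableEquivPiIoc (0 : Fin 2 → ℝ) y : _) : Fin 2 → ℝ) :=
    measurable_subtype_coe.comp (UnitAddTorus.measurableEquivPiIoc (0 : Fin 2 → ℝ)).measurable
  rw [h2, ← Measure.map_map hsm hE, h1]
  have h3 : {x : Fin 2 → ℝ | ∀ i, x i ∈ Set.Ioc ((0 : Fin 2 → ℝ) i) ((0 : Fin 2 → ℝ) i + 1)} =
      (fun x : Fin 2 → ℝ => L • x) ⁻¹' (Set.univ.pi fun i => Set.Ioc ((0 : Fin 2 → ℝ) i) L) := by
    ext x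
    simp [hL]
  have h4 : MeasurableSet (Set.univ.pi fun i : Fin 2 => Set.Ioc ((0 : Fin 2 → ℝ) i) L) :=
    MeasurableSet.univ_pi fun i => measurableSet_Ioc
  have h5 : (Set.univ.pi fun i : Fin 2 => Set.Ioc ((0 : Fin 2 → ℝ) i) L) =ᵐ[volume] cell L :=
    Measure.univ_pi_Ioc_ae_eq_Icc (μ := fun _ : Fin 2 => (volume : Measure ℝ))
      (f := (0 : Fin 2 → ℝ)) (g := fun _ => L)
  rw [h3, ← Measure.restrict_map hsm h4, Measure.map_addHaar_smul _ hL.ne', Measure.restrict_smul,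
    Measure.restrict_congr_set h5]
  simp [abs_of_pos hL]

theorem integral_comp_torusSection {L : ℝ} (hL : 0 < L) {f : (Fin 2 → ℝ) → ℂ}
    (hf : AEStronglyMeasurable f (volume.restrict (cell L))) :
    ∫ y, f (torusSection L y) = ((L : ℂ) ^ 2)⁻¹ * ∫ x in cell L, f x := by
  rw [← integral_map (measurable_torusSection L).aemeasurable, map_torusSection hL,
    integral_smul_measure, ENNReal.toReal_ofReal (by positivity)]
  · simp
  · rw [map_torusSection hL]; exact hf.smul_measure _

theorem memLp_comp_torusSection {L : ℝ} (hL : 0 < L) {f : (Fin 2 → ℝ) → ℂ}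
    (hf : MemLp f 2 (volume.restrict (cell L))) :
    MemLp (fun y => f (torusSection L y)) 2 (volume : Measure (UnitAddTorus (Fin 2))) := by
  refine MemLp.comp_of_map (f := torusSection L) ?_ (measurable_torusSection L).aemeasurable
  rw [map_torusSection hL]
  exact hf.smul_measure (by simp)

theorem mFourierCoeff_toLp_eq_fcoef {L : ℝ} (hL : 0 < L) {f : (Fin 2 → ℝ) → ℂ}
    (hf : MemLp f 2 (volume.restrict (cell L))) (k : Fin 2 → ℤ) :
    UnitAddTorus.mFourierCoeff ((memLp_comp_torusSection hL hf).toLp _) k = fcoef L f k := by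
  rw [UnitAddTorus.mFourierCoeff, fcoef, ← integral_comp_torusSection hL]
  · refine integral_congr_ae ?_
    filter_upwards [(memLp_comp_torusSection hL hf).coeFn_toLp] with y hy
    rw [hy, UnitAddTorus.mFourier_neg, mFourier_eq_fourierChar hL, smul_eq_mul]
  · exact ((Complex.continuous_conj.comp
      (continuous_fourierChar L k)).aestronglyMeasurable).mul hf.1

/-- Parseval's identity on the cell. -/
theorem hasSum_fcoef_mul {L : ℝ} (hL : 0 < L) {f g : (Fin 2 → ℝ) → ℂ}
    (hf : MemLp f 2 (volume.restrict (cell L))) (hg : MemLp g 2 (volume.restrict (cell L))) :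
    HasSum (fun k => conj (fcoef L f k) * fcoef L g k)
      (((L : ℂ) ^ 2)⁻¹ * ∫ x in cell L, conj (f x) * g x) := by
  have h := UnitAddTorus.hasSum_prod_mFourierCoeff ((memLp_comp_torusSection hL hf).toLp _)
    ((memLp_comp_torusSection hL hg).toLp _)
  simp only [mFourierCoeff_toLp_eq_fcoef hL hf, mFourierCoeff_toLp_eq_fcoef hL hg] at h
  convert! h using 1
  rw [← integral_comp_torusSection (f := fun x => conj (f x) * g x) hL
    ((Complex.continuous_conj.comp_aestronglyMeasurable hf.1).mul hg.1)]
  refine integral_congr_ae ?_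
  filter_upwards [(memLp_comp_torusSection hL hf).coeFn_toLp,
    (memLp_comp_torusSection hL hg).coeFn_toLp] with y h1 h2
  rw [h1, h2]

/-- A square integrable function whose Fourier coefficients vanish outside a finite set is the
corresponding trigonometric polynomial. -/
theorem ae_eq_sum_fcoef {L : ℝ} (hL : 0 < L) {f : (Fin 2 → ℝ) → ℂ}
    (hf : MemLp f 2 (volume.restrict (cell L))) {K : Finset (Fin 2 → ℤ)}
    (hK : ∀ k ∉ K, fcoef L f k = 0) :
    ∀ᵐ x ∂(volume.restrict (cell L)), f x = ∑ k ∈ K, fcoef L f k * fourierChar L k x := by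
  set F := (memLp_comp_torusSection hL hf).toLp _ with hF
  have h := UnitAddTorus.hasSum_mFourier_series_L2 F
  have hz : ∀ k ∉ K, UnitAddTorus.mFourierCoeff F k •
      UnitAddTorus.mFourierLp (d := Fin 2) 2 k = 0 := by
    intro k hk
    rw [hF, mFourierCoeff_toLp_eq_fcoef hL hf, hK k hk, zero_smul]
  have h' := hasSum_sum_of_ne_finset_zero (L := SummationFilter.unconditional _) hz
  have h2 := h.unique h'
  have hm : AEStronglyMeasurable (fun x => f x - ∑ k ∈ K, fcoef L f k * fourierChar L k x)
      (volume.restrict (cell L)) := hf.1.sub (Continuous.aestronglyMeasurable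
        (continuous_finsetSum _ fun k _ => continuous_const.mul (continuous_fourierChar L k)))
  have hae : ∀ᵐ y : UnitAddTorus (Fin 2),
      f (torusSection L y) - ∑ k ∈ K, fcoef L f k * fourierChar L k (torusSection L y) = 0 := by
    have h3 := Lp.coeFn_finsetSum (p := 2) (μ := (volume : Measure (UnitAddTorus (Fin 2)))) K
      (fun i => UnitAddTorus.mFourierCoeff F i • UnitAddTorus.mFourierLp (d := Fin 2) 2 i)
    rw [← h2] at h3
    have h4 : ∀ᵐ y : UnitAddTorus (Fin 2), ∀ k ∈ K,
        (UnitAddTorus.mFourierCoeff F k • UnitAddTorus.mFourierLp (d := Fin 2) 2 k :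
          Lp ℂ 2 (volume : Measure (UnitAddTorus (Fin 2)))) y =
          fcoef L f k * fourierChar L k (torusSection L y) := by
      rw [Filter.eventually_all_finset]
      intro k _
      filter_upwards [Lp.coeFn_smul (UnitAddTorus.mFourierCoeff F k)
        (UnitAddTorus.mFourierLp (d := Fin 2) 2 k), UnitAddTorus.coeFn_mFourierLp 2 k] with y h5 h6
      rw [h5, Pi.smul_apply, h6, mFourier_eq_fourierChar hL, hF,
        mFourierCoeff_toLp_eq_fcoef hL hf, smul_eq_mul]
    filter_upwards [h3, h4, (memLp_comp_torusSection hL hf).coeFn_toLp] with y h5 h6 h7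
    rw [← h7, ← hF, h5, Finset.sum_apply, Finset.sum_congr rfl h6, sub_self]
  have hmap : ∀ᵐ x ∂((volume : Measure (UnitAddTorus (Fin 2))).map (torusSection L)),
      f x - ∑ k ∈ K, fcoef L f k * fourierChar L k x = 0 := by
    have hm' : AEStronglyMeasurable (fun x => f x - ∑ k ∈ K, fcoef L f k * fourierChar L k x)
        ((volume : Measure (UnitAddTorus (Fin 2))).map (torusSection L)) := by
      rw [map_torusSection hL]; exact hm.smul_measure _
    have hN := hm'.aemeasurable.nullMeasurable (measurableSet_singleton (0 : ℂ)).compl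
    rw [ae_iff]
    exact (Measure.map_apply₀ (measurable_torusSection L).aemeasurable hN).trans hae
  rw [map_torusSection hL, Measure.ae_ennreal_smul_measure_iff (by positivity)] at hmap
  filter_upwards [hmap] with x hx
  exact sub_eq_zero.1 hx

end UnitTorus

/-! ### Fourier coefficients of vector fields -/

/-- The wave vector component `2π kᵢ / L`. -/
def wave (L : ℝ) (k : Fin 2 → ℤ) (i : Fin 2) : ℝ := 2 * Real.pi / L * k i

/-- The phase `2π k·x / L`. -/
def phase (L : ℝ) (k : Fin 2 → ℤ) : (Fin 2 → ℝ) →L[ℝ] ℝ :=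
  ∑ i, wave L k i • ContinuousLinearMap.proj i

/-- The `k`-th Fourier coefficient of the `c`-th component of a vector field. -/
def fc {L : ℝ} (u : L2 L) (k : Fin 2 → ℤ) (c : Fin 2) : ℂ := fcoef L (fun x => (u x c : ℂ)) k

theorem phase_apply (L : ℝ) (k : Fin 2 → ℤ) (x : Fin 2 → ℝ) :
    phase L k x = ∑ i, wave L k i * x i := by
  simp [phase]

theorem fourierChar_eq (L : ℝ) (k : Fin 2 → ℤ) (x : Fin 2 → ℝ) :
    fourierChar L k x = (Real.cos (phase L k x) : ℂ) + Real.sin (phase L k x) * Complex.I := by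
  have : 2 * Real.pi / L * ∑ i, (k i : ℝ) * x i = phase L k x := by
    rw [phase_apply, Finset.mul_sum]
    simp only [wave, mul_assoc]
  rw [fourierChar, this, Complex.exp_mul_I, Complex.ofReal_cos, Complex.ofReal_sin]

theorem phase_add_single {L : ℝ} (hL : 0 < L) (k : Fin 2 → ℤ) (x : Fin 2 → ℝ) (i : Fin 2) :
    phase L k (x + Pi.single i L) = phase L k x + k i * (2 * Real.pi) := by
  rw [map_add, phase_apply L k (Pi.single i L)]
  simp only [Pi.single_apply, mul_ite, mul_zero, Finset.sum_ite_eq', Finset.mem_univ, if_true, wave]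
  field_simp

theorem isTest_cos {L : ℝ} (hL : 0 < L) (k : Fin 2 → ℤ) :
    IsTest L fun x => Real.cos (phase L k x) where
  smooth := Real.contDiff_cos.comp (phase L k).contDiff
  periodic x i := by rw [phase_add_single hL, Real.cos_add_int_mul_two_pi]

theorem isTest_sin {L : ℝ} (hL : 0 < L) (k : Fin 2 → ℤ) :
    IsTest L fun x => Real.sin (phase L k x) where
  smooth := Real.contDiff_sin.comp (phase L k).contDiff
  periodic x i := by rw [phase_add_single hL, Real.sin_add_int_mul_two_pi]

theorem phase_single (L : ℝ) (k : Fin 2 → ℤ) (i : Fin 2) :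
    phase L k (Pi.single i 1) = wave L k i := by
  rw [phase_apply]
  simp [Pi.single_apply]

theorem pderiv_cos (L : ℝ) (k : Fin 2 → ℤ) (i : Fin 2) (x : Fin 2 → ℝ) :
    pderiv i (fun x => Real.cos (phase L k x)) x = -wave L k i * Real.sin (phase L k x) := by
  have h := (Real.hasDerivAt_cos (phase L k x)).comp_hasFDerivAt x (phase L k).hasFDerivAt
  rw [pderiv, show (fun x => Real.cos (phase L k x)) = Real.cos ∘ phase L k from rfl, h.fderiv]
  simp [phase_single, mul_comm]

theorem pderiv_sin (L : ℝ) (k : Fin 2 → ℤ) (i : Fin 2) (x : Fin 2 → ℝ) :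
    pderiv i (fun x => Real.sin (phase L k x)) x = wave L k i * Real.cos (phase L k x) := by
  have h := (Real.hasDerivAt_sin (phase L k x)).comp_hasFDerivAt x (phase L k).hasFDerivAt
  rw [pderiv, show (fun x => Real.sin (phase L k x)) = Real.sin ∘ phase L k from rfl, h.fderiv]
  simp [phase_single, mul_comm]

theorem isFiniteMeasure_cell (L : ℝ) :
    IsFiniteMeasure ((volume : Measure (Fin 2 → ℝ)).restrict (cell L)) :=
  ⟨by simpa [cell] using (isCompact_Icc (a := (0 : Fin 2 → ℝ)) (b := fun _ => L)).measure_lt_top⟩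

theorem integrable_comp_mul {L : ℝ} (u : L2 L) (c : Fin 2) {φ : (Fin 2 → ℝ) → ℝ}
    (hφ : Continuous φ) : IntegrableOn (fun x => φ x * u x c) (cell L) := by
  have h1 : IntegrableOn (fun x => u x c) (cell L) :=
    (EuclideanSpace.proj (𝕜 := ℝ) c).integrable_comp u.integrable
  simpa only [mul_comm] using h1.mul_continuousOn hφ.continuousOn isCompact_Icc

theorem integrable_smul {L : ℝ} (u : L2 L) {φ : (Fin 2 → ℝ) → ℝ}
    (hφ : Continuous φ) : IntegrableOn (fun x => φ x • u x) (cell L) :=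
  u.integrable.continuousOn_smul hφ.continuousOn isCompact_Icc

theorem integral_smul_apply {L : ℝ} (u : L2 L) (c : Fin 2) {φ : (Fin 2 → ℝ) → ℝ}
    (hφ : Continuous φ) :
    (∫ x in cell L, φ x • u x) c = ∫ x in cell L, φ x * u x c :=
  ((EuclideanSpace.proj (𝕜 := ℝ) c).integral_comp_comm (integrable_smul u hφ)).symm

theorem continuous_cos_phase (L : ℝ) (k : Fin 2 → ℤ) :
    Continuous fun x => Real.cos (phase L k x) := Real.continuous_cos.comp (phase L k).continuous

theorem continuous_sin_phase (L : ℝ) (k : Fin 2 → ℤ) :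
    Continuous fun x => Real.sin (phase L k x) := Real.continuous_sin.comp (phase L k).continuous

theorem fc_eq {L : ℝ} (u : L2 L) (k : Fin 2 → ℤ) (c : Fin 2) :
    fc u k c = ((L : ℂ) ^ 2)⁻¹ * (((∫ x in cell L, Real.cos (phase L k x) * u x c : ℝ) : ℂ) -
      Complex.I * ((∫ x in cell L, Real.sin (phase L k x) * u x c : ℝ) : ℂ)) := by
  rw [fc, fcoef, ← integral_complex_ofReal, ← integral_complex_ofReal,
    ← integral_const_mul Complex.I, ← integral_sub]
  · congr 1
    refine integral_congr_ae (Eventually.of_forall fun x => ?_)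
    simp only [fourierChar_eq, map_add, map_mul, Complex.conj_ofReal, Complex.conj_I]
    push_cast
    ring
  · exact (integrable_comp_mul u c (continuous_cos_phase L k)).ofReal
  · exact (integrable_comp_mul u c (continuous_sin_phase L k)).ofReal.const_mul _

theorem memLp_comp {L : ℝ} (u : L2 L) (c : Fin 2) :
    MemLp (fun x => u x c) 2 (volume.restrict (cell L)) :=
  (EuclideanSpace.proj (𝕜 := ℝ) c).comp_memLp' (Lp.memLp u)

theorem memLp_comp_ofReal {L : ℝ} (u : L2 L) (c : Fin 2) :
    MemLp (fun x => (u x c : ℂ)) 2 (volume.restrict (cell L)) := (memLp_comp u c).ofReal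

theorem L2.inner_eq {L : ℝ} (u v : L2 L) :
    ⟪u, v⟫ = ∑ c, ∫ x in cell L, u x c * v x c := by
  rw [MeasureTheory.L2.inner_def, ← integral_finsetSum]
  · refine integral_congr_ae (Eventually.of_forall fun x => ?_)
    simp [PiLp.inner_apply, mul_comm]
  · intro c _
    exact (memLp_comp u c).integrable_mul (memLp_comp v c)

/-- Parseval's identity for vector fields. -/
theorem hasSum_fc {L : ℝ} (hL : 0 < L) (u v : L2 L) :
    HasSum (fun k => ∑ c, (conj (fc u k c) * fc v k c).re) ((L ^ 2)⁻¹ * ⟪u, v⟫) := by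
  rw [L2.inner_eq, Finset.mul_sum]
  refine hasSum_sum fun c _ => ?_
  have h := (hasSum_fcoef_mul hL (memLp_comp_ofReal u c) (memLp_comp_ofReal v c)).mapL
    Complex.reCLM
  convert! h using 1
  simp only [Complex.conj_ofReal, ← Complex.ofReal_mul, integral_complex_ofReal]
  rw [← Complex.ofReal_pow, ← Complex.ofReal_inv, ← Complex.ofReal_mul, Complex.reCLM_apply,
    Complex.ofReal_re]

theorem hasSum_fc_sq {L : ℝ} (hL : 0 < L) (u : L2 L) :
    HasSum (fun k => ∑ c, ‖fc u k c‖ ^ 2) ((L ^ 2)⁻¹ * ‖u‖ ^ 2) := by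
  convert! hasSum_fc hL u u using 2 with k
  · refine Finset.sum_congr rfl fun c _ => ?_
    rw [Complex.conj_mul', ← Complex.ofReal_pow, Complex.ofReal_re]
  · rw [real_inner_self_eq_norm_sq]

theorem norm_fc_le {L : ℝ} (hL : 0 < L) (u : L2 L) (k : Fin 2 → ℤ) (c : Fin 2) :
    ‖fc u k c‖ ≤ L⁻¹ * ‖u‖ := by
  have h1 : ‖fc u k c‖ ^ 2 ≤ (L ^ 2)⁻¹ * ‖u‖ ^ 2 :=
    (Finset.single_le_sum (f := fun c => ‖fc u k c‖ ^ 2) (fun c _ => by positivity)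
      (Finset.mem_univ c)).trans (le_hasSum (hasSum_fc_sq hL u) k fun _ _ => by positivity)
  rw [← inv_pow, ← mul_pow] at h1
  exact (pow_le_pow_iff_left₀ (norm_nonneg _) (by positivity) two_ne_zero).1 h1

theorem fc_add {L : ℝ} (u v : L2 L) (k : Fin 2 → ℤ) (c : Fin 2) :
    fc (u + v) k c = fc u k c + fc v k c := by
  have h := Lp.coeFn_add u v
  have h1 : ∀ φ : (Fin 2 → ℝ) → ℝ, Continuous φ → ∫ x in cell L, φ x * (u + v) x c =
      (∫ x in cell L, φ x * u x c) + ∫ x in cell L, φ x * v x c := fun φ hφ => by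
    rw [← integral_add (integrable_comp_mul u c hφ) (integrable_comp_mul v c hφ)]
    refine integral_congr_ae ?_
    filter_upwards [h] with x hx
    simp only [hx, Pi.add_apply, PiLp.add_apply, mul_add]
  rw [fc_eq, fc_eq, fc_eq, h1 _ (continuous_cos_phase L k), h1 _ (continuous_sin_phase L k)]
  push_cast
  ring

theorem fc_smul {L : ℝ} (a : ℝ) (u : L2 L) (k : Fin 2 → ℤ) (c : Fin 2) :
    fc (a • u) k c = a * fc u k c := by
  have h := Lp.coeFn_smul a u
  have h1 : ∀ φ : (Fin 2 → ℝ) → ℝ, ∫ x in cell L, φ x * (a • u) x c =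
      a * ∫ x in cell L, φ x * u x c := fun φ => by
    rw [← integral_const_mul]
    refine integral_congr_ae ?_
    filter_upwards [h] with x hx
    simp only [hx, Pi.smul_apply, PiLp.smul_apply, smul_eq_mul]
    ring
  rw [fc_eq, fc_eq, h1, h1]
  push_cast
  ring

/-- `fc` as a continuous linear functional. -/
def fcL {L : ℝ} (hL : 0 < L) (k : Fin 2 → ℤ) (c : Fin 2) : L2 L →L[ℝ] ℂ :=
  LinearMap.mkContinuous
    { toFun := fun u => fc u k c
      map_add' := fun u v => fc_add u v k c
      map_smul' := fun a u => by simp [fc_smul] } L⁻¹ fun u => norm_fc_le hL u k c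

theorem fcL_apply {L : ℝ} (hL : 0 < L) (k : Fin 2 → ℤ) (c : Fin 2) (u : L2 L) :
    fcL hL k c u = fc u k c := rfl

/-- A square integrable field is determined by its Fourier coefficients. -/
theorem L2.ext_fc {L : ℝ} (hL : 0 < L) {u v : L2 L} (h : ∀ k c, fc u k c = fc v k c) : u = v := by
  have h0 : ∀ k c, fc (u - v) k c = 0 := fun k c => by
    rw [← fcL_apply hL, map_sub, fcL_apply, fcL_apply, h, sub_self]
  have h1 := hasSum_fc_sq hL (u - v)
  simp only [h0] at h1
  have h2 : (L ^ 2)⁻¹ * ‖u - v‖ ^ 2 = 0 := h1.unique (by simp)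
  have h3 : ‖u - v‖ = 0 := by
    have : (L ^ 2)⁻¹ ≠ 0 := by positivity
    simpa [this, hL.ne'] using h2
  exact sub_eq_zero.1 (norm_eq_zero.1 h3)

/-! ### Weak derivatives -/

theorem IsTest.continuous {L : ℝ} {φ : (Fin 2 → ℝ) → ℝ} (h : IsTest L φ) : Continuous φ :=
  h.smooth.continuous

theorem IsTest.continuous_pderiv {L : ℝ} {φ : (Fin 2 → ℝ) → ℝ} (h : IsTest L φ) (i : Fin 2) :
    Continuous (pderiv i φ) :=
  (h.smooth.continuous_fderiv (by simp)).clm_apply continuous_const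

/-- Weak derivatives are Fourier multipliers; it suffices to test with sines and cosines. -/
theorem HasWeakDeriv.fc_eq {L : ℝ} (hL : 0 < L) {i : Fin 2} {u g : L2 L} (h : HasWeakDeriv i u g)
    (k : Fin 2 → ℤ) (c : Fin 2) : fc g k c = Complex.I * wave L k i * fc u k c := by
  have key : ∀ φ, IsTest L φ → ∫ x in cell L, pderiv i φ x * u x c =
      -∫ x in cell L, φ x * g x c := fun φ hφ => by
    rw [← integral_smul_apply u c (hφ.continuous_pderiv i), ← integral_smul_apply g c hφ.continuous,
      h φ hφ]
    rfl
  have h1 := key _ (isTest_cos hL k)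
  have h2 := key _ (isTest_sin hL k)
  simp only [pderiv_cos, pderiv_sin, mul_assoc, integral_const_mul] at h1 h2
  rw [NavierStokes2D.fc_eq, NavierStokes2D.fc_eq, ← neg_eq_iff_eq_neg.2 h1,
    ← neg_eq_iff_eq_neg.2 h2]
  push_cast
  linear_combination (((L : ℂ) ^ 2)⁻¹ * wave L k i *
    ((∫ x in cell L, Real.sin (phase L k x) * u x c : ℝ) : ℂ)) * Complex.I_sq

theorem HasWeakDeriv.unique {L : ℝ} (hL : 0 < L) {i : Fin 2} {u g g' : L2 L}
    (h : HasWeakDeriv i u g) (h' : HasWeakDeriv i u g') : g = g' :=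
  L2.ext_fc hL fun k c => by rw [h.fc_eq hL, h'.fc_eq hL]

theorem HasWeakDeriv.weakDeriv_eq {L : ℝ} (hL : 0 < L) {i : Fin 2} {u g : L2 L}
    (h : HasWeakDeriv i u g) : weakDeriv i u = g := by
  have hex : ∃ g, HasWeakDeriv i u g := ⟨g, h⟩
  rw [weakDeriv, dif_pos hex]
  exact hex.choose_spec.unique hL h

theorem hasWeakDeriv_weakDeriv {L : ℝ} {i : Fin 2} {u : L2 L} (h : ∃ g, HasWeakDeriv i u g) :
    HasWeakDeriv i u (weakDeriv i u) := by
  rw [weakDeriv, dif_pos h]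
  exact h.choose_spec

theorem memLp_single {L : ℝ} {φ : (Fin 2 → ℝ) → ℝ} (hφ : Continuous φ) (c : Fin 2) :
    MemLp (fun x => (EuclideanSpace.single c (φ x) : EuclideanSpace ℝ (Fin 2))) 2
      (volume.restrict (cell L)) := by
  have := isFiniteMeasure_cell L
  have hc : Continuous fun x => (EuclideanSpace.single c (φ x) : EuclideanSpace ℝ (Fin 2)) := by
    refine (PiLp.continuous_toLp 2 _).comp ?_
    exact (continuous_single c).comp hφ
  obtain ⟨M, hM⟩ := (isCompact_Icc (a := (0 : Fin 2 → ℝ))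
    (b := fun _ => L)).exists_bound_of_continuousOn hc.continuousOn
  refine MemLp.of_bound hc.aestronglyMeasurable M ?_
  exact (ae_restrict_iff' measurableSet_Icc).2 (Eventually.of_forall hM)

/-- Testing a component against a continuous function is an inner product with a fixed element of
`L²`, hence continuous. -/
theorem inner_single {L : ℝ} {φ : (Fin 2 → ℝ) → ℝ} (hφ : Continuous φ) (c : Fin 2) (u : L2 L) :
    ⟪(memLp_single (L := L) hφ c).toLp _, u⟫ = ∫ x in cell L, φ x * u x c := by
  rw [MeasureTheory.L2.inner_def]
  refine integral_congr_ae ?_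
  filter_upwards [(memLp_single (L := L) hφ c).coeFn_toLp] with x hx
  rw [hx, EuclideanSpace.inner_single_left]
  simp

/-- Weak differentiation is closed: it commutes with convergent series in `L²`. -/
theorem HasWeakDeriv.hasSum {L : ℝ} {i : Fin 2} {ι : Type*} {f g : ι → L2 L} {u v : L2 L}
    (h : ∀ j, HasWeakDeriv i (f j) (g j)) (hu : HasSum f u) (hv : HasSum g v) :
    HasWeakDeriv i u v := by
  intro φ hφ
  ext c
  have hd := hφ.continuous_pderiv i
  have h1 := hu.mapL (innerSL ℝ ((memLp_single (L := L) hd c).toLp _))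
  have h2 := (hv.mapL (innerSL ℝ ((memLp_single (L := L) hφ.continuous c).toLp _))).neg
  simp only [innerSL_apply_apply, inner_single hd, inner_single hφ.continuous] at h1 h2
  rw [PiLp.neg_apply, integral_smul_apply _ _ hd, integral_smul_apply _ _ hφ.continuous]
  refine h1.unique ?_
  convert! h2 using 2 with j
  rw [← integral_smul_apply _ _ hd, h j φ hφ, PiLp.neg_apply,
    integral_smul_apply _ _ hφ.continuous]

/-! ### The Stokes operator in the eigenbasis and in Fourier space -/

/-- The Fourier symbol `|2π k / L|²` of `-Δ`. -/
def symb (L : ℝ) (k : Fin 2 → ℤ) : ℝ := ∑ i, wave L k i ^ 2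

theorem symb_nonneg (L : ℝ) (k : Fin 2 → ℤ) : 0 ≤ symb L k :=
  Finset.sum_nonneg fun _ _ => sq_nonneg _

theorem symb_pos {L : ℝ} (hL : 0 < L) {k : Fin 2 → ℤ} (hk : k ≠ 0) : 0 < symb L k := by
  obtain ⟨i, hi⟩ := Function.ne_iff.1 hk
  refine Finset.sum_pos' (fun _ _ => sq_nonneg _) ⟨i, Finset.mem_univ _, ?_⟩
  have h1 : (k i : ℝ) ≠ 0 := by exact_mod_cast hi
  unfold wave
  positivity

theorem fc_zero_of_mem_H {L : ℝ} (u : H L) (c : Fin 2) : fc (u : L2 L) 0 c = 0 := by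
  have h1 := congrArg (fun v : EuclideanSpace ℝ (Fin 2) => v c) u.2.1
  have h2 := integral_smul_apply (u : L2 L) c (φ := fun _ => 1) continuous_const
  simp only [one_smul] at h2
  rw [fc_eq]
  have h0 : ∀ x, phase L 0 x = 0 := fun x => by simp [phase_apply, wave]
  simp only [h0, Real.cos_zero, Real.sin_zero, zero_mul, integral_zero, ← h2]
  simp only [h1]
  simp

/-- The Fourier coefficients of a divergence free field are orthogonal to the wave vectors. -/
theorem sum_wave_mul_fc {L : ℝ} (hL : 0 < L) (u : H L) (k : Fin 2 → ℤ) :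
    ∑ c, (wave L k c : ℂ) * fc (u : L2 L) k c = 0 := by
  have key : ∀ φ, IsTest L φ →
      ∑ c, ∫ x in cell L, pderiv c φ x * (u : L2 L) x c = 0 := fun φ hφ => by
    rw [← integral_finsetSum _ fun c _ => integrable_comp_mul _ c (hφ.continuous_pderiv c),
      ← u.2.2 φ hφ]
    simp only [mul_comm]
  have h1 := key _ (isTest_cos hL k)
  have h2 := key _ (isTest_sin hL k)
  simp only [pderiv_cos, pderiv_sin, mul_assoc, integral_const_mul, Fin.sum_univ_two] at h1 h2
  have h1' := congrArg (fun r : ℝ => (r : ℂ)) h1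
  have h2' := congrArg (fun r : ℝ => (r : ℂ)) h2
  push_cast at h1' h2'
  simp only [fc_eq, Fin.sum_univ_two]
  linear_combination ((L : ℂ) ^ 2)⁻¹ * h2' + ((L : ℂ) ^ 2)⁻¹ * Complex.I * h1'

theorem norm_le_of_fc_le {L : ℝ} (hL : 0 < L) {u v : L2 L}
    (h : ∀ k c, ‖fc u k c‖ ≤ ‖fc v k c‖) : ‖u‖ ≤ ‖v‖ := by
  have h1 := hasSum_le (fun k => Finset.sum_le_sum fun c _ =>
    pow_le_pow_left₀ (norm_nonneg _) (h k c) 2) (hasSum_fc_sq hL u) (hasSum_fc_sq hL v)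
  have h2 : ‖u‖ ^ 2 ≤ ‖v‖ ^ 2 := le_of_mul_le_mul_left h1 (by positivity)
  exact (pow_le_pow_iff_left₀ (norm_nonneg _) (norm_nonneg _) two_ne_zero).1 h2

theorem fc_sum {L : ℝ} (hL : 0 < L) {ι : Type*} (s : Finset ι) (f : ι → L2 L) (k : Fin 2 → ℤ)
    (c : Fin 2) : fc (∑ j ∈ s, f j) k c = ∑ j ∈ s, fc (f j) k c := by
  simp only [← fcL_apply hL, map_sum]

theorem fc_sub {L : ℝ} (hL : 0 < L) (u v : L2 L) (k : Fin 2 → ℤ) (c : Fin 2) :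
    fc (u - v) k c = fc u k c - fc v k c := by
  simp only [← fcL_apply hL, map_sub]

theorem fc_neg {L : ℝ} (hL : 0 < L) (u : L2 L) (k : Fin 2 → ℤ) (c : Fin 2) :
    fc (-u) k c = -fc u k c := by
  simp only [← fcL_apply hL, map_neg]

theorem hasWeakDeriv_of_mem_V {L : ℝ} {u : H L} (hu : u ∈ V L) (i : Fin 2) :
    HasWeakDeriv i (u : L2 L) (weakDeriv i (u : L2 L)) := hasWeakDeriv_weakDeriv (hu i)

theorem fc_weakDeriv {L : ℝ} (hL : 0 < L) {u : H L} (hu : u ∈ V L) (i : Fin 2) (k : Fin 2 → ℤ)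
    (c : Fin 2) : fc (weakDeriv i (u : L2 L)) k c =
      Complex.I * wave L k i * fc (u : L2 L) k c :=
  (hasWeakDeriv_of_mem_V hu i).fc_eq hL k c

theorem domA_subset_V {L : ℝ} {u : H L} (hu : u ∈ domA L) : u ∈ V L := fun i =>
  let ⟨g, hg, _⟩ := hu i
  ⟨g, hg⟩

theorem hasWeakDeriv_weakDeriv_of_mem_domA {L : ℝ} (hL : 0 < L) {u : H L} (hu : u ∈ domA L)
    (i j : Fin 2) : HasWeakDeriv j (weakDeriv i (u : L2 L))
      (weakDeriv j (weakDeriv i (u : L2 L))) := by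
  obtain ⟨g, hg, h⟩ := hu i
  rw [hg.weakDeriv_eq hL]
  exact hasWeakDeriv_weakDeriv (h j)

theorem fc_stokes {L : ℝ} (hL : 0 < L) {u : H L} (hu : u ∈ domA L) (k : Fin 2 → ℤ)
    (c : Fin 2) : fc (stokes u) k c = symb L k * fc (u : L2 L) k c := by
  have h : ∀ i, fc (weakDeriv i (weakDeriv i (u : L2 L))) k c =
      -(wave L k i : ℂ) ^ 2 * fc (u : L2 L) k c := fun i => by
    rw [(hasWeakDeriv_weakDeriv_of_mem_domA hL hu i i).fc_eq hL,
      fc_weakDeriv hL (domA_subset_V hu)]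
    linear_combination (wave L k i : ℂ) ^ 2 * fc (u : L2 L) k c * Complex.I_sq
  rw [stokes, fc_neg hL, fc_sum hL, symb]
  simp only [h, Fin.sum_univ_two]
  push_cast
  ring

theorem HasWeakDeriv.smul {L : ℝ} {i : Fin 2} {u g : L2 L} (h : HasWeakDeriv i u g) (a : ℝ) :
    HasWeakDeriv i (a • u) (a • g) := by
  intro φ hφ
  have h1 : ∀ (ψ : (Fin 2 → ℝ) → ℝ) (v : L2 L), ∫ x in cell L, ψ x • (a • v : L2 L) x =
      a • ∫ x in cell L, ψ x • v x := fun ψ v => by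
    rw [← integral_smul]
    refine integral_congr_ae ?_
    filter_upwards [Lp.coeFn_smul a v] with x hx
    rw [hx, Pi.smul_apply, smul_comm]
  rw [h1, h1, h φ hφ, smul_neg]

section Eigenbasis

variable {L : ℝ} {ζ : HilbertBasis ℕ ℝ (H L)} {lam : ℕ → ℝ}

theorem IsEigenbasis.symb_mul_fc (hL : 0 < L) (hζ : IsEigenbasis ζ lam) (j : ℕ) (k : Fin 2 → ℤ)
    (c : Fin 2) : (symb L k : ℂ) * fc (ζ j : L2 L) k c = lam j * fc (ζ j : L2 L) k c := by
  rw [← fc_stokes hL (hζ.mem_domA j), hζ.eigen j, fc_smul]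

/-- An eigenfunction has Fourier coefficients only where the symbol equals its eigenvalue. -/
theorem IsEigenbasis.mul_fc (hL : 0 < L) (hζ : IsEigenbasis ζ lam) (m : ℝ → ℝ) (j : ℕ)
    (k : Fin 2 → ℤ) (c : Fin 2) :
    (m (lam j) : ℂ) * fc (ζ j : L2 L) k c = m (symb L k) * fc (ζ j : L2 L) k c := by
  by_cases h : fc (ζ j : L2 L) k c = 0
  · rw [h, mul_zero, mul_zero]
  · have := mul_right_cancel₀ h (hζ.symb_mul_fc hL j k c)
    rw [← Complex.ofReal_injective this]

theorem IsEigenbasis.lam_pos (hL : 0 < L) (hζ : IsEigenbasis ζ lam) (j : ℕ) : 0 < lam j := by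
  have h1 : (ζ j : L2 L) ≠ 0 := fun h => by
    have := ζ.orthonormal.1 j
    rw [← Submodule.norm_coe, h, norm_zero] at this
    exact zero_ne_one this
  have h2 : ∃ k c, fc (ζ j : L2 L) k c ≠ 0 := by
    by_contra! h
    refine h1 (L2.ext_fc hL fun k c => ?_)
    rw [h k c, ← fcL_apply hL, map_zero]
  obtain ⟨k, c, hkc⟩ := h2
  have hk : k ≠ 0 := fun h => hkc (by rw [h, fc_zero_of_mem_H])
  have h3 := mul_right_cancel₀ hkc (hζ.symb_mul_fc hL j k c)
  rw [← Complex.ofReal_injective h3]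
  exact symb_pos hL hk

theorem hasSum_coe {u : H L} {f : ℕ → H L} (h : HasSum f u) :
    HasSum (fun j => (f j : L2 L)) (u : L2 L) := h.mapL (H L).subtypeL

theorem hasSum_basis (u : H L) : HasSum (fun j => ⟪ζ j, u⟫ • ζ j) u := by
  simpa only [HilbertBasis.repr_apply_apply] using ζ.hasSum_repr u

theorem hasSum_basis_sq (u : H L) : HasSum (fun j => ⟪ζ j, u⟫ ^ 2) (‖u‖ ^ 2) := by
  have := ζ.hasSum_inner_mul_inner u u
  rw [real_inner_self_eq_norm_sq] at this
  convert! this using 2 with j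
  rw [real_inner_comm u, sq]

theorem exists_of_summable_sq {c : ℕ → ℝ} (hc : Summable fun j => c j ^ 2) :
    ∃ y : H L, (∀ j, ⟪ζ j, y⟫ = c j) ∧ HasSum (fun j => c j • ζ j) y := by
  have hm : Memℓp c 2 := memℓp_gen (by simpa using hc)
  refine ⟨ζ.repr.symm ⟨c, hm⟩, fun j => ?_, ζ.hasSum_repr_symm ⟨c, hm⟩⟩
  rw [← HilbertBasis.repr_apply_apply, LinearIsometryEquiv.apply_symm_apply]

/-- Functions of the Stokes operator act as Fourier multipliers. -/
theorem fc_multiplier (hL : 0 < L) (hζ : IsEigenbasis ζ lam) (m : ℝ → ℝ) {u v : H L}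
    (h : ∀ j, ⟪ζ j, v⟫ = m (lam j) * ⟪ζ j, u⟫) (k : Fin 2 → ℤ) (c : Fin 2) :
    fc (v : L2 L) k c = m (symb L k) * fc (u : L2 L) k c := by
  have h1 := (hasSum_coe (hasSum_basis (ζ := ζ) v)).mapL (fcL hL k c)
  have h2 := ((hasSum_coe (hasSum_basis (ζ := ζ) u)).mapL (fcL hL k c)).mul_left
    (m (symb L k) : ℂ)
  refine h1.unique ?_
  convert! h2 using 2 with j
  simp only [Submodule.coe_smul, fcL_apply, fc_smul, h]
  push_cast
  linear_combination (⟪ζ j, u⟫ : ℂ) * hζ.mul_fc hL m j k c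

/-- Integration by parts `(∇ζⱼ, ∇u) = λⱼ (ζⱼ, u)`, by Parseval's identity. -/
theorem sum_inner_weakDeriv (hL : 0 < L) (hζ : IsEigenbasis ζ lam) (j : ℕ) {u : L2 L}
    {g : Fin 2 → L2 L} (hg : ∀ i, HasWeakDeriv i u (g i)) :
    ∑ i, ⟪weakDeriv i (ζ j : L2 L), g i⟫ = lam j * ⟪(ζ j : L2 L), u⟫ := by
  have h1 : HasSum (fun k => ∑ i, ∑ c, (conj (fc (weakDeriv i (ζ j : L2 L)) k c) *
      fc (g i) k c).re) ((L ^ 2)⁻¹ * ∑ i, ⟪weakDeriv i (ζ j : L2 L), g i⟫) := by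
    rw [Finset.mul_sum]
    exact hasSum_sum fun i _ => hasSum_fc hL _ _
  have h2 := (hasSum_fc hL (ζ j : L2 L) u).mul_left (lam j)
  have hpt : ∀ (w : ℝ) (a b : ℂ), (conj (Complex.I * w * a) * (Complex.I * w * b)).re =
      w ^ 2 * (conj a * b).re := fun w a b => by
    simp only [map_mul, Complex.conj_I, Complex.conj_ofReal, Complex.mul_re, Complex.mul_im,
      Complex.neg_re, Complex.neg_im, Complex.I_re, Complex.I_im, Complex.ofReal_re,
      Complex.ofReal_im, Complex.conj_re, Complex.conj_im]
    ring
  have h3 : (L ^ 2)⁻¹ * ∑ i, ⟪weakDeriv i (ζ j : L2 L), g i⟫ =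
      lam j * ((L ^ 2)⁻¹ * ⟪(ζ j : L2 L), u⟫) := by
    refine h1.unique ?_
    convert! h2 using 2 with k
    have h4 : ∀ i c, (conj (fc (weakDeriv i (ζ j : L2 L)) k c) * fc (g i) k c).re =
        wave L k i ^ 2 * (conj (fc (ζ j : L2 L) k c) * fc u k c).re := fun i c => by
      rw [fc_weakDeriv hL (domA_subset_V (hζ.mem_domA j)), (hg i).fc_eq hL, hpt]
    simp only [h4]
    rw [Finset.sum_comm, Finset.mul_sum]
    refine Finset.sum_congr rfl fun c _ => ?_
    rw [← Finset.sum_mul]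
    have h5 := congrArg (fun z => (conj z * fc u k c).re) (hζ.symb_mul_fc hL j k c)
    simpa only [map_mul, Complex.conj_ofReal, mul_assoc, Complex.re_ofReal_mul, symb] using h5
  have h4 : (L ^ 2)⁻¹ ≠ 0 := by positivity
  refine mul_left_cancel₀ h4 ?_
  rw [h3]; ring

theorem hasWeakDeriv_sum (hζ : IsEigenbasis ζ lam) (S : Finset ℕ) (c : ℕ → ℝ) (i : Fin 2) :
    HasWeakDeriv i (((∑ j ∈ S, c j • ζ j : H L)) : L2 L)
      (∑ j ∈ S, c j • weakDeriv i (ζ j : L2 L)) := by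
  have h1 : (((∑ j ∈ S, c j • ζ j : H L)) : L2 L) = ∑ j ∈ S, c j • (ζ j : L2 L) := by
    simp only [AddSubmonoidClass.coe_finsetSum, Submodule.coe_smul]
  rw [h1]
  refine HasWeakDeriv.hasSum (fun j : {j // j ∈ S} => ?_)
    (Finset.hasSum S fun j => c j • (ζ j : L2 L))
    (Finset.hasSum S fun j => c j • weakDeriv i (ζ j : L2 L))
  exact (hasWeakDeriv_of_mem_V (domA_subset_V (hζ.mem_domA j)) i).smul _

theorem inner_sum_smul (S : Finset ℕ) (c : ℕ → ℝ) (j : ℕ) (hj : j ∈ S) :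
    ⟪ζ j, ∑ j ∈ S, c j • ζ j⟫ = c j := ζ.orthonormal.inner_right_sum c hj

/-- The gradients of the `ζⱼ` are orthogonal, with squared norms `λⱼ`. -/
theorem sum_norm_sq_weakDeriv_sum (hL : 0 < L) (hζ : IsEigenbasis ζ lam) (S : Finset ℕ)
    (c : ℕ → ℝ) : ∑ i, ‖∑ j ∈ S, c j • weakDeriv i (ζ j : L2 L)‖ ^ 2 =
      ∑ j ∈ S, lam j * c j ^ 2 := by
  have h := fun j => sum_inner_weakDeriv hL hζ j fun i => hasWeakDeriv_sum hζ S c i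
  simp only [← real_inner_self_eq_norm_sq]
  have h1 : ∀ i, ⟪∑ j ∈ S, c j • weakDeriv i (ζ j : L2 L), ∑ j ∈ S, c j • weakDeriv i (ζ j : L2 L)⟫
      = ∑ j ∈ S, c j * ⟪weakDeriv i (ζ j : L2 L), ∑ j ∈ S, c j • weakDeriv i (ζ j : L2 L)⟫ := by
    intro i
    conv_lhs => rw [sum_inner]
    simp only [real_inner_smul_left]
  rw [Finset.sum_congr rfl fun i _ => h1 i, Finset.sum_comm]
  refine Finset.sum_congr rfl fun j hj => ?_
  rw [← Finset.mul_sum, h, ← Submodule.coe_inner, inner_sum_smul S c j hj]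
  ring

/-- Bessel's inequality for the gradients of the eigenfunctions. -/
theorem summable_lam_mul_sq (hL : 0 < L) (hζ : IsEigenbasis ζ lam) {u : H L} (hu : u ∈ V L) :
    Summable fun j => lam j * ⟪ζ j, u⟫ ^ 2 := by
  refine summable_of_sum_le (c := ∑ i, ‖weakDeriv i (u : L2 L)‖ ^ 2)
    (fun j => mul_nonneg (hζ.lam_pos hL j).le (sq_nonneg _)) fun S => ?_
  set c := fun j => ⟪ζ j, u⟫
  have h1 := sum_norm_sq_weakDeriv_sum hL hζ S c
  have h2 : ∑ i, ⟪∑ j ∈ S, c j • weakDeriv i (ζ j : L2 L), weakDeriv i (u : L2 L)⟫ =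
      ∑ j ∈ S, lam j * c j ^ 2 := by
    simp only [sum_inner, real_inner_smul_left]
    rw [Finset.sum_comm]
    refine Finset.sum_congr rfl fun j hj => ?_
    rw [← Finset.mul_sum, sum_inner_weakDeriv hL hζ j fun i => hasWeakDeriv_of_mem_V hu i,
      ← Submodule.coe_inner]
    ring
  have h3 : 0 ≤ ∑ i, ‖∑ j ∈ S, c j • weakDeriv i (ζ j : L2 L) - weakDeriv i (u : L2 L)‖ ^ 2 :=
    Finset.sum_nonneg fun _ _ => sq_nonneg _
  simp only [norm_sub_sq_real, Finset.sum_add_distrib, Finset.sum_sub_distrib, ← Finset.mul_sum,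
    h1, h2] at h3
  linarith

/-- Cauchy criterion for series that are almost orthogonal. -/
theorem summable_of_norm_sum_sq_le {E : Type*} [NormedAddCommGroup E] [CompleteSpace E]
    {f : ℕ → E} {a : ℕ → ℝ} (ha : Summable a)
    (h : ∀ S : Finset ℕ, ‖∑ j ∈ S, f j‖ ^ 2 ≤ ∑ j ∈ S, a j) : Summable f := by
  refine summable_iff_vanishing_norm.2 fun ε hε => ?_
  obtain ⟨s, hs⟩ := summable_iff_vanishing_norm.1 ha (ε ^ 2) (by positivity)
  refine ⟨s, fun t ht => ?_⟩
  have h1 := (h t).trans_lt ((le_abs_self _).trans_lt (hs t ht))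
  exact (pow_lt_pow_iff_left₀ (norm_nonneg _) hε.le two_ne_zero).1 h1

theorem summable_weakDeriv (hL : 0 < L) (hζ : IsEigenbasis ζ lam) {c : ℕ → ℝ}
    (hc : Summable fun j => lam j * c j ^ 2) (i : Fin 2) :
    Summable fun j => c j • weakDeriv i (ζ j : L2 L) := by
  refine summable_of_norm_sum_sq_le hc fun S => ?_
  rw [← sum_norm_sq_weakDeriv_sum hL hζ S c]
  exact Finset.single_le_sum (f := fun i => ‖∑ j ∈ S, c j • weakDeriv i (ζ j : L2 L)‖ ^ 2)
    (fun _ _ => sq_nonneg _) (Finset.mem_univ i)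

theorem hasWeakDeriv_tsum (hL : 0 < L) (hζ : IsEigenbasis ζ lam) {u : H L}
    (hu : Summable fun j => lam j * ⟪ζ j, u⟫ ^ 2) (i : Fin 2) :
    HasWeakDeriv i (u : L2 L) (∑' j, ⟪ζ j, u⟫ • weakDeriv i (ζ j : L2 L)) := by
  refine HasWeakDeriv.hasSum (fun j => ?_) (hasSum_coe (hasSum_basis (ζ := ζ) u))
    (summable_weakDeriv hL hζ hu i).hasSum
  exact (hasWeakDeriv_of_mem_V (domA_subset_V (hζ.mem_domA j)) i).smul _

theorem mem_V_of_summable (hL : 0 < L) (hζ : IsEigenbasis ζ lam) {u : H L}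
    (hu : Summable fun j => lam j * ⟪ζ j, u⟫ ^ 2) : u ∈ V L :=
  fun i => ⟨_, hasWeakDeriv_tsum hL hζ hu i⟩

/-- The second derivatives of a field are bounded by its Laplacian, as the components of the wave
vector satisfy `|κₗ κᵢ| ≤ |κ|²`. -/
theorem norm_sum_weakDeriv_weakDeriv_sq_le (hL : 0 < L) (hζ : IsEigenbasis ζ lam) (S : Finset ℕ)
    (c : ℕ → ℝ) (i l : Fin 2) :
    ‖∑ j ∈ S, c j • weakDeriv l (weakDeriv i (ζ j : L2 L))‖ ^ 2 ≤
      ∑ j ∈ S, lam j ^ 2 * c j ^ 2 := by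
  have h1 : ‖(((∑ j ∈ S, (lam j * c j) • ζ j : H L)) : L2 L)‖ ^ 2 =
      ∑ j ∈ S, lam j ^ 2 * c j ^ 2 := by
    rw [Submodule.norm_coe, ← real_inner_self_eq_norm_sq, ζ.orthonormal.inner_sum]
    refine Finset.sum_congr rfl fun j _ => ?_
    simp only [conj_trivial]; ring
  rw [← h1]
  refine pow_le_pow_left₀ (norm_nonneg _) (norm_le_of_fc_le hL fun k d => ?_) 2
  have h2 : (((∑ j ∈ S, (lam j * c j) • ζ j : H L)) : L2 L) =
      ∑ j ∈ S, (lam j * c j) • (ζ j : L2 L) := by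
    simp only [AddSubmonoidClass.coe_finsetSum, Submodule.coe_smul]
  rw [h2, fc_sum hL, fc_sum hL]
  have h3 : ∀ j, fc (c j • weakDeriv l (weakDeriv i (ζ j : L2 L))) k d =
      -(wave L k l * wave L k i : ℂ) * (c j * fc (ζ j : L2 L) k d) := fun j => by
    rw [fc_smul, (hasWeakDeriv_weakDeriv_of_mem_domA hL (hζ.mem_domA j) i l).fc_eq hL,
      fc_weakDeriv hL (domA_subset_V (hζ.mem_domA j))]
    linear_combination (c j * wave L k l * wave L k i : ℂ) * fc (ζ j : L2 L) k d * Complex.I_sq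
  have h4 : ∀ j, fc ((lam j * c j) • (ζ j : L2 L)) k d =
      symb L k * (c j * fc (ζ j : L2 L) k d) := fun j => by
    rw [fc_smul]
    push_cast
    linear_combination (-(c j : ℂ)) * hζ.symb_mul_fc hL j k d
  simp only [h3, h4, ← Finset.mul_sum]
  rw [norm_mul, norm_mul, norm_neg, ← Complex.ofReal_mul, Complex.norm_real, Complex.norm_real]
  refine mul_le_mul_of_nonneg_right ?_ (norm_nonneg _)
  rw [Real.norm_eq_abs, Real.norm_eq_abs, abs_of_nonneg (symb_nonneg L k), symb, Fin.sum_univ_two]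
  have h5 := sq_nonneg (wave L k 0)
  have h6 := sq_nonneg (wave L k 1)
  have h7 := sq_nonneg (wave L k 0 - wave L k 1)
  have h8 := sq_nonneg (wave L k 0 + wave L k 1)
  rw [abs_le]
  fin_cases i <;> fin_cases l <;> constructor <;> simp <;> nlinarith

theorem summable_lam_mul_sq_of_sq (hL : 0 < L) (hζ : IsEigenbasis ζ lam) {u : H L}
    (hu : Summable fun j => lam j ^ 2 * ⟪ζ j, u⟫ ^ 2) :
    Summable fun j => lam j * ⟪ζ j, u⟫ ^ 2 := by
  refine Summable.of_nonneg_of_le (fun j => mul_nonneg (hζ.lam_pos hL j).le (sq_nonneg _))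
    (fun j => ?_) (hu.add (hasSum_basis_sq (ζ := ζ) u).summable)
  have h1 := sq_nonneg (⟪ζ j, u⟫)
  nlinarith [mul_nonneg (sq_nonneg (lam j - 1)) h1, mul_nonneg (hζ.lam_pos hL j).le h1]

/-- Elliptic regularity: the spectral description of `Dom A`. -/
theorem mem_domA_of_summable (hL : 0 < L) (hζ : IsEigenbasis ζ lam) {u : H L}
    (hu : Summable fun j => lam j ^ 2 * ⟪ζ j, u⟫ ^ 2) : u ∈ domA L := by
  have hu' := summable_lam_mul_sq_of_sq hL hζ hu
  refine fun i => ⟨_, hasWeakDeriv_tsum hL hζ hu' i, fun l => ?_⟩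
  refine ⟨∑' j, ⟪ζ j, u⟫ • weakDeriv l (weakDeriv i (ζ j : L2 L)), ?_⟩
  refine HasWeakDeriv.hasSum (fun j => ?_) (summable_weakDeriv hL hζ hu' i).hasSum
    (Summable.hasSum ?_)
  · exact (hasWeakDeriv_weakDeriv_of_mem_domA hL (hζ.mem_domA j) i l).smul _
  · exact summable_of_norm_sum_sq_le hu fun S =>
      norm_sum_weakDeriv_weakDeriv_sq_le hL hζ S (fun j => ⟪ζ j, u⟫) i l

theorem hasSum_stokes_sq (hL : 0 < L) (hζ : IsEigenbasis ζ lam) {u : H L}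
    (hu : Summable fun j => lam j ^ 2 * ⟪ζ j, u⟫ ^ 2) :
    HasSum (fun j => lam j ^ 2 * ⟪ζ j, u⟫ ^ 2) (‖stokes u‖ ^ 2) := by
  obtain ⟨y, hy, -⟩ := exists_of_summable_sq (ζ := ζ) (c := fun j => lam j * ⟪ζ j, u⟫)
    (by simpa only [mul_pow] using hu)
  have h1 : stokes u = (y : L2 L) := L2.ext_fc hL fun k c => by
    rw [fc_stokes hL (mem_domA_of_summable hL hζ hu), fc_multiplier hL hζ id hy]
    rfl
  rw [h1, Submodule.norm_coe]
  simpa only [hy, mul_pow] using hasSum_basis_sq (ζ := ζ) y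

theorem inner_sqrtStokes (hL : 0 < L) (hζ : IsEigenbasis ζ lam) {u : H L} (hu : u ∈ V L)
    (j : ℕ) : ⟪ζ j, sqrtStokes ζ lam u⟫ = √(lam j) * ⟪ζ j, u⟫ := by
  obtain ⟨y, hy, hs⟩ := exists_of_summable_sq (ζ := ζ) (c := fun j => √(lam j) * ⟪ζ j, u⟫) (by
    simpa only [mul_pow, Real.sq_sqrt (hζ.lam_pos hL _).le] using summable_lam_mul_sq hL hζ hu)
  rw [sqrtStokes, hs.tsum_eq, hy]

theorem hasSum_inner_sqrtStokes (hL : 0 < L) (hζ : IsEigenbasis ζ lam) {u v : H L} (hu : u ∈ V L)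
    (hv : v ∈ V L) : HasSum (fun j => lam j * (⟪ζ j, u⟫ * ⟪ζ j, v⟫))
      ⟪sqrtStokes ζ lam u, sqrtStokes ζ lam v⟫ := by
  convert! ζ.hasSum_inner_mul_inner (sqrtStokes ζ lam u) (sqrtStokes ζ lam v) using 2 with j
  rw [real_inner_comm (ζ j) (sqrtStokes ζ lam u), inner_sqrtStokes hL hζ hu,
    inner_sqrtStokes hL hζ hv]
  linear_combination (-⟪ζ j, u⟫ * ⟪ζ j, v⟫) * Real.sq_sqrt (hζ.lam_pos hL j).le

theorem hasSum_sqrtStokes_sq (hL : 0 < L) (hζ : IsEigenbasis ζ lam) {u : H L} (hu : u ∈ V L) :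
    HasSum (fun j => lam j * ⟪ζ j, u⟫ ^ 2) (‖sqrtStokes ζ lam u‖ ^ 2) := by
  rw [← real_inner_self_eq_norm_sq]
  simpa only [sq] using hasSum_inner_sqrtStokes hL hζ hu hu

end Eigenbasis

/-! ### Smooth periodic functions and trigonometric polynomials -/

section Test

variable {L : ℝ} {φ ψ : (Fin 2 → ℝ) → ℝ}

theorem IsTest.differentiable (h : IsTest L φ) : Differentiable ℝ φ :=
  h.smooth.differentiable (by simp)

theorem IsTest.add (h : IsTest L φ) (h' : IsTest L ψ) : IsTest L fun x => φ x + ψ x where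
  smooth := h.smooth.add h'.smooth
  periodic x i := by rw [h.periodic, h'.periodic]

theorem IsTest.sub (h : IsTest L φ) (h' : IsTest L ψ) : IsTest L fun x => φ x - ψ x where
  smooth := h.smooth.sub h'.smooth
  periodic x i := by rw [h.periodic, h'.periodic]

theorem IsTest.mul (h : IsTest L φ) (h' : IsTest L ψ) : IsTest L fun x => φ x * ψ x where
  smooth := h.smooth.mul h'.smooth
  periodic x i := by rw [h.periodic, h'.periodic]

theorem IsTest.const (a : ℝ) : IsTest L fun _ => a where
  smooth := contDiff_const
  periodic _ _ := rfl

theorem IsTest.sum {ι : Type*} {s : Finset ι} {f : ι → (Fin 2 → ℝ) → ℝ}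
    (h : ∀ k ∈ s, IsTest L (f k)) : IsTest L fun x => ∑ k ∈ s, f k x where
  smooth := ContDiff.sum fun k hk => (h k hk).smooth
  periodic x i := Finset.sum_congr rfl fun k hk => (h k hk).periodic x i

theorem IsTest.pderiv_add (h : IsTest L φ) (h' : IsTest L ψ) (i : Fin 2) (x : Fin 2 → ℝ) :
    pderiv i (fun x => φ x + ψ x) x = pderiv i φ x + pderiv i ψ x := by
  simp only [pderiv]
  rw [fderiv_fun_add (h.differentiable x) (h'.differentiable x)]
  rfl

theorem IsTest.pderiv_sub (h : IsTest L φ) (h' : IsTest L ψ) (i : Fin 2) (x : Fin 2 → ℝ) :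
    pderiv i (fun x => φ x - ψ x) x = pderiv i φ x - pderiv i ψ x := by
  simp only [pderiv]
  rw [fderiv_fun_sub (h.differentiable x) (h'.differentiable x)]
  rfl

theorem IsTest.pderiv_mul (h : IsTest L φ) (h' : IsTest L ψ) (i : Fin 2) (x : Fin 2 → ℝ) :
    pderiv i (fun x => φ x * ψ x) x = pderiv i φ x * ψ x + φ x * pderiv i ψ x := by
  simp only [pderiv]
  rw [fderiv_fun_mul (h.differentiable x) (h'.differentiable x)]
  simp only [add_apply, smul_apply, smul_eq_mul]
  ring

theorem pderiv_const (a : ℝ) (i : Fin 2) (x : Fin 2 → ℝ) : pderiv i (fun _ => a) x = 0 := by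
  simp [pderiv]

theorem IsTest.pderiv_sum {ι : Type*} {s : Finset ι} {f : ι → (Fin 2 → ℝ) → ℝ}
    (h : ∀ k ∈ s, IsTest L (f k)) (i : Fin 2) (x : Fin 2 → ℝ) :
    pderiv i (fun x => ∑ k ∈ s, f k x) x = ∑ k ∈ s, pderiv i (f k) x := by
  simp only [pderiv]
  rw [fderiv_fun_sum fun k hk => (h k hk).differentiable x, sum_apply]

/-- The divergence theorem for periodic fields. -/
theorem integral_divergence_eq_zero (hL : 0 < L) {f : Fin 2 → (Fin 2 → ℝ) → ℝ}
    (hf : ∀ i, IsTest L (f i)) : ∫ x in cell L, ∑ i, pderiv i (f i) x = 0 := by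
  have h := integral_divergence_of_hasFDerivAt_off_countable' (n := 1) (E := ℝ) (0 : Fin 2 → ℝ)
    (fun _ => L) (fun i => hL.le) f (fun i x => fderiv ℝ (f i) x) ∅ Set.countable_empty
    (fun i => (hf i).continuous.continuousOn)
    (fun x _ i => ((hf i).differentiable x).hasFDerivAt)
    (Continuous.integrableOn_Icc (continuous_finsetSum _ fun i _ => (hf i).continuous_pderiv i))
  refine h.trans (Finset.sum_eq_zero fun i _ => ?_)
  rw [sub_eq_zero]
  refine integral_congr_ae (Eventually.of_forall fun x => ?_)
  have h1 : (Fin.insertNth i L x : Fin 2 → ℝ) =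
      (Fin.insertNth i (0 : ℝ) x : Fin 2 → ℝ) + Pi.single i L := by
    ext j
    rcases Fin.eq_self_or_eq_succAbove i j with rfl | ⟨l, rfl⟩ <;> simp
  have h2 := (hf i).periodic (Fin.insertNth i (0 : ℝ) x : Fin 2 → ℝ) i
  rw [← h1] at h2
  exact h2

end Test

/-- The real trigonometric polynomial `Re ∑ₖ aₖ exp (2πi k·x / L)`. -/
def trig (L : ℝ) (K : Finset (Fin 2 → ℤ)) (a : (Fin 2 → ℤ) → ℂ) (x : Fin 2 → ℝ) : ℝ :=
  ∑ k ∈ K, ((a k).re * Real.cos (phase L k x) - (a k).im * Real.sin (phase L k x))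

theorem trig_eq (L : ℝ) (K : Finset (Fin 2 → ℤ)) (a : (Fin 2 → ℤ) → ℂ) (x : Fin 2 → ℝ) :
    trig L K a x = (∑ k ∈ K, a k * fourierChar L k x).re := by
  rw [trig, Complex.re_sum]
  refine Finset.sum_congr rfl fun k _ => ?_
  simp only [fourierChar_eq, Complex.mul_re, Complex.add_re, Complex.add_im, Complex.mul_im,
    Complex.ofReal_re, Complex.ofReal_im, Complex.I_re, Complex.I_im]
  ring

theorem isTest_trig_term {L : ℝ} (hL : 0 < L) (k : Fin 2 → ℤ) (a b : ℝ) :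
    IsTest L fun x => a * Real.cos (phase L k x) - b * Real.sin (phase L k x) :=
  ((IsTest.const a).mul (isTest_cos hL k)).sub ((IsTest.const b).mul (isTest_sin hL k))

theorem isTest_trig {L : ℝ} (hL : 0 < L) (K : Finset (Fin 2 → ℤ)) (a : (Fin 2 → ℤ) → ℂ) :
    IsTest L (trig L K a) :=
  IsTest.sum fun k _ => isTest_trig_term hL k _ _

theorem pderiv_trig {L : ℝ} (hL : 0 < L) (K : Finset (Fin 2 → ℤ)) (a : (Fin 2 → ℤ) → ℂ)
    (i : Fin 2) : pderiv i (trig L K a) = trig L K fun k => Complex.I * wave L k i * a k := by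
  ext x
  have h := IsTest.pderiv_sum (s := K) (fun k _ => isTest_trig_term hL k (a k).re (a k).im) i x
  refine h.trans (Finset.sum_congr rfl fun k _ => ?_)
  rw [((IsTest.const _).mul (isTest_cos hL k)).pderiv_sub
    ((IsTest.const _).mul (isTest_sin hL k)), (IsTest.const _).pderiv_mul (isTest_cos hL k),
    (IsTest.const _).pderiv_mul (isTest_sin hL k), pderiv_const, pderiv_const, pderiv_cos,
    pderiv_sin]
  simp only [Complex.mul_re, Complex.mul_im, Complex.I_re, Complex.I_im, Complex.ofReal_re,
    Complex.ofReal_im]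
  ring

theorem ae_eq_trig {L : ℝ} (hL : 0 < L) {u : L2 L} {K : Finset (Fin 2 → ℤ)}
    (hK : ∀ k ∉ K, ∀ c, fc u k c = 0) (c : Fin 2) :
    ∀ᵐ x ∂(volume.restrict (cell L)), u x c = trig L K (fun k => fc u k c) x := by
  filter_upwards [ae_eq_sum_fcoef hL (memLp_comp_ofReal u c) fun k hk => hK k hk c] with x hx
  rw [trig_eq]
  exact (congrArg Complex.re hx)

theorem ae_abs_le_sum_fc {L : ℝ} (hL : 0 < L) {u : L2 L} {K : Finset (Fin 2 → ℤ)}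
    (hK : ∀ k ∉ K, ∀ c, fc u k c = 0) (c : Fin 2) :
    ∀ᵐ x ∂(volume.restrict (cell L)), |u x c| ≤ ∑ k ∈ K, ‖fc u k c‖ := by
  filter_upwards [ae_eq_trig hL hK c] with x hx
  rw [hx, trig_eq]
  refine (Complex.abs_re_le_norm _).trans ((norm_sum_le _ _).trans
    (Finset.sum_le_sum fun k _ => ?_))
  rw [norm_mul, norm_fourierChar, mul_one]

/-! ### The vorticity identity `b(v, v, A v) = 0` -/

/-- In two dimensions `(v · ∇) v` is orthogonal to `Δ v` for a smooth divergence free periodic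
field: with the vorticity `ω = ∂₀v₁ - ∂₁v₀` one has `Δv = (-∂₁ω, ∂₀ω)`, and `((v · ∇) v) · Δ v` is
the divergence of `(ω (v · ∇) v₁ - v₀ ω² / 2, - ω (v · ∇) v₀ - v₁ ω² / 2)`. -/
theorem integral_advection_mul_laplacian {L : ℝ} (hL : 0 < L) {v : Fin 2 → (Fin 2 → ℝ) → ℝ}
    (hv : ∀ c, IsTest L (v c)) (hp : ∀ i c, IsTest L (pderiv i (v c)))
    (hdiv : ∀ x, ∑ i, pderiv i (v i) x = 0)
    (hdiv' : ∀ l x, ∑ i, pderiv l (pderiv i (v i)) x = 0)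
    (hsymm : ∀ c x, pderiv 1 (pderiv 0 (v c)) x = pderiv 0 (pderiv 1 (v c)) x) :
    ∫ x in cell L, ∑ i, ∑ j, v i x * pderiv i (v j) x *
      (∑ l, pderiv l (pderiv l (v j)) x) = 0 := by
  have hω : IsTest L fun x => pderiv 0 (v 1) x - pderiv 1 (v 0) x := (hp 0 1).sub (hp 1 0)
  have hA : ∀ c, IsTest L fun x => v 0 x * pderiv 0 (v c) x + v 1 x * pderiv 1 (v c) x :=
    fun c => ((hv 0).mul (hp 0 c)).add ((hv 1).mul (hp 1 c))
  have hE : ∀ c, IsTest L fun x => 2⁻¹ * (v c x * ((pderiv 0 (v 1) x - pderiv 1 (v 0) x) *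
      (pderiv 0 (v 1) x - pderiv 1 (v 0) x))) :=
    fun c => (IsTest.const _).mul ((hv c).mul (hω.mul hω))
  have hF0 := (hω.mul (hA 1)).sub (hE 0)
  have hF1 := ((IsTest.const (L := L) (-1)).mul (hω.mul (hA 0))).sub (hE 1)
  have hω' : ∀ i x, pderiv i (fun x => pderiv 0 (v 1) x - pderiv 1 (v 0) x) x =
      pderiv i (pderiv 0 (v 1)) x - pderiv i (pderiv 1 (v 0)) x := fun i x =>
    (hp 0 1).pderiv_sub (hp 1 0) i x
  have hA' : ∀ i c x, pderiv i (fun x => v 0 x * pderiv 0 (v c) x + v 1 x * pderiv 1 (v c) x) x =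
      pderiv i (v 0) x * pderiv 0 (v c) x + v 0 x * pderiv i (pderiv 0 (v c)) x +
      (pderiv i (v 1) x * pderiv 1 (v c) x + v 1 x * pderiv i (pderiv 1 (v c)) x) :=
    fun i c x => by
      rw [((hv 0).mul (hp 0 c)).pderiv_add ((hv 1).mul (hp 1 c)), (hv 0).pderiv_mul (hp 0 c),
        (hv 1).pderiv_mul (hp 1 c)]
  have hE' : ∀ i c x, pderiv i (fun x => 2⁻¹ * (v c x * ((pderiv 0 (v 1) x - pderiv 1 (v 0) x) *
      (pderiv 0 (v 1) x - pderiv 1 (v 0) x)))) x = 2⁻¹ * (pderiv i (v c) x *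
      (pderiv 0 (v 1) x - pderiv 1 (v 0) x) ^ 2 + 2 * v c x *
      (pderiv 0 (v 1) x - pderiv 1 (v 0) x) *
      (pderiv i (pderiv 0 (v 1)) x - pderiv i (pderiv 1 (v 0)) x)) := fun i c x => by
    rw [(IsTest.const _).pderiv_mul ((hv c).mul (hω.mul hω)), (hv c).pderiv_mul (hω.mul hω),
      hω.pderiv_mul hω, hω', pderiv_const]
    ring
  have hF0' := fun x => (hω.mul (hA 1)).pderiv_sub (hE 0) 0 x
  have hF1' := fun x => ((IsTest.const (L := L) (-1)).mul (hω.mul (hA 0))).pderiv_sub (hE 1) 1 x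
  have h := integral_divergence_eq_zero hL (f := ![_, _]) (Fin.forall_fin_two.2 ⟨hF0, hF1⟩)
  rw [← h]
  refine integral_congr_ae (Eventually.of_forall fun x => ?_)
  have h1 := hdiv x
  have h2 := hdiv' 0 x
  have h3 := hdiv' 1 x
  have h4 := hsymm 0 x
  have h5 := hsymm 1 x
  simp only [Fin.sum_univ_two, Matrix.cons_val_zero, Matrix.cons_val_one] at h1 h2 h3 ⊢
  rw [hF0', hF1', hω.pderiv_mul (hA 1), (IsTest.const _).pderiv_mul (hω.mul (hA 0)),
    hω.pderiv_mul (hA 0), pderiv_const, hω', hω', hA', hA', hE', hE']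
  rw [h4] at h3 ⊢
  rw [h5]
  rw [eq_neg_of_add_eq_zero_right h1, eq_neg_of_add_eq_zero_right h3,
    eq_neg_of_add_eq_zero_left h2]
  ring

/-- The trilinear form with the two first derivatives of its second argument replaced by arbitrary
square integrable fields `g 0` and `g 1`. -/
def tri {L : ℝ} (u : L2 L) (g : Fin 2 → L2 L) (y : L2 L) : ℝ :=
  ∫ x in cell L, ∑ i, ∑ j, u x i * g i x j * y x j

theorem trilinear_eq_tri {L : ℝ} (u v w : H L) :
    trilinear u v w = tri (u : L2 L) (fun i => weakDeriv i (v : L2 L)) (w : L2 L) := rfl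

/-- The identity `b(v, v, A v) = 0` for a divergence free field with finitely many frequencies; here
`g` are the derivatives of `v` and `y` is `A v`, described by its Fourier coefficients. -/
theorem tri_stokes_self {L : ℝ} (hL : 0 < L) {v : H L} {g : Fin 2 → L2 L} {y : L2 L}
    {K : Finset (Fin 2 → ℤ)} (hK : ∀ k ∉ K, ∀ c, fc (v : L2 L) k c = 0)
    (hg : ∀ i, HasWeakDeriv i (v : L2 L) (g i))
    (hy : ∀ k c, fc y k c = symb L k * fc (v : L2 L) k c) : tri (v : L2 L) g y = 0 := by
  set V : Fin 2 → (Fin 2 → ℝ) → ℝ := fun c => trig L K fun k => fc (v : L2 L) k c with hV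
  have hVt : ∀ c, IsTest L (V c) := fun c => isTest_trig hL K _
  have hd : ∀ i c, pderiv i (V c) = trig L K fun k => Complex.I * wave L k i * fc (v : L2 L) k c :=
    fun i c => pderiv_trig hL K _ i
  have hdd : ∀ l i c, pderiv l (pderiv i (V c)) = trig L K fun k =>
      Complex.I * wave L k l * (Complex.I * wave L k i * fc (v : L2 L) k c) := fun l i c => by
    rw [hd, pderiv_trig hL]
  have hadd : ∀ a b x, trig L K a x + trig L K b x = trig L K (fun k => a k + b k) x :=
    fun a b x => by
      simp only [trig_eq, add_mul, Finset.sum_add_distrib, Complex.add_re]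
  have hzero : ∀ x, trig L K (fun _ => 0) x = 0 := fun x => by simp [trig]
  have hdiv0 : ∀ k, wave L k 0 * fc (v : L2 L) k 0 + wave L k 1 * fc (v : L2 L) k 1 = 0 :=
    fun k => by simpa using sum_wave_mul_fc hL v k
  have hdiv : ∀ x, ∑ i, pderiv i (V i) x = 0 := fun x => by
    rw [Fin.sum_univ_two, hd, hd, hadd, ← hzero x]
    congr 1
    ext k
    linear_combination Complex.I * hdiv0 k
  have hdiv' : ∀ l x, ∑ i, pderiv l (pderiv i (V i)) x = 0 := fun l x => by
    rw [Fin.sum_univ_two, hdd, hdd, hadd, ← hzero x]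
    congr 1
    ext k
    linear_combination Complex.I * Complex.I * wave L k l * hdiv0 k
  have hsymm : ∀ c x, pderiv 1 (pderiv 0 (V c)) x = pderiv 0 (pderiv 1 (V c)) x := fun c x => by
    rw [hdd, hdd]
    congr 1
    ext k
    ring
  have hmain := integral_advection_mul_laplacian hL hVt (fun i c => by
    rw [hd]; exact isTest_trig hL K _) hdiv hdiv' hsymm
  have hg' : ∀ i c, ∀ᵐ x ∂(volume.restrict (cell L)), g i x c = pderiv i (V c) x := fun i c => by
    have h1 : ∀ k ∉ K, ∀ c, fc (g i) k c = 0 := fun k hk c => by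
      rw [(hg i).fc_eq hL, hK k hk, mul_zero]
    filter_upwards [ae_eq_trig hL h1 c] with x hx
    rw [hx, hd]
    simp only [(hg i).fc_eq hL]
  have hy' : ∀ c, ∀ᵐ x ∂(volume.restrict (cell L)),
      y x c = -∑ l, pderiv l (pderiv l (V c)) x := fun c => by
    have h1 : ∀ k ∉ K, ∀ c, fc y k c = 0 := fun k hk c => by
      rw [hy, hK k hk, mul_zero]
    filter_upwards [ae_eq_trig hL h1 c] with x hx
    rw [hx, Fin.sum_univ_two, hdd, hdd, hadd, ← sub_eq_zero, sub_neg_eq_add, hadd, ← hzero x]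
    congr 1
    ext k
    rw [hy, symb, Fin.sum_univ_two]
    push_cast
    linear_combination ((wave L k 0 : ℂ) ^ 2 + (wave L k 1 : ℂ) ^ 2) * fc (v : L2 L) k c *
      Complex.I_sq
  have hv' : ∀ c, ∀ᵐ x ∂(volume.restrict (cell L)), (v : L2 L) x c = V c x := fun c =>
    ae_eq_trig hL hK c
  rw [tri, ← neg_eq_zero, ← integral_neg, ← hmain]
  refine integral_congr_ae ?_
  filter_upwards [ae_all_iff.2 hv', ae_all_iff.2 hy', ae_all_iff.2 fun i => ae_all_iff.2 (hg' i)]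
    with x h1 h2 h3
  simp only [h1, h2, h3, mul_neg, Finset.sum_neg_distrib, neg_neg]

/-! ### Bounds for the trilinear form -/

theorem integral_norm_mul_norm_le {L : ℝ} (u v : L2 L) :
    ∫ x in cell L, ‖u x‖ * ‖v x‖ ≤ ‖u‖ * ‖v‖ := by
  have hu := (Lp.memLp u).norm
  have hv := (Lp.memLp v).norm
  have h1 := real_inner_le_norm (hu.toLp _) (hv.toLp _)
  rw [MeasureTheory.L2.inner_def, Lp.norm_toLp, Lp.norm_toLp, eLpNorm_norm, eLpNorm_norm,
    ← Lp.norm_def, ← Lp.norm_def] at h1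
  refine le_trans (le_of_eq (integral_congr_ae ?_)) h1
  filter_upwards [hu.coeFn_toLp, hv.coeFn_toLp] with x h2 h3
  rw [h2, h3]
  simp [mul_comm]

theorem integrable_norm_mul_norm {L : ℝ} (u v : L2 L) :
    IntegrableOn (fun x => ‖u x‖ * ‖v x‖) (cell L) :=
  (Lp.memLp u).norm.integrable_mul (Lp.memLp v).norm

theorem abs_apply_le_norm (z : EuclideanSpace ℝ (Fin 2)) (i : Fin 2) : |z i| ≤ ‖z‖ := by
  simpa using PiLp.norm_apply_le z i

theorem integrable_tri {L : ℝ} (u : L2 L) (g : Fin 2 → L2 L) (y : L2 L) {M : ℝ}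
    (hy : ∀ j, ∀ᵐ x ∂(volume.restrict (cell L)), |y x j| ≤ M) (i j : Fin 2) :
    IntegrableOn (fun x => u x i * g i x j * y x j) (cell L) :=
  (((memLp_comp u i).integrable_mul (memLp_comp (g i) j)).mul_bdd (c := M)
    (memLp_comp y j).1 (by simpa using hy j))

theorem tri_add_left {L : ℝ} (u u' : L2 L) (g : Fin 2 → L2 L) (y : L2 L) {M : ℝ}
    (hy : ∀ j, ∀ᵐ x ∂(volume.restrict (cell L)), |y x j| ≤ M) :
    tri (u + u') g y = tri u g y + tri u' g y := by
  rw [tri, tri, tri, ← integral_add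
    (integrable_finsetSum _ fun i _ => integrable_finsetSum _ fun j _ =>
      integrable_tri u g y hy i j)
    (integrable_finsetSum _ fun i _ => integrable_finsetSum _ fun j _ =>
      integrable_tri u' g y hy i j)]
  refine integral_congr_ae ?_
  filter_upwards [Lp.coeFn_add u u'] with x hx
  simp only [hx, Pi.add_apply, PiLp.add_apply, add_mul, Finset.sum_add_distrib]

theorem tri_add_right {L : ℝ} (u : L2 L) (g g' : Fin 2 → L2 L) (y : L2 L) {M : ℝ}
    (hy : ∀ j, ∀ᵐ x ∂(volume.restrict (cell L)), |y x j| ≤ M) :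
    tri u (fun i => g i + g' i) y = tri u g y + tri u g' y := by
  rw [tri, tri, tri, ← integral_add
    (integrable_finsetSum _ fun i _ => integrable_finsetSum _ fun j _ =>
      integrable_tri u g y hy i j)
    (integrable_finsetSum _ fun i _ => integrable_finsetSum _ fun j _ =>
      integrable_tri u g' y hy i j)]
  refine integral_congr_ae ?_
  filter_upwards [ae_all_iff.2 fun i => Lp.coeFn_add (g i) (g' i)] with x hx
  simp only [hx, Pi.add_apply, PiLp.add_apply, add_mul, mul_add, Finset.sum_add_distrib]

theorem abs_integral_sum_sum_le {L C : ℝ} {f : Fin 2 → Fin 2 → (Fin 2 → ℝ) → ℝ}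
    {F : Fin 2 → (Fin 2 → ℝ) → ℝ} (hF : ∀ i, IntegrableOn (F i) (cell L))
    (hf : ∀ i j, ∀ᵐ x ∂(volume.restrict (cell L)), |f i j x| ≤ F i x)
    (hC : ∀ i, ∫ x in cell L, F i x ≤ C) :
    |∫ x in cell L, ∑ i, ∑ j, f i j x| ≤ 4 * C := by
  have h1 : |∫ x in cell L, ∑ i, ∑ j, f i j x| ≤ ∫ x in cell L, ∑ i, ∑ _j : Fin 2, F i x := by
    refine norm_integral_le_of_norm_le (G := ℝ)
      (integrable_finsetSum _ fun i _ => integrable_finsetSum _ fun j _ => hF i) ?_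
    filter_upwards [ae_all_iff.2 fun i => ae_all_iff.2 (hf i)] with x hx
    exact (norm_sum_le _ _).trans (Finset.sum_le_sum fun i _ =>
      (norm_sum_le _ _).trans (Finset.sum_le_sum fun j _ => hx i j))
  have h2 : ∫ x in cell L, ∑ i, ∑ _j : Fin 2, F i x = ∑ i, ∑ _j : Fin 2, ∫ x in cell L, F i x := by
    rw [integral_finsetSum _ fun i _ => integrable_finsetSum _ fun j _ => hF i]
    exact Finset.sum_congr rfl fun i _ => integral_finsetSum _ fun j _ => hF i
  refine (h1.trans_eq h2).trans ?_
  simp only [Fin.sum_univ_two]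
  linarith [hC 0, hC 1]

theorem integral_const_mul_norm_mul_norm_le {L M G : ℝ} (hM : 0 ≤ M) (u g : L2 L) (hg : ‖g‖ ≤ G) :
    ∫ x in cell L, M * (‖u x‖ * ‖g x‖) ≤ M * (‖u‖ * G) := by
  rw [integral_const_mul]
  exact mul_le_mul_of_nonneg_left ((integral_norm_mul_norm_le u g).trans
    (mul_le_mul_of_nonneg_left hg (norm_nonneg _))) hM

theorem abs_tri_le_of_right {L : ℝ} (u : L2 L) (g : Fin 2 → L2 L) (y : L2 L) {M G : ℝ}
    (hM : 0 ≤ M) (hy : ∀ j, ∀ᵐ x ∂(volume.restrict (cell L)), |y x j| ≤ M)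
    (hg : ∀ i, ‖g i‖ ≤ G) : |tri u g y| ≤ 4 * (M * (‖u‖ * G)) := by
  refine abs_integral_sum_sum_le (fun i => (integrable_norm_mul_norm u (g i)).const_mul M)
    (fun i j => ?_) fun i => integral_const_mul_norm_mul_norm_le hM u (g i) (hg i)
  filter_upwards [hy j] with x hx
  rw [abs_mul, abs_mul, mul_comm M]
  gcongr
  · exact abs_apply_le_norm _ _
  · exact abs_apply_le_norm _ _

theorem abs_tri_le_of_left {L : ℝ} (u : L2 L) (g : Fin 2 → L2 L) (y : L2 L) {M G : ℝ}
    (hM : 0 ≤ M) (hu : ∀ j, ∀ᵐ x ∂(volume.restrict (cell L)), |u x j| ≤ M)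
    (hg : ∀ i, ‖g i‖ ≤ G) : |tri u g y| ≤ 4 * (M * (‖y‖ * G)) := by
  refine abs_integral_sum_sum_le (fun i => (integrable_norm_mul_norm y (g i)).const_mul M)
    (fun i j => ?_) fun i => integral_const_mul_norm_mul_norm_le hM y (g i) (hg i)
  filter_upwards [hu i] with x hx
  rw [abs_mul, abs_mul, mul_assoc, mul_comm |g i x j|]
  gcongr
  · exact abs_apply_le_norm _ _
  · exact abs_apply_le_norm _ _

/-! ### Lattice sums and uniform bounds for truncated fields -/

theorem norm_sq_le_symb {L : ℝ} (k : Fin 2 → ℤ) :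
    (2 * Real.pi / L) ^ 2 * ‖k‖ ^ 2 ≤ symb L k := by
  have h1 : ‖k‖ ^ 2 ≤ ∑ i, (k i : ℝ) ^ 2 := by
    obtain ⟨i, hi⟩ : ∃ i, ‖k‖ = ‖k i‖ := by
      obtain ⟨i, _, hi⟩ := Finset.exists_max_image Finset.univ (fun i => ‖k i‖)
        ⟨0, Finset.mem_univ _⟩
      exact ⟨i, le_antisymm ((pi_norm_le_iff_of_nonneg (norm_nonneg _)).2 fun j =>
        hi j (Finset.mem_univ _)) (norm_le_pi_norm k i)⟩
    rw [hi, Int.norm_eq_abs, sq_abs]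
    exact Finset.single_le_sum (f := fun i => (k i : ℝ) ^ 2) (fun _ _ => sq_nonneg _)
      (Finset.mem_univ i)
  simp only [symb, wave, mul_pow, ← Finset.mul_sum] at h1 ⊢
  exact mul_le_mul_of_nonneg_left h1 (by positivity)

theorem summable_symb_inv_sq {L : ℝ} (hL : 0 < L) :
    Summable fun k : Fin 2 → ℤ => (symb L k ^ 2)⁻¹ := by
  have h := (EisensteinSeries.summable_one_div_norm_rpow (k := 4) (by norm_num)).mul_left
    ((2 * Real.pi / L) ^ 4)⁻¹
  refine Summable.of_nonneg_of_le (fun k => by positivity) (fun k => ?_) h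
  by_cases hk : k = 0
  · subst hk
    have : symb L 0 = 0 := by simp [symb, wave]
    rw [this]
    simp
  · have h0 : 0 < ‖k‖ := norm_pos_iff.2 hk
    have hk4 : ‖k‖ ^ (-4 : ℝ) = (‖k‖ ^ 4)⁻¹ := by
      rw [Real.rpow_neg h0.le]; norm_cast
    rw [hk4, ← mul_inv]
    refine inv_anti₀ (by positivity) ?_
    calc (2 * Real.pi / L) ^ 4 * ‖k‖ ^ 4 = ((2 * Real.pi / L) ^ 2 * ‖k‖ ^ 2) ^ 2 := by ring
      _ ≤ symb L k ^ 2 := pow_le_pow_left₀ (by positivity) (norm_sq_le_symb k) 2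

/-- In two dimensions the number of frequencies whose symbol is at most `R` is `O(R)`. -/
theorem exists_finset_symb_le {L : ℝ} (hL : 0 < L) : ∃ C : ℝ, 0 ≤ C ∧ ∀ R : ℝ, 1 ≤ R →
    ∃ K : Finset (Fin 2 → ℤ), (∀ k, symb L k ≤ R → k ∈ K) ∧ (K.card : ℝ) ≤ C ^ 2 * R := by
  set κ := 2 * Real.pi / L with hκ
  have hκ0 : 0 < κ := by positivity
  refine ⟨2 / κ + 1, by positivity, fun R hR => ?_⟩
  set m := ⌊√R / κ⌋₊ with hm
  refine ⟨Fintype.piFinset fun _ => Finset.Icc (-(m : ℤ)) m, fun k hk => ?_, ?_⟩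
  · have h1 : κ * ‖k‖ ≤ √R := by
      refine Real.le_sqrt_of_sq_le ?_
      rw [mul_pow]
      exact (norm_sq_le_symb k).trans hk
    have h2 : ‖k‖ ≤ √R / κ := by rw [le_div_iff₀ hκ0]; linarith
    refine Fintype.mem_piFinset.2 fun i => Finset.mem_Icc.2 (abs_le.1 ?_)
    have h3 : ((k i).natAbs : ℝ) ≤ √R / κ := by
      refine le_trans (le_of_eq ?_) ((norm_le_pi_norm k i).trans h2)
      rw [Int.norm_eq_abs, Nat.cast_natAbs, Int.cast_abs]
    have h4 : (k i).natAbs ≤ m := Nat.le_floor h3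
    rw [Int.abs_eq_natAbs]
    exact_mod_cast h4
  · have h1 : (m : ℝ) ≤ √R / κ := Nat.floor_le (by positivity)
    have h2 : 1 ≤ √R := Real.one_le_sqrt.2 hR
    have h3 : ((Fintype.piFinset fun _ : Fin 2 => Finset.Icc (-(m : ℤ)) m).card : ℝ) =
        (2 * m + 1) ^ 2 := by
      rw [Fintype.card_piFinset]
      simp only [Int.card_Icc, Finset.prod_const, Finset.card_univ, Fintype.card_fin]
      have : ((m : ℤ) + 1 - -(m : ℤ)).toNat = 2 * m + 1 := by omega
      rw [this]
      push_cast
      ring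
    rw [h3]
    calc (2 * (m : ℝ) + 1) ^ 2 ≤ ((2 / κ + 1) * √R) ^ 2 := by
          refine pow_le_pow_left₀ (by positivity) ?_ 2
          calc 2 * (m : ℝ) + 1 ≤ 2 * (√R / κ) + √R := by linarith
            _ = _ := by ring
      _ = _ := by rw [mul_pow, Real.sq_sqrt (by linarith)]

theorem sum_fc_sq_le {L : ℝ} (hL : 0 < L) (u : L2 L) (K : Finset (Fin 2 → ℤ)) (c : Fin 2) :
    ∑ k ∈ K, ‖fc u k c‖ ^ 2 ≤ (L⁻¹ * ‖u‖) ^ 2 := by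
  rw [mul_pow, inv_pow]
  refine le_trans (Finset.sum_le_sum fun k _ => ?_)
    (sum_le_hasSum K (fun k _ => Finset.sum_nonneg fun c _ => sq_nonneg _) (hasSum_fc_sq hL u))
  exact Finset.single_le_sum (f := fun c => ‖fc u k c‖ ^ 2) (fun _ _ => sq_nonneg _)
    (Finset.mem_univ c)

/-- A field with `card K` frequencies is bounded by `√(card K)` times its `L²` norm. -/
theorem sum_norm_fc_le_card {L : ℝ} (hL : 0 < L) (u : L2 L) (K : Finset (Fin 2 → ℤ)) (c : Fin 2) :
    ∑ k ∈ K, ‖fc u k c‖ ≤ √K.card * (L⁻¹ * ‖u‖) := by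
  have h := sum_fc_sq_le hL u K c
  have h2 := sq_sum_le_card_mul_sum_sq (s := K) (f := fun k => ‖fc u k c‖)
  refine abs_le_of_sq_le_sq' ?_ (by positivity) |>.2
  rw [mul_pow, Real.sq_sqrt (by positivity)]
  exact h2.trans (mul_le_mul_of_nonneg_left h (by positivity))

/-- In two dimensions `‖v‖_∞ ≤ C ‖Δ v‖`, since `∑ |k|⁻⁴` converges on `ℤ² ∖ {0}`. -/
theorem sum_norm_fc_le_laplacian {L : ℝ} (hL : 0 < L) (v : H L) (y : L2 L)
    (hy : ∀ k c, fc y k c = symb L k * fc (v : L2 L) k c) (K : Finset (Fin 2 → ℤ)) (c : Fin 2) :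
    ∑ k ∈ K, ‖fc (v : L2 L) k c‖ ≤
      √(∑' k : Fin 2 → ℤ, (symb L k ^ 2)⁻¹) * (L⁻¹ * ‖y‖) := by
  have h := sum_fc_sq_le hL y K c
  have h1 : ∀ k, ‖fc (v : L2 L) k c‖ = (symb L k)⁻¹ * ‖fc y k c‖ := fun k => by
    by_cases hk : k = 0
    · rw [hk, fc_zero_of_mem_H, hy, fc_zero_of_mem_H]; simp
    · have := symb_pos hL hk
      rw [hy, norm_mul, Complex.norm_real, Real.norm_eq_abs, abs_of_pos this]
      field_simp
  simp only [h1]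
  refine abs_le_of_sq_le_sq' ?_ (by positivity) |>.2
  rw [mul_pow, Real.sq_sqrt (tsum_nonneg fun k => by positivity)]
  refine (Finset.sum_mul_sq_le_sq_mul_sq K _ _).trans ?_
  refine mul_le_mul ?_ h (Finset.sum_nonneg fun _ _ => sq_nonneg _)
    (tsum_nonneg fun k => by positivity)
  simp only [inv_pow]
  exact (summable_symb_inv_sq hL).sum_le_tsum K fun k _ => by positivity

/-! ### Spectral truncation and the energy inequality -/

/-- The indicator of `(-∞, R]`, as a spectral multiplier. -/
def cutoff (R t : ℝ) : ℝ := if t ≤ R then 1 else 0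

theorem cutoff_nonneg (R t : ℝ) : 0 ≤ cutoff R t := by unfold cutoff; split_ifs <;> simp

theorem cutoff_le_one (R t : ℝ) : cutoff R t ≤ 1 := by unfold cutoff; split_ifs <;> simp

theorem cutoff_mul_self (R t : ℝ) : cutoff R t * cutoff R t = cutoff R t := by
  unfold cutoff; split_ifs <;> simp

theorem tendsto_cutoff (t : ℝ) : Tendsto (fun n : ℕ => cutoff n t) atTop (nhds 1) := by
  refine tendsto_const_nhds.congr' ?_
  obtain ⟨N, hN⟩ := exists_nat_ge t
  filter_upwards [eventually_ge_atTop N] with n hn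
  rw [cutoff, if_pos (hN.trans (by exact_mod_cast hn))]

theorem tendsto_tsum_cutoff {ι : Type*} {f lam : ι → ℝ} (hf : Summable f) :
    Tendsto (fun n : ℕ => ∑' j, cutoff n (lam j) * f j) atTop (nhds (∑' j, f j)) := by
  refine tendsto_tsum_of_dominated_convergence hf.abs (fun j => ?_) (Eventually.of_forall
    fun n j => ?_)
  · simpa using (tendsto_cutoff (lam j)).mul_const (f j)
  · rw [norm_mul, Real.norm_eq_abs, Real.norm_eq_abs, abs_of_nonneg (cutoff_nonneg _ _)]
    exact mul_le_of_le_one_left (abs_nonneg _) (cutoff_le_one _ _)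

theorem summable_cutoff_mul {ι : Type*} {f lam : ι → ℝ} (hf : Summable f) (R : ℝ) :
    Summable fun j => cutoff R (lam j) * f j := by
  refine Summable.of_norm_bounded hf.abs fun j => ?_
  rw [norm_mul, Real.norm_eq_abs, Real.norm_eq_abs, abs_of_nonneg (cutoff_nonneg _ _)]
  exact mul_le_of_le_one_left (abs_nonneg _) (cutoff_le_one _ _)

section Energy

variable {L : ℝ} {ζ : HilbertBasis ℕ ℝ (H L)} {lam : ℕ → ℝ}

/-- The nonlinear term tested against the truncation `y` of `A u` at spectral level `n` is small:
it is bounded by `ε n (‖y‖² + ‖y‖)` with `ε n → 0`. -/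
theorem exists_bound_tri (hL : 0 < L) (hζ : IsEigenbasis ζ lam) {u : H L} (hu : u ∈ V L) :
    ∃ ε : ℕ → ℝ, Tendsto ε atTop (nhds 0) ∧ ∀ n : ℕ, 1 ≤ n → ∀ y : H L,
      (∀ j, ⟪ζ j, y⟫ = cutoff n (lam j) * lam j * ⟪ζ j, u⟫) →
        |trilinear u u y| ≤ ε n * (‖y‖ ^ 2 + ‖y‖) := by
  obtain ⟨C, hC0, hC⟩ := exists_finset_symb_le hL
  set D := √(∑' k : Fin 2 → ℤ, (symb L k ^ 2)⁻¹)
  set g : Fin 2 → L2 L := fun i => weakDeriv i (u : L2 L) with hg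
  have hgd : ∀ i, HasWeakDeriv i (u : L2 L) (g i) := hasWeakDeriv_of_mem_V hu
  have hsum : ∀ i, HasSum (fun k => ∑ c, ‖fc (g i) k c‖ ^ 2) ((L ^ 2)⁻¹ * ‖g i‖ ^ 2) :=
    fun i => hasSum_fc_sq hL (g i)
  -- the squared `L²` norm of the gradient of the part of `u` above level `n`
  set τ : ℕ → ℝ := fun n => L ^ 2 * ∑ i, ((L ^ 2)⁻¹ * ‖g i‖ ^ 2 -
    ∑' k, cutoff n (symb L k) * ∑ c, ‖fc (g i) k c‖ ^ 2) with hτ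
  have hτ0 : Tendsto τ atTop (nhds 0) := by
    have h1 : ∀ i, Tendsto (fun n : ℕ => (L ^ 2)⁻¹ * ‖g i‖ ^ 2 -
        ∑' k, cutoff n (symb L k) * ∑ c, ‖fc (g i) k c‖ ^ 2) atTop (nhds 0) := fun i => by
      have := (tendsto_tsum_cutoff (lam := symb L) (hsum i).summable).const_sub
        ((L ^ 2)⁻¹ * ‖g i‖ ^ 2)
      rwa [(hsum i).tsum_eq, sub_self] at this
    have h2 := (tendsto_finsetSum Finset.univ fun i _ => h1 i).const_mul (L ^ 2)
    rw [Finset.sum_const_zero, mul_zero] at h2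
    exact h2
  set G := ‖g 0‖ + ‖g 1‖
  refine ⟨fun n => 4 * (D * L⁻¹ + C * L⁻¹ * G) * √(τ n), ?_, fun n hn y hy => ?_⟩
  · have := (Real.continuous_sqrt.tendsto 0).comp hτ0
    rw [Real.sqrt_zero] at this
    simpa using this.const_mul (4 * (D * L⁻¹ + C * L⁻¹ * G))
  obtain ⟨K, hK, hKcard⟩ := hC n (by exact_mod_cast hn)
  obtain ⟨v, hv, -⟩ := exists_of_summable_sq (ζ := ζ)
    (c := fun j => cutoff n (lam j) * ⟪ζ j, u⟫) (by
      have := summable_cutoff_mul (lam := lam) (hasSum_basis_sq (ζ := ζ) u).summable n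
      refine this.congr fun j => ?_
      rw [mul_pow, sq (cutoff _ _), cutoff_mul_self])
  have hvf : ∀ k c, fc (v : L2 L) k c = cutoff n (symb L k) * fc (u : L2 L) k c :=
    fc_multiplier hL hζ (cutoff n) hv
  have hyf : ∀ k c, fc (y : L2 L) k c = symb L k * fc (v : L2 L) k c := fun k c => by
    rw [fc_multiplier hL hζ (fun t => cutoff n t * t) hy, hvf]
    push_cast
    ring
  have hvK : ∀ k ∉ K, ∀ c, fc (v : L2 L) k c = 0 := fun k hk c => by
    rw [hvf, cutoff, if_neg fun h => hk (hK k h)]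
    simp
  have hyK : ∀ k ∉ K, ∀ c, fc (y : L2 L) k c = 0 := fun k hk c => by
    rw [hyf, hvK k hk, mul_zero]
  have hvV : v ∈ V L := mem_V_of_summable hL hζ (by
    refine (summable_cutoff_mul (lam := lam) (summable_lam_mul_sq hL hζ hu) n).congr fun j => ?_
    rw [hv, mul_pow, sq (cutoff _ _), cutoff_mul_self]
    ring)
  set g' : Fin 2 → L2 L := fun i => weakDeriv i (v : L2 L) with hg'
  have hgd' : ∀ i, HasWeakDeriv i (v : L2 L) (g' i) := hasWeakDeriv_of_mem_V hvV
  have hfg : ∀ i k c, fc (g i - g' i) k c = (1 - cutoff n (symb L k) : ℝ) * fc (g i) k c :=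
    fun i k c => by
      rw [fc_sub hL, (hgd i).fc_eq hL, (hgd' i).fc_eq hL, hvf]
      push_cast
      ring
  have hnorm : ∑ i, ‖g i - g' i‖ ^ 2 = τ n := by
    have h1 : ∀ i, (L ^ 2)⁻¹ * ‖g i - g' i‖ ^ 2 = (L ^ 2)⁻¹ * ‖g i‖ ^ 2 -
        ∑' k, cutoff n (symb L k) * ∑ c, ‖fc (g i) k c‖ ^ 2 := fun i => by
      have h2 := (hsum i).sub (summable_cutoff_mul (lam := symb L) (hsum i).summable n).hasSum
      refine (hasSum_fc_sq hL (g i - g' i)).unique ?_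
      convert! h2 using 2 with k
      rw [Finset.mul_sum, ← Finset.sum_sub_distrib]
      refine Finset.sum_congr rfl fun c _ => ?_
      rw [hfg, norm_mul, Complex.norm_real, mul_pow, Real.norm_eq_abs, sq_abs]
      linear_combination ‖fc (g i) k c‖ ^ 2 * cutoff_mul_self n (symb L k)
    simp only [hτ, ← h1, ← Finset.mul_sum]
    field_simp
  have hτn : 0 ≤ τ n := hnorm ▸ Finset.sum_nonneg fun _ _ => sq_nonneg _
  have hgn : ∀ i, ‖g i - g' i‖ ≤ √(τ n) := fun i => Real.le_sqrt_of_sq_le (hnorm ▸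
    Finset.single_le_sum (f := fun i => ‖g i - g' i‖ ^ 2) (fun _ _ => sq_nonneg _)
      (Finset.mem_univ i))
  -- a field with frequencies beyond level `n` gains a factor `√n` over its gradient
  have hw : √n * ‖(u : L2 L) - (v : L2 L)‖ ≤ √(τ n) := by
    refine Real.le_sqrt_of_sq_le ?_
    rw [mul_pow, Real.sq_sqrt (by positivity), ← hnorm]
    have h1 : HasSum (fun k => ∑ i, ∑ c, ‖fc (g i - g' i) k c‖ ^ 2)
        ((L ^ 2)⁻¹ * ∑ i, ‖g i - g' i‖ ^ 2) := by
      rw [Finset.mul_sum]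
      exact hasSum_sum fun i _ => hasSum_fc_sq hL _
    have h2 := (hasSum_fc_sq hL ((u : L2 L) - (v : L2 L))).mul_left (n : ℝ)
    have h3 : (n : ℝ) * ((L ^ 2)⁻¹ * ‖(u : L2 L) - (v : L2 L)‖ ^ 2) ≤
        (L ^ 2)⁻¹ * ∑ i, ‖g i - g' i‖ ^ 2 := by
      refine hasSum_le (fun k => ?_) h2 h1
      rw [Finset.sum_comm, Finset.mul_sum]
      refine Finset.sum_le_sum fun c _ => ?_
      have h4 : ∀ i, ‖fc (g i - g' i) k c‖ ^ 2 =
          wave L k i ^ 2 * ‖fc ((u : L2 L) - (v : L2 L)) k c‖ ^ 2 := fun i => by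
        rw [fc_sub hL, fc_sub hL, (hgd i).fc_eq hL, (hgd' i).fc_eq hL, ← mul_sub, norm_mul,
          norm_mul, Complex.norm_I, Complex.norm_real, one_mul, mul_pow, Real.norm_eq_abs, sq_abs]
      simp only [h4, ← Finset.sum_mul]
      by_cases hk : symb L k ≤ n
      · rw [fc_sub hL, hvf, cutoff, if_pos hk]
        simp
      · exact mul_le_mul_of_nonneg_right (not_le.1 hk).le (sq_nonneg _)
    have h5 : (L ^ 2)⁻¹ * ((n : ℝ) * ‖(u : L2 L) - (v : L2 L)‖ ^ 2) ≤
        (L ^ 2)⁻¹ * ∑ i, ‖g i - g' i‖ ^ 2 := by linarith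
    exact le_of_mul_le_mul_left h5 (by positivity)
  -- uniform bounds for `v` and `y`
  have hvM : ∀ j, ∀ᵐ x ∂(volume.restrict (cell L)), |(v : L2 L) x j| ≤ D * (L⁻¹ * ‖y‖) :=
    fun j => by
      filter_upwards [ae_abs_le_sum_fc hL hvK j] with x hx
      exact hx.trans (sum_norm_fc_le_laplacian hL v y hyf K j)
  have hyM : ∀ j, ∀ᵐ x ∂(volume.restrict (cell L)),
      |(y : L2 L) x j| ≤ C * √n * (L⁻¹ * ‖y‖) := fun j => by
    filter_upwards [ae_abs_le_sum_fc hL hyK j] with x hx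
    refine hx.trans ((sum_norm_fc_le_card hL (y : L2 L) K j).trans ?_)
    refine mul_le_mul_of_nonneg_right ?_ (by positivity)
    refine (Real.sqrt_le_sqrt hKcard).trans (le_of_eq ?_)
    rw [Real.sqrt_mul (by positivity), Real.sqrt_sq hC0]
  -- `b(u, u, y) = b(v, v, y) + b(v, u - v, y) + b(u - v, u, y)`, and the first term vanishes
  have hdecomp : trilinear u u y = tri (v : L2 L) g' (y : L2 L) +
      tri (v : L2 L) (fun i => g i - g' i) (y : L2 L) +
      tri ((u : L2 L) - (v : L2 L)) g (y : L2 L) := by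
    rw [trilinear_eq_tri, ← tri_add_right _ _ _ _ hyM]
    simp only [add_sub_cancel]
    rw [← tri_add_left _ _ _ _ hyM, add_sub_cancel]
  have h0 : tri (v : L2 L) g' (y : L2 L) = 0 := tri_stokes_self hL hvK hgd' hyf
  have h1 : |tri (v : L2 L) (fun i => g i - g' i) (y : L2 L)| ≤
      4 * (D * (L⁻¹ * ‖y‖) * (‖y‖ * √(τ n))) :=
    abs_tri_le_of_left _ _ _ (by positivity) hvM hgn
  have h2 : |tri ((u : L2 L) - (v : L2 L)) g (y : L2 L)| ≤
      4 * (C * √n * (L⁻¹ * ‖y‖) * (‖(u : L2 L) - (v : L2 L)‖ * G)) :=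
    abs_tri_le_of_right _ _ _ (by positivity) hyM (Fin.forall_fin_two.2
      ⟨le_add_of_nonneg_right (norm_nonneg _), le_add_of_nonneg_left (norm_nonneg _)⟩)
  have h3 : 4 * (C * √n * (L⁻¹ * ‖y‖) * (‖(u : L2 L) - (v : L2 L)‖ * G)) ≤
      4 * (C * L⁻¹ * ‖y‖ * G) * √(τ n) := by
    calc _ = 4 * (C * L⁻¹ * ‖y‖ * G) * (√n * ‖(u : L2 L) - (v : L2 L)‖) := by ring
      _ ≤ _ := mul_le_mul_of_nonneg_left hw (by positivity)
  rw [hdecomp, h0, zero_add]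
  refine (abs_add_le _ _).trans ((add_le_add h1 (h2.trans h3)).trans ?_)
  have h4 : 0 ≤ 4 * (D * L⁻¹) * √(τ n) * ‖y‖ := by positivity
  have h5 : 0 ≤ 4 * (C * L⁻¹ * G) * √(τ n) * ‖y‖ ^ 2 := by positivity
  calc _ = 4 * (D * L⁻¹) * √(τ n) * ‖y‖ ^ 2 + 4 * (C * L⁻¹ * G) * √(τ n) * ‖y‖ := by ring
    _ ≤ 4 * (D * L⁻¹) * √(τ n) * ‖y‖ ^ 2 + 4 * (C * L⁻¹ * G) * √(τ n) * ‖y‖ +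
      (4 * (D * L⁻¹) * √(τ n) * ‖y‖ + 4 * (C * L⁻¹ * G) * √(τ n) * ‖y‖ ^ 2) := by linarith
    _ = _ := by ring

/-- A truncated energy balance with negligible nonlinear term passes to the limit. -/
theorem summable_of_truncated_balance {lam a f b ε : ℕ → ℝ} {s h : ℝ} (hs : 0 < s)
    (hh : 0 < h) (hf : Summable f) (hε : Tendsto ε atTop (nhds 0)) (d : ℕ → ℝ) (hd : ∀ n, 0 ≤ d n)
    (hd2 : ∀ n : ℕ, 1 ≤ n → HasSum (fun j => cutoff n (lam j) * a j ^ 2) (d n ^ 2))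
    (hb : ∀ n : ℕ, 1 ≤ n → |b n| ≤ ε n * (d n ^ 2 + d n))
    (heq : ∀ n : ℕ, 1 ≤ n → s * d n ^ 2 + h * b n = ∑' j, cutoff n (lam j) * f j) :
    Summable (fun j => a j ^ 2) ∧ s * ∑' j, a j ^ 2 = ∑' j, f j := by
  have hF := tendsto_tsum_cutoff (lam := lam) hf
  obtain ⟨B, hB⟩ : ∃ B, ∀ᶠ n : ℕ in atTop, ∑' j, cutoff n (lam j) * f j ≤ B :=
    ⟨∑' j, f j + 1, (hF.eventually_lt_const (lt_add_one _)).mono fun n hn => hn.le⟩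
  have hεh : ∀ᶠ n in atTop, h * ε n < s / 4 := by
    have := hε.const_mul h
    rw [mul_zero] at this
    exact this.eventually_lt_const (by positivity)
  have hbd : ∀ᶠ n in atTop, d n ^ 2 ≤ (2 * |B| + s) / s := by
    filter_upwards [hB, hεh, eventually_ge_atTop 1] with n h1 h2 h3
    rw [le_div_iff₀ hs]
    have h4 := heq n h3
    have h5 := neg_abs_le (b n)
    have h6 : h * |b n| ≤ h * (ε n * (d n ^ 2 + d n)) := mul_le_mul_of_nonneg_left (hb n h3) hh.le
    have h7 : h * (ε n * (d n ^ 2 + d n)) ≤ s / 4 * (d n ^ 2 + d n) := by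
      rw [← mul_assoc]
      exact mul_le_mul_of_nonneg_right h2.le (add_nonneg (sq_nonneg _) (hd n))
    have h8 : d n ≤ d n ^ 2 + 1 := by nlinarith [sq_nonneg (d n - 1), sq_nonneg (d n)]
    have h9 : s / 4 * (d n ^ 2 + d n) ≤ s / 4 * (2 * d n ^ 2 + 1) :=
      mul_le_mul_of_nonneg_left (by linarith) (by positivity)
    have h10 : h * -|b n| ≤ h * b n := mul_le_mul_of_nonneg_left h5 hh.le
    nlinarith [le_abs_self B]
  have hsum : Summable fun j => a j ^ 2 := by
    refine summable_of_sum_le (c := (2 * |B| + s) / s) (fun _ => sq_nonneg _) fun S => ?_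
    have h1 : ∀ᶠ n : ℕ in atTop, ∀ j ∈ S, cutoff n (lam j) = 1 := by
      rw [Filter.eventually_all_finset]
      intro j _
      obtain ⟨N, hN⟩ := exists_nat_ge (lam j)
      filter_upwards [eventually_ge_atTop N] with n hn
      rw [cutoff, if_pos (hN.trans (by exact_mod_cast hn))]
    obtain ⟨n, h2, h3, h4⟩ := (hbd.and (h1.and (eventually_ge_atTop 1))).exists
    refine le_trans ?_ h2
    refine le_trans (le_of_eq ?_) (sum_le_hasSum S (fun j _ => mul_nonneg (cutoff_nonneg _ _)
      (sq_nonneg _)) (hd2 n h4))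
    exact Finset.sum_congr rfl fun j hj => by rw [h3 j hj, one_mul]
  refine ⟨hsum, ?_⟩
  have hb0 : Tendsto (fun n => h * b n) atTop (nhds 0) := by
    set Q := (2 * |B| + s) / s
    have h1 : Tendsto (fun n => h * (|ε n| * (2 * Q + 1))) atTop (nhds 0) := by
      have := ((hε.abs).mul_const (2 * Q + 1)).const_mul h
      simpa using this
    refine squeeze_zero_norm' ?_ h1
    filter_upwards [hbd, eventually_ge_atTop 1] with n h2 h3
    rw [norm_mul, Real.norm_eq_abs, Real.norm_eq_abs, abs_of_pos hh]
    refine mul_le_mul_of_nonneg_left ((hb n h3).trans ?_) hh.le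
    have h8 : d n ≤ d n ^ 2 + 1 := by nlinarith [sq_nonneg (d n - 1), sq_nonneg (d n)]
    exact mul_le_mul (le_abs_self _) (by linarith) (add_nonneg (sq_nonneg _) (hd n)) (abs_nonneg _)
  have hlim1 : Tendsto (fun n : ℕ => s * ∑' j, cutoff n (lam j) * a j ^ 2 + h * b n) atTop
      (nhds (s * ∑' j, a j ^ 2 + 0)) :=
    ((tendsto_tsum_cutoff (lam := lam) hsum).const_mul s).add hb0
  rw [add_zero] at hlim1
  refine tendsto_nhds_unique hlim1 (hF.congr' ?_)
  filter_upwards [eventually_ge_atTop 1] with n hn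
  rw [(hd2 n hn).tsum_eq, heq n hn]

/-- One implicit Euler step regularises, and satisfies an energy inequality at the level of the
gradient. The step is tested with the truncations `y n` of `A u`; in the modes of the eigenbasis the
limit reads `h ν λⱼ² uⱼ² = λⱼ (wⱼ + u'ⱼ - uⱼ) uⱼ` after summation over `j`. -/
theorem euler_step_energy (hL : 0 < L) (hζ : IsEigenbasis ζ lam) {ν h : ℝ} (hν : 0 < ν)
    (hh : 0 < h) {u u' w : H L} (hu : u ∈ V L) (hu' : u' ∈ V L)
    (hw : Summable fun j => lam j * ⟪ζ j, w⟫ ^ 2)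
    (heq : ∀ φ ∈ V L, ⟪u - u', φ⟫ + h * (ν * ⟪sqrtStokes ζ lam u, sqrtStokes ζ lam φ⟫ +
      trilinear u u φ) = ⟪w, φ⟫) :
    Summable (fun j => lam j ^ 2 * ⟪ζ j, u⟫ ^ 2) ∧
    ‖sqrtStokes ζ lam u‖ ^ 2 + 2 * ν * h * ‖stokes u‖ ^ 2 ≤
      ∑' j, lam j * (⟪ζ j, u'⟫ + ⟪ζ j, w⟫) ^ 2 := by
  obtain ⟨ε, hε, hbound⟩ := exists_bound_tri hL hζ hu
  have hl := fun j => (hζ.lam_pos hL j).le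
  have hsu := summable_lam_mul_sq hL hζ hu
  have hsu' := summable_lam_mul_sq hL hζ hu'
  have hsr : Summable fun j => lam j * (⟪ζ j, u'⟫ + ⟪ζ j, w⟫) ^ 2 := by
    refine Summable.of_nonneg_of_le (fun j => mul_nonneg (hl j) (sq_nonneg _)) (fun j => ?_)
      ((hsu'.add hw).mul_left 2)
    nlinarith [mul_nonneg (hl j) (sq_nonneg (⟪ζ j, u'⟫ - ⟪ζ j, w⟫))]
  set f : ℕ → ℝ := fun j => lam j * ((⟪ζ j, w⟫ - ⟪ζ j, u⟫ + ⟪ζ j, u'⟫) * ⟪ζ j, u⟫) with hf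
  have hfs : Summable f := by
    refine Summable.of_norm_bounded ((hsr.add hsu).mul_left 2) fun j => ?_
    rw [Real.norm_eq_abs, abs_le]
    constructor <;> simp only [hf] <;>
    nlinarith [mul_nonneg (hl j) (sq_nonneg (⟪ζ j, u'⟫ + ⟪ζ j, w⟫ - ⟪ζ j, u⟫)),
      mul_nonneg (hl j) (sq_nonneg (⟪ζ j, u'⟫ + ⟪ζ j, w⟫ + ⟪ζ j, u⟫)),
      mul_nonneg (hl j) (sq_nonneg (⟪ζ j, u'⟫ + ⟪ζ j, w⟫)),
      mul_nonneg (hl j) (sq_nonneg (⟪ζ j, u⟫))]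
  have hcut : ∀ (n : ℕ) j, cutoff n (lam j) * lam j ^ 2 * ⟪ζ j, u⟫ ^ 2 ≤
      n * (lam j * ⟪ζ j, u⟫ ^ 2) := fun n j => by
    unfold cutoff
    split_ifs with hj
    · nlinarith [mul_nonneg (hl j) (sq_nonneg ⟪ζ j, u⟫)]
    · simp only [zero_mul]
      exact mul_nonneg (Nat.cast_nonneg _) (mul_nonneg (hl j) (sq_nonneg _))
  have hsq : ∀ n : ℕ, Summable fun j => (cutoff n (lam j) * lam j * ⟪ζ j, u⟫) ^ 2 := fun n => by
    refine Summable.of_nonneg_of_le (fun j => sq_nonneg _) (fun j => ?_) (hsu.mul_left (n : ℝ))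
    rw [mul_pow, mul_pow, sq (cutoff _ _), cutoff_mul_self]
    exact hcut n j
  choose y hy _ using fun n : ℕ => exists_of_summable_sq (ζ := ζ) (hsq n)
  have hyV : ∀ n, y n ∈ V L := fun n => mem_V_of_summable hL hζ (by
    refine Summable.of_nonneg_of_le (fun j => mul_nonneg (hl j) (sq_nonneg _)) (fun j => ?_)
      (hsu.mul_left ((n : ℝ) ^ 2))
    rw [hy, mul_pow, mul_pow, sq (cutoff _ _), cutoff_mul_self]
    unfold cutoff
    split_ifs with hj
    · have : lam j ^ 2 ≤ (n : ℝ) ^ 2 := pow_le_pow_left₀ (hl j) hj 2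
      nlinarith [mul_nonneg (hl j) (sq_nonneg ⟪ζ j, u⟫)]
    · simp only [zero_mul, mul_zero]
      exact mul_nonneg (sq_nonneg _) (mul_nonneg (hl j) (sq_nonneg _)))
  have hyn : ∀ n : ℕ, HasSum (fun j => cutoff n (lam j) * (lam j * ⟪ζ j, u⟫) ^ 2) (‖y n‖ ^ 2) :=
    fun n => by
      convert! hasSum_basis_sq (ζ := ζ) (y n) using 2 with j
      rw [hy]
      linear_combination (-(lam j * ⟪ζ j, u⟫) ^ 2) * cutoff_mul_self n (lam j)
  have hsy : ∀ n, ⟪sqrtStokes ζ lam u, sqrtStokes ζ lam (y n)⟫ = ‖y n‖ ^ 2 := fun n => by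
    refine (hasSum_inner_sqrtStokes hL hζ hu (hyV n)).unique ?_
    convert! hyn n using 2 with j
    rw [hy]; ring
  have hmain := summable_of_truncated_balance (lam := lam) (a := fun j => lam j * ⟪ζ j, u⟫)
    (f := f) (b := fun n => trilinear u u (y n)) (s := h * ν) (h := h) (by positivity) hh hfs hε
    (fun n => ‖y n‖) (fun n => norm_nonneg _) (fun n _ => hyn n)
    (fun n hn => hbound n hn (y n) (hy n)) (fun n _ => by
      have h1 := heq (y n) (hyV n)
      have h2 : HasSum (fun j => cutoff n (lam j) * f j) ⟪w - (u - u'), y n⟫ := by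
        convert! ζ.hasSum_inner_mul_inner (w - (u - u')) (y n) using 2 with j
        rw [real_inner_comm (ζ j), inner_sub_right, inner_sub_right, hy]
        simp only [hf]
        ring
      rw [h2.tsum_eq, inner_sub_left, ← h1, hsy]
      ring)
  simp only [mul_pow] at hmain
  refine ⟨hmain.1, ?_⟩
  rw [(hasSum_stokes_sq hL hζ hmain.1).tsum_eq] at hmain
  have h3 := (hasSum_sqrtStokes_sq hL hζ hu).add (hfs.hasSum.mul_left 2)
  rw [← hmain.2] at h3
  calc _ = ‖sqrtStokes ζ lam u‖ ^ 2 + 2 * (h * ν * ‖stokes u‖ ^ 2) := by ring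
    _ ≤ _ := by
      refine hasSum_le (fun j => ?_) h3 hsr.hasSum
      simp only [hf]
      nlinarith [mul_nonneg (hl j) (sq_nonneg (⟪ζ j, u'⟫ + ⟪ζ j, w⟫ - ⟪ζ j, u⟫))]

end Energy

/-! ### Gaussian exponential moments -/

/-- Exponential moment of a quadratic polynomial of a centred Gaussian variable of variance `h`.
With `s = 1 - 2 A h`, completing the square turns the integrand, multiplied by the Gaussian density,
into a Gaussian density of variance `h / s`, up to the factor `s ^ (-1 / 2) ≤ exp (2 A h)` and a
factor `exp (B² h / (2 s) - w) ≤ 1`. -/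
theorem lintegral_exp_quadratic_gaussianReal_le {h : ℝ≥0} (hh : h ≠ 0) {A B w : ℝ}
    (hA : 0 ≤ A) (hA2 : 2 * A * h ≤ 1 / 2) (hw : B ^ 2 * h ≤ w * (2 * (1 - 2 * A * h))) :
    ∫⁻ x, ENNReal.ofReal (Real.exp (A * x ^ 2 + B * x - w)) ∂gaussianReal 0 h ≤
      ENNReal.ofReal (Real.exp (2 * A * h)) := by
  have hh0 : (0 : ℝ) < h := by exact_mod_cast pos_iff_ne_zero.2 hh
  set s : ℝ := 1 - 2 * A * h with hs
  have hs0 : 1 / 2 ≤ s := by linarith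
  have hsp : 0 < s := by linarith
  clear_value s
  set h' : ℝ≥0 := ⟨h / s, by positivity⟩ with hh'
  have hh'0 : h' ≠ 0 := by
    rw [← NNReal.coe_ne_zero]
    exact (div_pos hh0 hsp).ne'
  have hcoe : (h' : ℝ) = h / s := rfl
  have hpt : ∀ x, gaussianPDFReal 0 h x * Real.exp (A * x ^ 2 + B * x - w) ≤
      Real.exp (2 * A * h) * gaussianPDFReal (B * h') h' x := fun x => by
    rw [gaussianPDFReal, gaussianPDFReal, mul_assoc, ← Real.exp_add]
    have e1 : -(x - 0) ^ 2 / (2 * h) + (A * x ^ 2 + B * x - w) =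
        -(x - B * h') ^ 2 / (2 * h') + (B ^ 2 * h / (2 * s) - w) := by
      have hAe : A = (1 - s) / (2 * h) := by rw [hs]; field_simp; ring
      rw [hcoe, hAe]
      field_simp
      ring
    have e2 : Real.exp (B ^ 2 * h / (2 * s) - w) ≤ 1 := by
      rw [Real.exp_le_one_iff, sub_nonpos, div_le_iff₀ (by positivity)]
      exact hw
    have e3 : (√(2 * Real.pi * h))⁻¹ ≤ Real.exp (2 * A * h) * (√(2 * Real.pi * h'))⁻¹ := by
      have e4 : √(2 * Real.pi * h') ≤ Real.exp (2 * A * h) * √(2 * Real.pi * h) := by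
        refine Real.sqrt_le_left (by positivity) |>.2 ?_
        rw [mul_pow, Real.sq_sqrt (by positivity), hcoe, ← Real.exp_nat_mul]
        have e5 : 1 / s ≤ Real.exp ((2 : ℕ) * (2 * A * h)) := by
          have e6 : 1 + 2 * (2 * A * h) ≤ Real.exp ((2 : ℕ) * (2 * A * h)) := by
            have := Real.add_one_le_exp ((2 : ℕ) * (2 * A * (h : ℝ)))
            push_cast at this ⊢
            linarith
          refine le_trans ?_ e6
          rw [div_le_iff₀ hsp, hs]
          nlinarith [mul_nonneg hA hh0.le]
        calc 2 * Real.pi * (h / s) = 1 / s * (2 * Real.pi * h) := by ring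
          _ ≤ _ := mul_le_mul_of_nonneg_right e5 (by positivity)
      have hp1 : 0 < √(2 * Real.pi * h) := by positivity
      have hp2 : 0 < √(2 * Real.pi * h') := by
        rw [hcoe]; positivity
      rw [inv_eq_one_div, ← div_eq_mul_inv, div_le_div_iff₀ hp1 hp2, one_mul]
      exact e4
    rw [e1, Real.exp_add]
    calc (√(2 * Real.pi * h))⁻¹ * (Real.exp (-(x - B * h') ^ 2 / (2 * h')) *
          Real.exp (B ^ 2 * h / (2 * s) - w))
        ≤ (Real.exp (2 * A * h) * (√(2 * Real.pi * h'))⁻¹) *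
          (Real.exp (-(x - B * h') ^ 2 / (2 * h')) * 1) := by
          gcongr
      _ = _ := by ring
  rw [gaussianReal_of_var_ne_zero _ hh, lintegral_withDensity_eq_lintegral_mul _
    (measurable_gaussianPDF 0 h) (by fun_prop)]
  calc _ ≤ ∫⁻ x, ENNReal.ofReal (Real.exp (2 * A * h)) * gaussianPDF (B * h') h' x := by
        refine lintegral_mono fun x => ?_
        simp only [Pi.mul_apply, gaussianPDF]
        rw [← ENNReal.ofReal_mul (gaussianPDFReal_nonneg _ _ _),
          ← ENNReal.ofReal_mul (Real.exp_pos _).le]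
        exact ENNReal.ofReal_le_ofReal (hpt x)
    _ = _ := by
        rw [lintegral_const_mul _ (measurable_gaussianPDF _ _),
          lintegral_gaussianPDF_eq_one _ hh'0, mul_one]

section Freezing

variable {Ω : Type*} {𝓕 mΩ : MeasurableSpace Ω} {P : Measure Ω} [IsProbabilityMeasure P]

/-- Freezing lemma: an independent variable may be integrated out first. -/
theorem lintegral_of_indepFun {β γ : Type*} [MeasurableSpace β] [MeasurableSpace γ] {Z : Ω → β}
    {D : Ω → γ} (hZ : Measurable Z) (hD : Measurable D) (h : IndepFun Z D P) {g : β × γ → ℝ≥0∞}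
    (hg : Measurable g) :
    ∫⁻ ω, g (Z ω, D ω) ∂P = ∫⁻ ω, ∫⁻ ω', g (Z ω, D ω') ∂P ∂P := by
  have h1 := (indepFun_iff_map_prod_eq_prod_map_map hZ.aemeasurable hD.aemeasurable).1 h
  have : IsProbabilityMeasure (P.map D) := Measure.isProbabilityMeasure_map hD.aemeasurable
  rw [← lintegral_map (f := g) hg (hZ.prodMk hD), h1, lintegral_prod _ hg.aemeasurable,
    lintegral_map hg.lintegral_prod_right' hZ]
  refine lintegral_congr fun ω => ?_
  exact lintegral_map (hg.comp measurable_prodMk_left) hD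

/-- Conditional exponential moment bound for a quadratic functional of finitely many independent
Gaussian increments with coefficients known at the earlier time. -/
theorem lintegral_mul_exp_sum_le (h𝓕 : 𝓕 ≤ mΩ) {h : ℝ≥0} (hh : h ≠ 0) {D X : ℕ → Ω → ℝ}
    (hD : ∀ j, Measurable (D j)) (hlaw : ∀ j, HasLaw (D j) (gaussianReal 0 h) P)
    (hind : iIndepFun D P)
    (hpast : Indep (⨆ j, MeasurableSpace.comap (D j) inferInstance) 𝓕 P)
    (hX : ∀ j, Measurable[𝓕] (X j)) {A B w : ℕ → ℝ} (hA : ∀ j, 0 ≤ A j)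
    (hA2 : ∀ j, 2 * A j * h ≤ 1 / 2)
    (hw : ∀ j, B j ^ 2 * h ≤ w j * (2 * (1 - 2 * A j * h))) {f : Ω → ℝ≥0∞}
    (hf : Measurable[𝓕] f) (J : ℕ) :
    ∫⁻ ω, f ω * ENNReal.ofReal (Real.exp (∑ j ∈ Finset.range J,
        (A j * D j ω ^ 2 + B j * X j ω * D j ω - w j * X j ω ^ 2))) ∂P ≤
      ENNReal.ofReal (Real.exp (∑ j ∈ Finset.range J, 2 * A j * h)) * ∫⁻ ω, f ω ∂P := by
  have hZ' : Measurable[𝓕] fun ω => (f ω, fun j => X j ω) :=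
    hf.prodMk ((@measurable_pi_iff Ω ℕ (fun _ => ℝ) 𝓕 _ _).2 hX)
  have hZ : Measurable fun ω => (f ω, fun j => X j ω) := hZ'.mono h𝓕 le_rfl
  have hDm : Measurable fun ω => fun j => D j ω := measurable_pi_iff.2 hD
  have hDm' : Measurable[⨆ j, MeasurableSpace.comap (D j) inferInstance]
      fun ω => fun j => D j ω := by
    refine (@measurable_pi_iff Ω ℕ (fun _ => ℝ) (⨆ j, MeasurableSpace.comap (D j) inferInstance)
      _ _).2 fun j => ?_
    exact (comap_measurable (D j)).mono
      (le_iSup (fun j => MeasurableSpace.comap (D j) inferInstance) j) le_rfl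
  have hindep : IndepFun (fun ω => (f ω, fun j => X j ω)) (fun ω => fun j => D j ω) P := by
    rw [IndepFun_iff_Indep]
    exact indep_of_indep_of_le_left (indep_of_indep_of_le_right hpast.symm hDm'.comap_le)
      hZ'.comap_le
  set e : ℕ → (ℝ≥0∞ × (ℕ → ℝ)) × (ℕ → ℝ) → ℝ≥0∞ := fun j p => ENNReal.ofReal (Real.exp
    (A j * p.2 j ^ 2 + B j * p.1.2 j * p.2 j - w j * p.1.2 j ^ 2)) with he
  have hem : ∀ j, Measurable (e j) := fun j => by
    simp only [he]
    fun_prop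
  have hg : Measurable fun p : (ℝ≥0∞ × (ℕ → ℝ)) × (ℕ → ℝ) =>
      p.1.1 * ∏ j ∈ Finset.range J, e j p :=
    (measurable_fst.comp measurable_fst).mul (Finset.measurable_prod _ fun j _ => hem j)
  have h1 := lintegral_of_indepFun hZ hDm hindep hg
  have h2 : ∀ ω, f ω * ENNReal.ofReal (Real.exp (∑ j ∈ Finset.range J,
      (A j * D j ω ^ 2 + B j * X j ω * D j ω - w j * X j ω ^ 2))) =
      f ω * ∏ j ∈ Finset.range J, e j ((f ω, fun j => X j ω), fun j => D j ω) := fun ω => by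
    rw [Real.exp_sum, ENNReal.ofReal_prod_of_nonneg fun _ _ => (Real.exp_pos _).le]
  rw [lintegral_congr h2, h1, ← lintegral_const_mul _ (hf.mono h𝓕 le_rfl)]
  refine lintegral_mono fun ω => ?_
  have hem' : ∀ j, Measurable fun ω' => e j ((f ω, fun j => X j ω), fun j => D j ω') := fun j =>
    (hem j).comp (measurable_const.prodMk hDm)
  have hind' : iIndepFun (fun j ω' => e j ((f ω, fun j => X j ω), fun j => D j ω')) P :=
    hind.comp (fun j x => ENNReal.ofReal (Real.exp
      (A j * x ^ 2 + B j * X j ω * x - w j * X j ω ^ 2))) fun j => by fun_prop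
  simp only
  rw [lintegral_const_mul _ (Finset.measurable_prod _ fun j _ => hem' j),
    lintegral_prod_eq_prod_lintegral_of_indepFun _ _ hind' hem', mul_comm (f ω), Real.exp_sum,
    ENNReal.ofReal_prod_of_nonneg fun _ _ => (Real.exp_pos _).le]
  refine mul_le_mul_left (Finset.prod_le_prod' fun j _ => ?_) _
  have h3 := (hlaw j).lintegral_comp (f := fun x => ENNReal.ofReal (Real.exp
      (A j * x ^ 2 + B j * X j ω * x - w j * X j ω ^ 2))) (by fun_prop)
  refine (le_of_eq h3).trans (lintegral_exp_quadratic_gaussianReal_le hh (hA j) (hA2 j) ?_)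
  have h4 := mul_le_mul_of_nonneg_right (hw j) (sq_nonneg (X j ω))
  nlinarith

/-- The limit of the previous bound for infinitely many increments. -/
theorem lintegral_mul_exp_le_of_tendsto (h𝓕 : 𝓕 ≤ mΩ) {h : ℝ≥0} (hh : h ≠ 0) {D X : ℕ → Ω → ℝ}
    (hD : ∀ j, Measurable (D j)) (hlaw : ∀ j, HasLaw (D j) (gaussianReal 0 h) P)
    (hind : iIndepFun D P)
    (hpast : Indep (⨆ j, MeasurableSpace.comap (D j) inferInstance) 𝓕 P)
    (hX : ∀ j, Measurable[𝓕] (X j)) {A B w : ℕ → ℝ} (hA : ∀ j, 0 ≤ A j)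
    (hA2 : ∀ j, 2 * A j * h ≤ 1 / 2)
    (hw : ∀ j, B j ^ 2 * h ≤ w j * (2 * (1 - 2 * A j * h))) {c : ℝ}
    (hc : ∀ J, ∑ j ∈ Finset.range J, 2 * A j * h ≤ c) {r : Ω → ℝ}
    (hr : ∀ᵐ ω ∂P, Tendsto (fun J => ∑ j ∈ Finset.range J,
      (A j * D j ω ^ 2 + B j * X j ω * D j ω - w j * X j ω ^ 2)) atTop (nhds (r ω)))
    {f : Ω → ℝ≥0∞} (hf : Measurable[𝓕] f) :
    ∫⁻ ω, f ω * ENNReal.ofReal (Real.exp (r ω)) ∂P ≤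
      ENNReal.ofReal (Real.exp c) * ∫⁻ ω, f ω ∂P := by
  have hXm : ∀ j, Measurable (X j) := fun j => (hX j).mono h𝓕 le_rfl
  have hfm : Measurable f := hf.mono h𝓕 le_rfl
  set F : ℕ → Ω → ℝ≥0∞ := fun J ω => f ω * ENNReal.ofReal (Real.exp (∑ j ∈ Finset.range J,
        (A j * D j ω ^ 2 + B j * X j ω * D j ω - w j * X j ω ^ 2))) with hF
  have hFm : ∀ J, Measurable (F J) := fun J => by
    refine hfm.mul (ENNReal.measurable_ofReal.comp (Real.measurable_exp.comp
      (Finset.measurable_sum _ fun j _ => ?_)))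
    exact (((hD j).pow_const 2).const_mul _ |>.add (((hXm j).const_mul _).mul (hD j))).sub
      (((hXm j).pow_const 2).const_mul _)
  have hlim : ∀ᵐ ω ∂P, f ω * ENNReal.ofReal (Real.exp (r ω)) = liminf (fun J => F J ω) atTop := by
    filter_upwards [hr] with ω hω
    refine (Tendsto.liminf_eq ?_).symm
    refine ENNReal.Tendsto.const_mul (ENNReal.tendsto_ofReal
      ((Real.continuous_exp.tendsto _).comp hω)) (Or.inl ?_)
    exact (ENNReal.ofReal_pos.2 (Real.exp_pos _)).ne'
  rw [lintegral_congr_ae hlim]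
  refine (lintegral_liminf_le (u := atTop) hFm).trans ?_
  refine (liminf_le_of_le (by isBoundedDefault) fun b hb => ?_)
  obtain ⟨J, hJ⟩ := hb.exists
  refine hJ.trans ((lintegral_mul_exp_sum_le h𝓕 hh hD hlaw hind hpast hX hA hA2 hw hf J).trans ?_)
  exact mul_le_mul_left (ENNReal.ofReal_le_ofReal (Real.exp_le_exp.2 (hc J))) _

end Freezing

/-! ### A maximal inequality for exponential supermartingales -/

/-- The running maximum of the partial sums `0, r₁, r₁ + r₂, …`. -/
def runMax {Ω : Type*} (r : ℕ → Ω → ℝ) : ℕ → Ω → ℝ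
  | 0, _ => 0
  | n + 1, ω => max (runMax r n ω) (∑ l ∈ Finset.range (n + 1), r (l + 1) ω)

theorem runMax_nonneg {Ω : Type*} (r : ℕ → Ω → ℝ) (n : ℕ) (ω : Ω) : 0 ≤ runMax r n ω := by
  induction n with
  | zero => exact le_rfl
  | succ n ih => exact ih.trans (le_max_left _ _)

theorem runMax_mono {Ω : Type*} (r : ℕ → Ω → ℝ) (ω : Ω) : Monotone fun n => runMax r n ω :=
  monotone_nat_of_le_succ fun _ => le_max_left _ _

theorem sum_le_runMax {Ω : Type*} (r : ℕ → Ω → ℝ) (n : ℕ) (ω : Ω) :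
    ∑ l ∈ Finset.range n, r (l + 1) ω ≤ runMax r n ω := by
  cases n with
  | zero => simp [runMax]
  | succ n => exact le_max_right _ _

/-- Convexity inequality behind the Bellman function of the maximal inequality. -/
theorem exp_bellman_le {a b : ℝ} (hb : 0 < b) (hab : b < a) (m z : ℝ) :
    Real.exp (b * max m z) + b / (a - b) * Real.exp (a * z - (a - b) * max m z) ≤
      Real.exp (b * m) + b / (a - b) * Real.exp (a * z - (a - b) * m) := by
  rcases le_total z m with h | h
  · rw [max_eq_left h]
  · rw [max_eq_right h]
    have ha : 0 < a := hb.trans hab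
    have hab' : 0 < a - b := sub_pos.2 hab
    have h1 : Real.exp (b * (z - m)) ≤ (1 - b / a) * 1 + b / a * Real.exp (a * (z - m)) := by
      have := convexOn_exp.2 (Set.mem_univ 0) (Set.mem_univ (a * (z - m)))
        (sub_nonneg.2 ((div_le_one ha).2 hab.le)) (div_pos hb ha).le (sub_add_cancel 1 (b / a))
      simp only [smul_eq_mul, mul_zero, zero_add, Real.exp_zero] at this
      refine le_trans (le_of_eq ?_) this
      congr 1
      field_simp
    have h2 : Real.exp (b * z) = Real.exp (b * m) * Real.exp (b * (z - m)) := by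
      rw [← Real.exp_add]; ring_nf
    have h3 : Real.exp (a * z - (a - b) * z) = Real.exp (b * m) * Real.exp (b * (z - m)) := by
      rw [← Real.exp_add]; ring_nf
    have h4 : Real.exp (a * z - (a - b) * m) = Real.exp (b * m) * Real.exp (a * (z - m)) := by
      rw [← Real.exp_add]; ring_nf
    rw [h2, h3, h4]
    have h5 : Real.exp (b * (z - m)) + b / (a - b) * Real.exp (b * (z - m)) ≤
        1 + b / (a - b) * Real.exp (a * (z - m)) := by
      have h6 : Real.exp (b * (z - m)) + b / (a - b) * Real.exp (b * (z - m)) =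
          a / (a - b) * Real.exp (b * (z - m)) := by field_simp; simp
      have h7 : 1 + b / (a - b) * Real.exp (a * (z - m)) =
          a / (a - b) * ((1 - b / a) * 1 + b / a * Real.exp (a * (z - m))) := by field_simp
      rw [h6, h7]
      exact mul_le_mul_of_nonneg_left h1 (by positivity)
    calc _ = Real.exp (b * m) *
          (Real.exp (b * (z - m)) + b / (a - b) * Real.exp (b * (z - m))) := by ring
      _ ≤ Real.exp (b * m) * (1 + b / (a - b) * Real.exp (a * (z - m))) :=
          mul_le_mul_of_nonneg_left h5 (Real.exp_pos _).le
      _ = _ := by ring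

/-- If `exp (a (r₁ + ⋯ + rₙ))` is a supermartingale, then `exp (b maxₙ (r₁ + ⋯ + rₙ))` has
expectation at most `a / (a - b)` for every `b < a`. -/
theorem lintegral_exp_runMax_le {Ω : Type*} {mΩ : MeasurableSpace Ω} {P : Measure Ω}
    [IsProbabilityMeasure P] {𝓖 : ℕ → MeasurableSpace Ω} (h𝓖 : ∀ l, 𝓖 l ≤ mΩ) (hmono : Monotone 𝓖)
    {a b : ℝ} (hb : 0 < b) (hab : b < a) {r : ℕ → Ω → ℝ} {N : ℕ}
    (hr : ∀ l, 1 ≤ l → l ≤ N → Measurable[𝓖 l] (r l))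
    (hstep : ∀ l, l < N → ∀ f : Ω → ℝ≥0∞, Measurable[𝓖 l] f →
      ∫⁻ ω, f ω * ENNReal.ofReal (Real.exp (a * r (l + 1) ω)) ∂P ≤ ∫⁻ ω, f ω ∂P) :
    ∫⁻ ω, ENNReal.ofReal (Real.exp (b * runMax r N ω)) ∂P ≤ ENNReal.ofReal (a / (a - b)) := by
  have hab' : 0 < a - b := sub_pos.2 hab
  set z : ℕ → Ω → ℝ := fun n ω => ∑ l ∈ Finset.range n, r (l + 1) ω with hz
  have hzm : ∀ n ≤ N, Measurable[𝓖 n] (z n) := fun n hn =>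
    Finset.measurable_sum _ fun l hl => by
      have := Finset.mem_range.1 hl
      exact (hr (l + 1) (by omega) (by omega)).mono (hmono (by omega)) le_rfl
  have hMm : ∀ n ≤ N, Measurable[𝓖 n] (runMax r n) := by
    intro n
    induction n with
    | zero => intro _; exact measurable_const
    | succ n ih =>
      intro hn
      exact ((ih (by omega)).mono (hmono (by omega)) le_rfl).max (hzm (n + 1) hn)
  -- the Bellman function: its expectation decreases in `n`, and it dominates `exp (b max)`
  set Φ : ℕ → Ω → ℝ := fun n ω => Real.exp (b * runMax r n ω) +
    b / (a - b) * Real.exp (a * z n ω - (a - b) * runMax r n ω) with hΦ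
  have hind : ∀ n ≤ N, ∫⁻ ω, ENNReal.ofReal (Φ n ω) ∂P ≤ ENNReal.ofReal (a / (a - b)) := by
    intro n
    induction n with
    | zero =>
      intro _
      have : ∀ ω, Φ 0 ω = a / (a - b) := fun ω => by
        simp only [hΦ, hz, runMax, Finset.range_zero, Finset.sum_empty, mul_zero, sub_zero,
          Real.exp_zero, mul_one]
        field_simp
        ring
      simp [this]
    | succ n ih =>
      intro hn
      refine le_trans ?_ (ih (by omega))
      have hM := hMm n (by omega)
      have hzn := hzm n (by omega)
      have hm1 : Measurable[𝓖 n] fun ω => ENNReal.ofReal (Real.exp (b * runMax r n ω)) :=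
        ENNReal.measurable_ofReal.comp (Real.measurable_exp.comp (hM.const_mul b))
      have hm2 : Measurable[𝓖 n] fun ω =>
          ENNReal.ofReal (b / (a - b) * Real.exp (a * z n ω - (a - b) * runMax r n ω)) :=
        ENNReal.measurable_ofReal.comp ((Real.measurable_exp.comp
          ((hzn.const_mul a).sub (hM.const_mul (a - b)))).const_mul _)
      calc ∫⁻ ω, ENNReal.ofReal (Φ (n + 1) ω) ∂P
          ≤ ∫⁻ ω, (ENNReal.ofReal (Real.exp (b * runMax r n ω)) +
            ENNReal.ofReal (b / (a - b) * Real.exp (a * z n ω - (a - b) * runMax r n ω)) *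
              ENNReal.ofReal (Real.exp (a * r (n + 1) ω))) ∂P := by
            refine lintegral_mono fun ω => ?_
            rw [← ENNReal.ofReal_mul (by positivity), ← ENNReal.ofReal_add (by positivity)
              (by positivity)]
            refine ENNReal.ofReal_le_ofReal ((exp_bellman_le hb hab (runMax r n ω)
              (z (n + 1) ω)).trans (le_of_eq ?_))
            rw [mul_assoc, ← Real.exp_add]
            simp only [hz, Finset.sum_range_succ]
            ring_nf
        _ ≤ ∫⁻ ω, ENNReal.ofReal (Real.exp (b * runMax r n ω)) ∂P +
            ∫⁻ ω, ENNReal.ofReal (b / (a - b) *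
              Real.exp (a * z n ω - (a - b) * runMax r n ω)) ∂P := by
            rw [lintegral_add_left (hm1.mono (h𝓖 n) le_rfl)]
            exact add_le_add le_rfl (hstep n (by omega) _ hm2)
        _ = ∫⁻ ω, ENNReal.ofReal (Φ n ω) ∂P := by
            rw [← lintegral_add_left (hm1.mono (h𝓖 n) le_rfl)]
            refine lintegral_congr fun ω => ?_
            rw [← ENNReal.ofReal_add (by positivity) (by positivity)]
  refine le_trans (lintegral_mono fun ω => ENNReal.ofReal_le_ofReal ?_) (hind N le_rfl)
  simp only [hΦ]
  exact le_add_of_nonneg_right (by positivity)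

/-! ### Modes of the noise -/

/-- Weighted sums of squares of identically distributed centred Gaussian variables converge almost
surely as soon as the weights are summable. -/
theorem ae_summable_mul_sq {Ω : Type*} {mΩ : MeasurableSpace Ω} {P : Measure Ω} {D : ℕ → Ω → ℝ}
    {v : ℝ≥0} (hD : ∀ j, HasLaw (D j) (gaussianReal 0 v) P) {c : ℕ → ℝ} (hc0 : ∀ j, 0 ≤ c j)
    (hc : Summable c) : ∀ᵐ ω ∂P, Summable fun j => c j * D j ω ^ 2 := by
  have hM : ∫⁻ x, ENNReal.ofReal (x ^ 2) ∂gaussianReal 0 v ≠ ∞ := by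
    have h1 : Integrable (fun x : ℝ => x ^ 2) (gaussianReal 0 v) :=
      (memLp_id_gaussianReal (μ := 0) (v := v) 2).integrable_sq
    exact h1.lintegral_lt_top.ne
  have hmeas : ∀ j, AEMeasurable (fun ω => ENNReal.ofReal (c j * D j ω ^ 2)) P := fun j =>
    (((hD j).aemeasurable.pow_const 2).const_mul (c j)).ennreal_ofReal
  have hfin : ∫⁻ ω, ∑' j, ENNReal.ofReal (c j * D j ω ^ 2) ∂P ≠ ∞ := by
    rw [lintegral_tsum hmeas]
    have h2 : ∀ j, ∫⁻ ω, ENNReal.ofReal (c j * D j ω ^ 2) ∂P =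
        ENNReal.ofReal (c j) * ∫⁻ x, ENNReal.ofReal (x ^ 2) ∂gaussianReal 0 v := fun j => by
      simp_rw [ENNReal.ofReal_mul (hc0 j)]
      rw [lintegral_const_mul' _ _ ENNReal.ofReal_ne_top]
      congr 1
      exact (hD j).lintegral_comp (f := fun x => ENNReal.ofReal (x ^ 2)) (by fun_prop)
    simp_rw [h2]
    rw [ENNReal.tsum_mul_right]
    exact ENNReal.mul_ne_top hc.tsum_ofReal_ne_top hM
  filter_upwards [ae_lt_top' (AEMeasurable.tsum hmeas) hfin] with ω hω
  refine (ENNReal.summable_toReal hω.ne).congr fun j => ?_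
  exact ENNReal.toReal_ofReal (mul_nonneg (hc0 j) (sq_nonneg _))

/-- Where the defining series of the Wiener process converges, its modes are `√qⱼ βⱼ`. -/
theorem inner_wiener {L : ℝ} (ζ : HilbertBasis ℕ ℝ (H L)) {q : ℕ → ℝ} (hq : ∀ j, 0 ≤ q j)
    {Ω : Type*} {bm : ℕ → ℝ≥0 → Ω → ℝ} {t : ℝ≥0} {ω : Ω}
    (h : Summable fun j => q j * bm j t ω ^ 2) (j : ℕ) :
    ⟪ζ j, wiener ζ q bm t ω⟫ = √(q j) * bm j t ω := by
  have h1 : Summable fun j => (√(q j) * bm j t ω) ^ 2 :=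
    h.congr fun j => by rw [mul_pow, Real.sq_sqrt (hq j)]
  obtain ⟨y, hy, hy'⟩ := exists_of_summable_sq (ζ := ζ) h1
  rw [wiener, hy'.tsum_eq, hy j]

theorem gridTime_succ (T : ℝ≥0) (N l : ℕ) :
    gridTime T N (l + 1) = gridTime T N l + T / N := by
  simp only [gridTime]
  push_cast
  ring

theorem gridTime_mono (T : ℝ≥0) (N : ℕ) : Monotone (gridTime T N) :=
  monotone_nat_of_le_succ fun l => by rw [gridTime_succ]; exact le_self_add

/-- The increment of the `j`-th Brownian motion over the time step `[t_l, t_{l+1}]`. -/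
def bmIncr {Ω : Type*} (bm : ℕ → ℝ≥0 → Ω → ℝ) (T : ℝ≥0) (N l j : ℕ) (ω : Ω) : ℝ :=
  bm j (gridTime T N (l + 1)) ω - bm j (gridTime T N l) ω

section Increments

variable {Ω : Type*} {mΩ : MeasurableSpace Ω} {P : Measure Ω} {ℱ : Filtration ℝ≥0 mΩ}
  {bm : ℕ → ℝ≥0 → Ω → ℝ}

theorem IsBrownianSequence.hasLaw_bmIncr (hbm : IsBrownianSequence P ℱ bm) (T : ℝ≥0) (N l j : ℕ) :
    HasLaw (bmIncr bm T N l j) (gaussianReal 0 (T / N)) P := by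
  have h := (hbm.brownian j).toIsPreBrownianReal.hasLaw_sub (gridTime T N (l + 1)) (gridTime T N l)
  have e : nndist (gridTime T N (l + 1) : ℝ) (gridTime T N l : ℝ) = T / N := by
    rw [gridTime_succ]
    ext
    rw [coe_nndist, Real.dist_eq, NNReal.coe_add, add_sub_cancel_left,
      abs_of_nonneg (NNReal.coe_nonneg _)]
  exact e ▸ h

theorem IsBrownianSequence.measurable_bmIncr (hbm : IsBrownianSequence P ℱ bm) (T : ℝ≥0)
    (N l j : ℕ) : Measurable[ℱ (gridTime T N (l + 1))] (bmIncr bm T N l j) :=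
  (hbm.adapted j _).sub
    ((hbm.adapted j _).mono (ℱ.mono (gridTime_mono T N (Nat.le_succ l))) le_rfl)

theorem IsBrownianSequence.iIndepFun_bmIncr (hbm : IsBrownianSequence P ℱ bm) (T : ℝ≥0)
    (N l : ℕ) : iIndepFun (bmIncr bm T N l) P :=
  hbm.indep.comp (fun _ (x : ℝ≥0 → ℝ) => x (gridTime T N (l + 1)) - x (gridTime T N l))
    fun _ => (measurable_pi_apply _).sub (measurable_pi_apply _)

end Increments

/-! ### Energy increments -/

/-- The sum of the series `∑ⱼ (λⱼ qⱼ dⱼ² + 2 λⱼ √qⱼ xⱼ dⱼ - Wⱼ xⱼ²)`: the change of the squared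
gradient norm of `x` under the noise with modes `√qⱼ dⱼ`, diminished by `∑ⱼ Wⱼ xⱼ²`. It is encoded
as an upper limit of partial sums to be measurable in `x` and `d` irrespective of convergence. -/
def noiseIncr (lam q W x d : ℕ → ℝ) : ℝ :=
  limsup (fun J : ℕ => ∑ j ∈ Finset.range J,
    (lam j * q j * d j ^ 2 + 2 * lam j * √(q j) * x j * d j - W j * x j ^ 2)) atTop

theorem measurable_noiseIncr {Ω : Type*} {𝓕 : MeasurableSpace Ω} (lam q W : ℕ → ℝ)
    {X D : ℕ → Ω → ℝ} (hX : ∀ j, Measurable (X j)) (hD : ∀ j, Measurable (D j)) :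
    Measurable fun ω => noiseIncr lam q W (fun j => X j ω) (fun j => D j ω) := by
  refine Measurable.limsup fun J => Finset.measurable_sum _ fun j _ => ?_
  exact (((hD j).pow_const 2).const_mul _).add (((hX j).const_mul _).mul (hD j)) |>.sub
    (((hX j).pow_const 2).const_mul _)

theorem hasSum_noiseIncr {lam q W x d : ℕ → ℝ} (hlam : ∀ j, 0 ≤ lam j) (hq : ∀ j, 0 ≤ q j)
    (hd : Summable fun j => lam j * q j * d j ^ 2) (hx : Summable fun j => lam j * x j ^ 2)
    (hW : Summable fun j => W j * x j ^ 2) :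
    HasSum (fun j => lam j * q j * d j ^ 2 + 2 * lam j * √(q j) * x j * d j - W j * x j ^ 2)
        (noiseIncr lam q W x d) ∧
      ∑' j, lam j * (x j + √(q j) * d j) ^ 2 =
        ∑' j, lam j * x j ^ 2 + noiseIncr lam q W x d + ∑' j, W j * x j ^ 2 := by
  have hs : Summable fun j => lam j * (x j + √(q j) * d j) ^ 2 := by
    refine Summable.of_nonneg_of_le (fun j => mul_nonneg (hlam j) (sq_nonneg _)) (fun j => ?_)
      ((hx.mul_left 2).add (hd.mul_left 2))
    have h1 : (x j + √(q j) * d j) ^ 2 ≤ 2 * x j ^ 2 + 2 * (q j * d j ^ 2) := by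
      have := sq_nonneg (x j - √(q j) * d j)
      nlinarith [Real.sq_sqrt (hq j)]
    calc _ ≤ lam j * (2 * x j ^ 2 + 2 * (q j * d j ^ 2)) := mul_le_mul_of_nonneg_left h1 (hlam j)
      _ = _ := by ring
  have hs' := (hs.hasSum.sub hx.hasSum).sub hW.hasSum
  have heq : (fun j => lam j * (x j + √(q j) * d j) ^ 2 - lam j * x j ^ 2 - W j * x j ^ 2) =
      fun j => lam j * q j * d j ^ 2 + 2 * lam j * √(q j) * x j * d j - W j * x j ^ 2 := by
    funext j
    linear_combination lam j * d j ^ 2 * Real.sq_sqrt (hq j)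
  rw [heq] at hs'
  have hlim : noiseIncr lam q W x d = _ := hs'.tendsto_sum_nat.limsup_eq
  rw [← hlim] at hs'
  refine ⟨hs', ?_⟩
  rw [hlim]
  ring

section Supermartingale

variable {Ω : Type*} {𝓕 mΩ : MeasurableSpace Ω} {P : Measure Ω} [IsProbabilityMeasure P]

/-- After subtraction of `2 K h`, an energy increment has a conditional exponential moment of order
`a` at most one, provided that the weights `W` dominate the quadratic variation of its linear
part. -/
theorem lintegral_mul_exp_noiseIncr_le (h𝓕 : 𝓕 ≤ mΩ) {h : ℝ≥0} (hh : h ≠ 0) {lam q W : ℕ → ℝ}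
    (hlam : ∀ j, 0 ≤ lam j) (hq : ∀ j, 0 ≤ q j) (hK : Summable fun j => lam j * q j)
    {D X : ℕ → Ω → ℝ} (hD : ∀ j, Measurable (D j))
    (hlaw : ∀ j, HasLaw (D j) (gaussianReal 0 h) P) (hind : iIndepFun D P)
    (hpast : Indep (⨆ j, MeasurableSpace.comap (D j) inferInstance) 𝓕 P)
    (hX : ∀ j, Measurable[𝓕] (X j)) {a : ℝ} (ha : 0 ≤ a)
    (hah : 2 * a * (∑' j, lam j * q j) * h ≤ 1 / 2)
    (hW : ∀ j, 2 * a * lam j ^ 2 * q j * h ≤ W j * (1 - 2 * a * (lam j * q j) * h))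
    (hx : ∀ᵐ ω ∂P, Summable fun j => lam j * X j ω ^ 2)
    (hWx : ∀ᵐ ω ∂P, Summable fun j => W j * X j ω ^ 2) {f : Ω → ℝ≥0∞} (hf : Measurable[𝓕] f) :
    ∫⁻ ω, f ω * ENNReal.ofReal (Real.exp (a *
        (noiseIncr lam q W (fun j => X j ω) (fun j => D j ω) -
          2 * (∑' j, lam j * q j) * h))) ∂P ≤ ∫⁻ ω, f ω ∂P := by
  set K := ∑' j, lam j * q j with hKdef
  have hlq : ∀ j, 0 ≤ lam j * q j := fun j => mul_nonneg (hlam j) (hq j)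
  have hd := ae_summable_mul_sq hlaw hlq hK
  have key := lintegral_mul_exp_le_of_tendsto h𝓕 hh hD hlaw hind hpast hX
    (A := fun j => a * (lam j * q j)) (B := fun j => 2 * a * lam j * √(q j))
    (w := fun j => a * W j) (c := 2 * a * K * h)
    (r := fun ω => a * noiseIncr lam q W (fun j => X j ω) (fun j => D j ω)) (f := f)
    (fun j => mul_nonneg ha (hlq j)) (fun j => ?_) (fun j => ?_) (fun J => ?_) ?_ hf
  · have e : ∀ ω, f ω * ENNReal.ofReal (Real.exp (a *
        (noiseIncr lam q W (fun j => X j ω) (fun j => D j ω) - 2 * K * h))) =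
        ENNReal.ofReal (Real.exp (-(2 * a * K * h))) * (f ω * ENNReal.ofReal (Real.exp (a *
          noiseIncr lam q W (fun j => X j ω) (fun j => D j ω)))) := fun ω => by
      rw [mul_left_comm, ← ENNReal.ofReal_mul (Real.exp_pos _).le, ← Real.exp_add]
      congr 3
      ring_nf
    simp_rw [e]
    rw [lintegral_const_mul' _ _ ENNReal.ofReal_ne_top]
    refine (mul_le_mul_right key _).trans (le_of_eq ?_)
    rw [← mul_assoc, ← ENNReal.ofReal_mul (Real.exp_pos _).le, ← Real.exp_add, neg_add_cancel,
      Real.exp_zero, ENNReal.ofReal_one, one_mul]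
  · refine le_trans ?_ hah
    have := hK.le_tsum j fun i _ => hlq i
    have h2 : a * (lam j * q j) * h ≤ a * K * h := by gcongr
    linarith
  · have h1 := mul_le_mul_of_nonneg_left (hW j) (mul_nonneg zero_le_two ha)
    have h2 : (2 * a * lam j * √(q j)) ^ 2 = 4 * a ^ 2 * lam j ^ 2 * q j := by
      rw [mul_pow, Real.sq_sqrt (hq j)]; ring
    rw [h2]
    nlinarith
  · have h1 : ∑ j ∈ Finset.range J, 2 * (a * (lam j * q j)) * h =
        2 * a * (∑ j ∈ Finset.range J, lam j * q j) * h := by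
      rw [Finset.mul_sum, Finset.sum_mul]
      exact Finset.sum_congr rfl fun j _ => by ring
    rw [h1]
    have := hK.sum_le_tsum (Finset.range J) fun i _ => hlq i
    gcongr
  · filter_upwards [hd, hx, hWx] with ω h1 h2 h3
    have := ((hasSum_noiseIncr hlam hq h1 h2 h3).1.mul_left a).tendsto_sum_nat
    refine this.congr fun J => Finset.sum_congr rfl fun j _ => ?_
    ring

end Supermartingale

/-! ### Summing the energy inequalities -/

/-- Summation of the energy inequalities. In each step but the first one the part `σ h y` of the
dissipation gained in the previous step pays for the compensator of the noise; keeping the last such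
term on the left makes the induction work. -/
theorem sum_energy_le {x y r : ℕ → ℝ} {N : ℕ} {h ν ρ σ c k : ℝ} (hρσ : ρ + σ = 2 * ν)
    (h1 : x 1 + 2 * ν * h * y 1 ≤ (1 + c) * x 0 + r 1 + k)
    (hs : ∀ l, 1 ≤ l → l < N → x (l + 1) + 2 * ν * h * y (l + 1) ≤
      x l + σ * h * y l + r (l + 1) + k) {n : ℕ} (hn1 : 1 ≤ n) (hn : n ≤ N) :
    x n + ρ * h * ∑ l ∈ Finset.Icc 1 n, y l + σ * h * y n ≤
      (1 + c) * x 0 + ∑ l ∈ Finset.range n, r (l + 1) + n * k := by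
  induction n, hn1 using Nat.le_induction with
  | base =>
    simp only [Finset.Icc_self, Finset.sum_singleton, Finset.range_one, Nat.cast_one, zero_add]
    have : 2 * ν * h * y 1 = ρ * h * y 1 + σ * h * y 1 := by rw [← hρσ]; ring
    linarith
  | succ n hn1 ih =>
    have := ih (by omega)
    have h2 := hs n hn1 (by omega)
    rw [Finset.sum_Icc_succ_top (by omega), Finset.sum_range_succ]
    have : 2 * ν * h * y (n + 1) = ρ * h * y (n + 1) + σ * h * y (n + 1) := by rw [← hρσ]; ring
    push_cast
    linarith

/-! ### Pathwise energy estimate for the scheme -/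

section Scheme

variable {L ν : ℝ} {T : ℝ≥0} {ζ : HilbertBasis ℕ ℝ (H L)} {lam q : ℕ → ℝ}
  {Ω : Type*} {mΩ : MeasurableSpace Ω} {P : Measure Ω}
  {ℱ : Filtration ℝ≥0 mΩ} {bm : ℕ → ℝ≥0 → Ω → ℝ} {u₀ : Ω → H L} {N : ℕ} {u : ℕ → Ω → H L}

theorem IsEulerScheme.measurable_mode (hu : IsEulerScheme ζ lam q ν T P ℱ bm u₀ N u) {l : ℕ}
    (hl : l ≤ N) (j : ℕ) : Measurable[ℱ (gridTime T N l)] fun ω => ⟪ζ j, u l ω⟫ := by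
  refine StronglyMeasurable.measurable ?_
  exact (innerSL ℝ (ζ j)).continuous.comp_stronglyMeasurable (hu.adapted l hl)

/-- The energy inequality of a time step, written in terms of the Brownian increments. -/
theorem IsEulerScheme.ae_step_energy (hL : 0 < L) (hν : 0 < ν) (hT : 0 < T)
    (hζ : IsEigenbasis ζ lam) (hq : ∀ j, 0 ≤ q j) (hQ : Summable q)
    (hK : Summable fun j => lam j * q j) (hbm : IsBrownianSequence P ℱ bm)
    (hu : IsEulerScheme ζ lam q ν T P ℱ bm u₀ N u) {l : ℕ} (hl : l < N) :
    ∀ᵐ ω ∂P, Summable (fun j => lam j ^ 2 * ⟪ζ j, u (l + 1) ω⟫ ^ 2) ∧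
      Summable (fun j => lam j * q j * bmIncr bm T N l j ω ^ 2) ∧
      ‖sqrtStokes ζ lam (u (l + 1) ω)‖ ^ 2 + 2 * ν * (T / N : ℝ) * ‖stokes (u (l + 1) ω)‖ ^ 2 ≤
        ∑' j, lam j * (⟪ζ j, u l ω⟫ + √(q j) * bmIncr bm T N l j ω) ^ 2 := by
  have hlam := fun j => (hζ.lam_pos hL j).le
  have hN : (0 : ℝ) < N := by exact_mod_cast (Nat.zero_le l).trans_lt hl
  have hd := ae_summable_mul_sq (fun j => hbm.hasLaw_bmIncr T N l j)
    (fun j => mul_nonneg (hlam j) (hq j)) hK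
  have hb : ∀ t, ∀ᵐ ω ∂P, Summable fun j => q j * bm j t ω ^ 2 := fun t =>
    ae_summable_mul_sq (fun j => (hbm.brownian j).toIsPreBrownianReal.hasLaw_eval t) hq hQ
  filter_upwards [hd, hb (gridTime T N (l + 1)), hb (gridTime T N l), hu.mem_V l hl.le,
    hu.mem_V (l + 1) hl, hu.step (l + 1) (by omega) hl] with ω h1 h2 h3 h4 h5 h6
  simp only [Nat.add_sub_cancel] at h6
  have hw : ∀ j, ⟪ζ j, wiener ζ q bm (gridTime T N (l + 1)) ω - wiener ζ q bm (gridTime T N l) ω⟫ =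
      √(q j) * bmIncr bm T N l j ω := fun j => by
    rw [inner_sub_right, inner_wiener ζ hq h2, inner_wiener ζ hq h3, ← mul_sub, bmIncr]
  have h7 := euler_step_energy hL hζ hν (div_pos (NNReal.coe_pos.2 hT) hN) h5 h4 ?_ h6
  · simp_rw [hw] at h7
    exact ⟨h7.1, h1, h7.2⟩
  · refine h1.congr fun j => ?_
    rw [hw, mul_pow, Real.sq_sqrt (hq j), mul_assoc]

/-- Weights dominating the quadratic variation of the noise. In the first step only the gradient
norm of the initial value is at hand, later the dissipation of the previous step. -/
def stepWeight (lam : ℕ → ℝ) (c s : ℝ) (l j : ℕ) : ℝ :=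
  if l = 0 then c * lam j else s * lam j ^ 2

/-- The compensated energy increment of the `l`-th time step (`l ≥ 1`). -/
def energyIncr (ζ : HilbertBasis ℕ ℝ (H L)) (lam q : ℕ → ℝ) (bm : ℕ → ℝ≥0 → Ω → ℝ) (T : ℝ≥0)
    (N : ℕ) (u : ℕ → Ω → H L) (c s k : ℝ) (l : ℕ) (ω : Ω) : ℝ :=
  noiseIncr lam q (stepWeight lam c s (l - 1)) (fun j => ⟪ζ j, u (l - 1) ω⟫)
    (fun j => bmIncr bm T N (l - 1) j ω) - k

theorem IsEulerScheme.measurable_energyIncr (hbm : IsBrownianSequence P ℱ bm)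
    (hu : IsEulerScheme ζ lam q ν T P ℱ bm u₀ N u) (c s k : ℝ) {l : ℕ} (hl : 1 ≤ l) (hlN : l ≤ N) :
    Measurable[ℱ (gridTime T N l)] (energyIncr ζ lam q bm T N u c s k l) := by
  obtain ⟨l, rfl⟩ := Nat.exists_eq_add_of_le' hl
  refine Measurable.sub_const ?_ k
  exact measurable_noiseIncr _ _ _ (fun j => (hu.measurable_mode (Nat.le_of_succ_le hlN) j).mono
    (ℱ.mono (gridTime_mono T N (Nat.le_succ l))) le_rfl) fun j => hbm.measurable_bmIncr T N l j

/-- The modes of the solution are summable with the weights of every step. -/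
theorem IsEulerScheme.ae_summable (hL : 0 < L) (hν : 0 < ν) (hT : 0 < T)
    (hζ : IsEigenbasis ζ lam) (hq : ∀ j, 0 ≤ q j) (hQ : Summable q)
    (hK : Summable fun j => lam j * q j) (hbm : IsBrownianSequence P ℱ bm)
    (hu : IsEulerScheme ζ lam q ν T P ℱ bm u₀ N u) (c s : ℝ) {l : ℕ} (hl : l < N) :
    ∀ᵐ ω ∂P, Summable (fun j => lam j * ⟪ζ j, u l ω⟫ ^ 2) ∧
      Summable (fun j => stepWeight lam c s l j * ⟪ζ j, u l ω⟫ ^ 2) ∧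
      ∑' j, stepWeight lam c s l j * ⟪ζ j, u l ω⟫ ^ 2 =
        if l = 0 then c * ‖sqrtStokes ζ lam (u l ω)‖ ^ 2 else s * ‖stokes (u l ω)‖ ^ 2 := by
  rcases l with _ | l
  · filter_upwards [hu.mem_V 0 (Nat.zero_le _)] with ω h1
    have h2 := hasSum_sqrtStokes_sq hL hζ h1
    have h3 := h2.mul_left c
    simp only [← mul_assoc] at h3
    exact ⟨h2.summable, by simpa [stepWeight] using h3.summable,
      by simpa [stepWeight] using h3.tsum_eq⟩
  · filter_upwards [hu.mem_V (l + 1) hl.le,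
      hu.ae_step_energy hL hν hT hζ hq hQ hK hbm (Nat.lt_of_succ_lt hl)] with ω h1 h2
    have h3 := (hasSum_stokes_sq hL hζ h2.1).mul_left s
    simp only [← mul_assoc] at h3
    exact ⟨summable_lam_mul_sq hL hζ h1, by simpa [stepWeight] using h3.summable,
      by simpa [stepWeight] using h3.tsum_eq⟩

theorem IsEulerScheme.ae_energyIncr_le (hL : 0 < L) (hν : 0 < ν) (hT : 0 < T)
    (hζ : IsEigenbasis ζ lam) (hq : ∀ j, 0 ≤ q j) (hQ : Summable q)
    (hK : Summable fun j => lam j * q j) (hbm : IsBrownianSequence P ℱ bm)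
    (hu : IsEulerScheme ζ lam q ν T P ℱ bm u₀ N u) (c s k : ℝ) {l : ℕ} (hl : l < N) :
    ∀ᵐ ω ∂P, ‖sqrtStokes ζ lam (u (l + 1) ω)‖ ^ 2 +
        2 * ν * (T / N : ℝ) * ‖stokes (u (l + 1) ω)‖ ^ 2 ≤
      ‖sqrtStokes ζ lam (u l ω)‖ ^ 2 +
        (if l = 0 then c * ‖sqrtStokes ζ lam (u l ω)‖ ^ 2 else s * ‖stokes (u l ω)‖ ^ 2) +
        energyIncr ζ lam q bm T N u c s k (l + 1) ω + k := by
  filter_upwards [hu.mem_V l hl.le, hu.ae_step_energy hL hν hT hζ hq hQ hK hbm hl,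
    hu.ae_summable hL hν hT hζ hq hQ hK hbm c s hl] with ω h1 h2 h3
  have h4 := (hasSum_noiseIncr (fun j => (hζ.lam_pos hL j).le) hq h2.2.1 h3.1 h3.2.1).2
  have h5 := h2.2.2
  rw [h4, (hasSum_sqrtStokes_sq hL hζ h1).tsum_eq, h3.2.2] at h5
  simp only [energyIncr, Nat.add_sub_cancel]
  linarith

/-- Pathwise bound of the maximal energy by the initial energy and the running maximum of the
compensated energy increments. -/
theorem IsEulerScheme.ae_maxGradDiss_le (hL : 0 < L) (hν : 0 < ν) (hT : 0 < T)
    (hζ : IsEigenbasis ζ lam) (hq : ∀ j, 0 ≤ q j) (hQ : Summable q)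
    (hK : Summable fun j => lam j * q j) (hbm : IsBrownianSequence P ℱ bm)
    (hu : IsEulerScheme ζ lam q ν T P ℱ bm u₀ N u) {ρ σ c k : ℝ} (hρσ : ρ + σ = 2 * ν)
    (hσ : 0 ≤ σ) (hc : 0 ≤ c) (hk : 0 ≤ k) :
    ∀ᵐ ω ∂P, maxGradDiss ζ lam ρ T N (fun l => u l ω) ≤
      (1 + c) * ‖sqrtStokes ζ lam (u₀ ω)‖ ^ 2 +
        runMax (energyIncr ζ lam q bm T N u c (σ * (T / N : ℝ)) k) N ω + N * k := by
  have hstep : ∀ᵐ ω ∂P, ∀ l < N, _ := ae_all_iff.2 fun l => Filter.eventually_imp_distrib_left.2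
    fun hl => hu.ae_energyIncr_le hL hν hT hζ hq hQ hK hbm c (σ * (T / N : ℝ)) k hl
  filter_upwards [hstep] with ω hω
  have hM := runMax_nonneg (energyIncr ζ lam q bm T N u c (σ * (T / N : ℝ)) k) N ω
  have hNk : 0 ≤ N * k := by positivity
  have hcx : 0 ≤ c * ‖sqrtStokes ζ lam (u₀ ω)‖ ^ 2 := by positivity
  refine Finset.sup'_le _ _ fun n hn => ?_
  have hnN : n ≤ N := Nat.lt_succ_iff.1 (Finset.mem_range.1 hn)
  rcases Nat.eq_zero_or_pos n with rfl | hn1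
  · simp only [hu.init]
    rw [Finset.Icc_eq_empty (by norm_num), Finset.sum_empty, mul_zero, add_zero]
    linarith
  · have h1 := sum_energy_le (x := fun l => ‖sqrtStokes ζ lam (u l ω)‖ ^ 2)
      (y := fun l => ‖stokes (u l ω)‖ ^ 2)
      (r := fun l => energyIncr ζ lam q bm T N u c (σ * (T / N : ℝ)) k l ω) (N := N)
      (h := (T / N : ℝ)) (c := c) (k := k) hρσ ?_ (fun l hl hlN => ?_) hn1 hnN
    · have h2 := sum_le_runMax (energyIncr ζ lam q bm T N u c (σ * (T / N : ℝ)) k) n ω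
      have h3 := runMax_mono (energyIncr ζ lam q bm T N u c (σ * (T / N : ℝ)) k) ω hnN
      have h4 : (n : ℝ) * k ≤ N * k := by gcongr
      have h5 : 0 ≤ σ * (T / N : ℝ) * ‖stokes (u n ω)‖ ^ 2 := by positivity
      simp only [hu.init] at h1
      simp only at h3
      linarith
    · have h2 := hω 0 (hn1.trans_le hnN)
      simp only [if_true, zero_add] at h2
      linarith
    · have h2 := hω l hlN
      rw [if_neg (by omega)] at h2
      linarith

/-! ### Measurability of the norms along the scheme -/

theorem IsEulerScheme.aemeasurable_sqrtStokes (hL : 0 < L) (hζ : IsEigenbasis ζ lam)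
    (hu : IsEulerScheme ζ lam q ν T P ℱ bm u₀ N u) {l : ℕ} (hl : l ≤ N) :
    AEMeasurable (fun ω => ‖sqrtStokes ζ lam (u l ω)‖ ^ 2) P := by
  refine ⟨fun ω => (∑' j, ENNReal.ofReal (lam j * ⟪ζ j, u l ω⟫ ^ 2)).toReal, ?_, ?_⟩
  · exact (Measurable.tsum fun j => ((((hu.measurable_mode hl j).mono (ℱ.le _) le_rfl).pow_const
      2).const_mul _).ennreal_ofReal).ennreal_toReal
  · filter_upwards [hu.mem_V l hl] with ω hω
    have h1 := hasSum_sqrtStokes_sq hL hζ hω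
    have h0 : ∀ j, 0 ≤ lam j * ⟪ζ j, u l ω⟫ ^ 2 := fun j =>
      mul_nonneg (hζ.lam_pos hL j).le (sq_nonneg _)
    rw [← ENNReal.ofReal_tsum_of_nonneg h0 h1.summable, h1.tsum_eq,
      ENNReal.toReal_ofReal (sq_nonneg _)]

theorem IsEulerScheme.aemeasurable_stokes (hL : 0 < L) (hν : 0 < ν) (hT : 0 < T)
    (hζ : IsEigenbasis ζ lam) (hq : ∀ j, 0 ≤ q j) (hQ : Summable q)
    (hK : Summable fun j => lam j * q j) (hbm : IsBrownianSequence P ℱ bm)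
    (hu : IsEulerScheme ζ lam q ν T P ℱ bm u₀ N u) {l : ℕ} (hl1 : 1 ≤ l) (hl : l ≤ N) :
    AEMeasurable (fun ω => ‖stokes (u l ω)‖ ^ 2) P := by
  obtain ⟨l, rfl⟩ := Nat.exists_eq_add_of_le' hl1
  refine ⟨fun ω => (∑' j, ENNReal.ofReal (lam j ^ 2 * ⟪ζ j, u (l + 1) ω⟫ ^ 2)).toReal, ?_, ?_⟩
  · exact (Measurable.tsum fun j => ((((hu.measurable_mode hl j).mono (ℱ.le _) le_rfl).pow_const
      2).const_mul _).ennreal_ofReal).ennreal_toReal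
  · filter_upwards [hu.ae_step_energy hL hν hT hζ hq hQ hK hbm hl] with ω hω
    have h1 := hasSum_stokes_sq hL hζ hω.1
    have h0 : ∀ j, 0 ≤ lam j ^ 2 * ⟪ζ j, u (l + 1) ω⟫ ^ 2 := fun j => by positivity
    rw [← ENNReal.ofReal_tsum_of_nonneg h0 h1.summable, h1.tsum_eq,
      ENNReal.toReal_ofReal (sq_nonneg _)]

theorem IsEulerScheme.aemeasurable_maxGradDiss (hL : 0 < L) (hν : 0 < ν) (hT : 0 < T)
    (hζ : IsEigenbasis ζ lam) (hq : ∀ j, 0 ≤ q j) (hQ : Summable q)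
    (hK : Summable fun j => lam j * q j) (hbm : IsBrownianSequence P ℱ bm)
    (hu : IsEulerScheme ζ lam q ν T P ℱ bm u₀ N u) (ρ : ℝ) :
    AEMeasurable (fun ω => maxGradDiss ζ lam ρ T N fun l => u l ω) P := by
  have h : ∀ n ∈ Finset.range (N + 1), AEMeasurable (fun ω => ‖sqrtStokes ζ lam (u n ω)‖ ^ 2 +
      ρ * (T / N : ℝ) * ∑ l ∈ Finset.Icc 1 n, ‖stokes (u l ω)‖ ^ 2) P := fun n hn => by
    have hn' := Finset.mem_range.1 hn
    refine (hu.aemeasurable_sqrtStokes hL hζ (by omega)).add (AEMeasurable.const_mul ?_ _)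
    refine Finset.aemeasurable_fun_sum _ fun l hl => ?_
    have hl' := Finset.mem_Icc.1 hl
    exact hu.aemeasurable_stokes hL hν hT hζ hq hQ hK hbm hl'.1 (by omega)
  have h2 := Finset.sup'_induction (p := fun g : Ω → ℝ => AEMeasurable g P)
    (Finset.nonempty_range_add_one (n := N)) (fun n ω => ‖sqrtStokes ζ lam (u n ω)‖ ^ 2 +
      ρ * (T / N : ℝ) * ∑ l ∈ Finset.Icc 1 n, ‖stokes (u l ω)‖ ^ 2)
    (fun f hf g hg => hf.sup hg) h
  convert h2 using 1
  funext ω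
  rw [Finset.sup'_apply]
  rfl

end Scheme

/-! ### Exponential moments -/

section ExpMoment

variable {L ν : ℝ} {T : ℝ≥0} {ζ : HilbertBasis ℕ ℝ (H L)} {lam q : ℕ → ℝ}
  {Ω : Type*} {mΩ : MeasurableSpace Ω} {P : Measure Ω} [IsProbabilityMeasure P]
  {ℱ : Filtration ℝ≥0 mΩ} {bm : ℕ → ℝ≥0 → Ω → ℝ} {u₀ : Ω → H L} {N : ℕ} {u : ℕ → Ω → H L}

/-- The compensated energy increments have a running maximum with exponential moments of all
orders `b < a`, where `2 a Tr Q < σ`, if the time step `T / N` is small. -/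
theorem IsEulerScheme.lintegral_exp_runMax_energyIncr_le (hL : 0 < L) (hν : 0 < ν) (hT : 0 < T)
    (hζ : IsEigenbasis ζ lam) (hq : ∀ j, 0 ≤ q j) (hQ : Summable q)
    (hK : Summable fun j => lam j * q j) (hbm : IsBrownianSequence P ℱ bm)
    (hu : IsEulerScheme ζ lam q ν T P ℱ bm u₀ N u) {a b σ : ℝ} (hb : 0 < b) (hab : b < a)
    (hσ : 0 ≤ σ) (h1 : 2 * a * (∑' j, lam j * q j) * (T / N : ℝ) ≤ 1 / 2)
    (h2 : 2 * a * traceQ q ≤ σ * (1 - 2 * a * (∑' j, lam j * q j) * (T / N : ℝ))) :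
    ∫⁻ ω, ENNReal.ofReal (Real.exp (b * runMax (energyIncr ζ lam q bm T N u
      (4 * a * (∑' j, lam j * q j) * (T / N : ℝ)) (σ * (T / N : ℝ))
      (2 * (∑' j, lam j * q j) * (T / N : ℝ))) N ω)) ∂P ≤ ENNReal.ofReal (a / (a - b)) := by
  have hlam := fun j => (hζ.lam_pos hL j).le
  have ha : 0 < a := hb.trans hab
  have hlq : ∀ j, 0 ≤ lam j * q j := fun j => mul_nonneg (hlam j) (hq j)
  set K := ∑' j, lam j * q j with hKdef
  have hqQ : ∀ j, q j ≤ traceQ q := fun j => hQ.le_tsum j fun i _ => hq i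
  have hlqK : ∀ j, lam j * q j ≤ K := fun j => hK.le_tsum j fun i _ => hlq i
  refine lintegral_exp_runMax_le (𝓖 := fun l => ℱ (gridTime T N l)) (fun l => ℱ.le _)
    (fun l m hlm => ℱ.mono (gridTime_mono T N hlm)) hb hab
    (fun l hl1 hl => hu.measurable_energyIncr hbm _ _ _ hl1 hl) fun l hl f hf => ?_
  have hN : (0 : ℝ≥0) < N := by exact_mod_cast (Nat.zero_le l).trans_lt hl
  have hsum := hu.ae_summable hL hν hT hζ hq hQ hK hbm (4 * a * K * (T / N : ℝ))
    (σ * (T / N : ℝ)) hl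
  set h : ℝ≥0 := T / N with hh
  have hcoe : (T / N : ℝ) = h := by simp [hh]
  have hh0 : 0 < h := div_pos hT hN
  rw [hcoe] at h1 h2 hsum ⊢
  have hA : ∀ j, 2 * a * (lam j * q j) * h ≤ 2 * a * K * h := fun j => by
    have := hlqK j
    gcongr
  refine lintegral_mul_exp_noiseIncr_le (ℱ.le (gridTime T N l)) hh0.ne' hlam hq hK
    (fun j => (hbm.measurable_bmIncr T N l j).mono (ℱ.le _) le_rfl)
    (fun j => hbm.hasLaw_bmIncr T N l j) (hbm.iIndepFun_bmIncr T N l)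
    (hbm.indep_past _ _ (gridTime_mono T N (Nat.le_succ l)))
    (fun j => hu.measurable_mode hl.le j) ha.le h1 (fun j => ?_) (hsum.mono fun ω h => h.1)
    (hsum.mono fun ω h => h.2.1) hf
  rcases l with _ | l
  · -- first step: `λⱼ qⱼ ≤ K`
    simp only [stepWeight, if_true]
    calc 2 * a * lam j ^ 2 * q j * h = 2 * a * lam j * h * (lam j * q j) := by ring
      _ ≤ 2 * a * lam j * h * K := by
          have := hlqK j
          have := hlam j
          gcongr
      _ = 4 * a * K * h * lam j * (1 / 2) := by ring
      _ ≤ _ := by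
          refine mul_le_mul_of_nonneg_left ?_ ?_
          · linarith [hA j]
          · have := (hlq j).trans (hlqK j)
            have := hlam j
            positivity
  · -- later steps: `qⱼ ≤ Tr Q`
    simp only [stepWeight, if_neg (Nat.succ_ne_zero l)]
    have h3 : 2 * a * q j ≤ σ * (1 - 2 * a * (lam j * q j) * h) := by
      refine le_trans ?_ (h2.trans ?_)
      · have := hqQ j
        gcongr
      · exact mul_le_mul_of_nonneg_left (by linarith [hA j]) hσ
    have h4 := mul_le_mul_of_nonneg_left h3 (show 0 ≤ lam j ^ 2 * h by positivity)
    linarith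

/-- Exponential moments of the maximal energy with a fraction `ρ < 2 ν` of the dissipation. -/
theorem exists_expMoment_maxGradDiss_le (hL : 0 < L) (hν : 0 < ν) (hT : 0 < T)
    (hζ : IsEigenbasis ζ lam) (hq : ∀ j, 0 < q j) (hQ : Summable q)
    (hK : Summable fun j => lam j * q j) (hbm : IsBrownianSequence P ℱ bm) {ρ α γ : ℝ}
    (hρ : ρ < 2 * ν) (hα : 0 < α) (hγ : 0 < γ)
    (hαγ : α / γ + α * (2 * traceQ q / (2 * ν - ρ)) < 1)
    (hu₀ : Integrable (fun ω => Real.exp (γ * ‖sqrtStokes ζ lam (u₀ ω)‖ ^ 2)) P) :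
    ∃ C : ℝ, 0 < C ∧ ∀ᶠ N : ℕ in atTop, ∀ u : ℕ → Ω → H L,
      IsEulerScheme ζ lam q ν T P ℱ bm u₀ N u →
        (∀ l, 1 ≤ l → l ≤ N → ∀ᵐ ω ∂P, u l ω ∈ domA L) ∧
        Integrable (fun ω => Real.exp (α * maxGradDiss ζ lam ρ T N fun l => u l ω)) P ∧
        ∫ ω, Real.exp (α * maxGradDiss ζ lam ρ T N fun l => u l ω) ∂P ≤ C := by
  have hlam := hζ.lam_pos hL
  have hq' := fun j => (hq j).le
  set K := ∑' j, lam j * q j with hKdef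
  have hK0 : 0 ≤ K := tsum_nonneg fun j => mul_nonneg (hlam j).le (hq' j)
  have hQ0 : 0 < traceQ q := hQ.tsum_pos hq' 0 (hq 0)
  obtain ⟨σ, hσdef⟩ : ∃ σ, σ = 2 * ν - ρ := ⟨_, rfl⟩
  rw [← hσdef] at hαγ
  have hσ : 0 < σ := by linarith
  -- the orders `b < a` of the exponential moments lie between `α / (1 - α / γ)` and `σ / (2 Tr Q)`
  have hα1 : 0 < 1 - α / γ := by
    have : 0 < α * (2 * traceQ q / σ) := by positivity
    linarith
  have hm : α / (1 - α / γ) < σ / (2 * traceQ q) := by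
    rw [div_lt_div_iff₀ hα1 (by positivity)]
    have h1 : α * (2 * traceQ q / σ) * σ < (1 - α / γ) * σ :=
      mul_lt_mul_of_pos_right (by linarith) hσ
    have h2 : α * (2 * traceQ q / σ) * σ = α * (2 * traceQ q) := by field_simp
    linarith
  obtain ⟨a, hma, ha⟩ := exists_between hm
  obtain ⟨b, hmb, hba⟩ := exists_between hma
  have hb : 0 < b := lt_trans (by positivity) hmb
  have ha0 : 0 < a := hb.trans hba
  have hαb : α / γ + α / b < 1 := by
    have h1 : α / b < 1 - α / γ := by
      rw [div_lt_iff₀ hb]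
      rwa [div_lt_iff₀ hα1, mul_comm] at hmb
    linarith
  have haσ : 2 * a * traceQ q < σ := by
    rw [lt_div_iff₀ (by positivity)] at ha
    linarith
  have hlim : Tendsto (fun N : ℕ => (T / N : ℝ)) atTop (nhds 0) :=
    tendsto_const_div_atTop_nhds_zero_nat _
  have ev1 : ∀ᶠ N : ℕ in atTop, 2 * a * K * (T / N : ℝ) < 1 / 2 := by
    have := hlim.const_mul (2 * a * K)
    rw [mul_zero] at this
    exact this.eventually_lt_const (by norm_num)
  have ev2 : ∀ᶠ N : ℕ in atTop, 2 * a * traceQ q < σ * (1 - 2 * a * K * (T / N : ℝ)) := by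
    have := ((hlim.const_mul (2 * a * K)).const_sub 1).const_mul σ
    rw [mul_zero, sub_zero, mul_one] at this
    exact this.eventually_const_lt haσ
  have ev3 : ∀ᶠ N : ℕ in atTop, (1 + 4 * a * K * (T / N : ℝ)) * (α / γ) + α / b < 1 := by
    have := (((hlim.const_mul (4 * a * K)).const_add 1).mul_const (α / γ)).add_const (α / b)
    rw [mul_zero, add_zero, one_mul] at this
    exact this.eventually_lt_const hαb
  have hI0 : 0 ≤ ∫ ω, Real.exp (γ * ‖sqrtStokes ζ lam (u₀ ω)‖ ^ 2) ∂P :=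
    integral_nonneg fun ω => (Real.exp_pos _).le
  have hab0 : 0 < a / (a - b) := div_pos ha0 (sub_pos.2 hba)
  refine ⟨Real.exp (2 * α * K * T) *
    ((∫ ω, Real.exp (γ * ‖sqrtStokes ζ lam (u₀ ω)‖ ^ 2) ∂P) + a / (a - b)), by positivity, ?_⟩
  filter_upwards [ev1, ev2, ev3, eventually_ge_atTop 1] with N h1 h2 h3 hN u hu
  have hN0 : (0 : ℝ) < N := by exact_mod_cast hN
  refine ⟨fun l hl1 hl => ?_, ?_⟩
  · obtain ⟨l, rfl⟩ := Nat.exists_eq_add_of_le' hl1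
    filter_upwards [hu.ae_step_energy hL hν hT hζ hq' hQ hK hbm hl] with ω hω
    exact mem_domA_of_summable hL hζ hω.1
  set c := 4 * a * K * (T / N : ℝ) with hc
  set k := 2 * K * (T / N : ℝ) with hk
  set M := runMax (energyIncr ζ lam q bm T N u c (σ * (T / N : ℝ)) k) N with hM
  have hc0 : 0 ≤ c := by positivity
  have hmax := hu.ae_maxGradDiss_le hL hν hT hζ hq' hQ hK hbm (ρ := ρ) (σ := σ) (c := c)
    (k := k) (by linarith) hσ.le hc0 (by positivity)
  have hrun := hu.lintegral_exp_runMax_energyIncr_le hL hν hT hζ hq' hQ hK hbm hb hba hσ.le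
    h1.le h2.le
  have hNk : N * k = 2 * K * T := by rw [hk]; field_simp
  have hmeas := (Real.measurable_exp.comp_aemeasurable
    ((hu.aemeasurable_maxGradDiss hL hν hT hζ hq' hQ hK hbm ρ).const_mul α))
  have hbound : ∫⁻ ω, ENNReal.ofReal
      (Real.exp (α * maxGradDiss ζ lam ρ T N fun l => u l ω)) ∂P ≤
      ENNReal.ofReal (Real.exp (2 * α * K * T) *
        ((∫ ω, Real.exp (γ * ‖sqrtStokes ζ lam (u₀ ω)‖ ^ 2) ∂P) + a / (a - b))) := by
    rw [ENNReal.ofReal_mul (Real.exp_pos _).le, ENNReal.ofReal_add hI0 hab0.le,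
      ofReal_integral_eq_lintegral_ofReal hu₀ (ae_of_all _ fun ω => (Real.exp_pos _).le)]
    refine le_trans ?_ (mul_le_mul_right (add_le_add le_rfl hrun) _)
    rw [← lintegral_add_left' hu₀.aestronglyMeasurable.aemeasurable.ennreal_ofReal,
      ← lintegral_const_mul' _ _ ENNReal.ofReal_ne_top]
    refine lintegral_mono_ae ?_
    filter_upwards [hmax] with ω hω
    rw [← ENNReal.ofReal_add (Real.exp_pos _).le (Real.exp_pos _).le,
      ← ENNReal.ofReal_mul (Real.exp_pos _).le]
    refine ENNReal.ofReal_le_ofReal ?_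
    set x := ‖sqrtStokes ζ lam (u₀ ω)‖ ^ 2 with hx
    have hx0 : 0 ≤ x := by positivity
    have hM0 : 0 ≤ M ω := runMax_nonneg _ _ _
    have e1 : α * maxGradDiss ζ lam ρ T N (fun l => u l ω) ≤
        2 * α * K * T + ((1 + c) * (α / γ) * (γ * x) + α / b * (b * M ω)) := by
      have := mul_le_mul_of_nonneg_left hω hα.le
      rw [hNk, ← hM] at this
      refine this.trans (le_of_eq ?_)
      field_simp
      ring
    -- a combination of two nonnegative numbers with weights of sum at most one is at most their
    -- maximum
    have e2 : (1 + c) * (α / γ) * (γ * x) + α / b * (b * M ω) ≤ max (γ * x) (b * M ω) := by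
      have i1 := mul_le_mul_of_nonneg_left (le_max_left (γ * x) (b * M ω))
        (show 0 ≤ (1 + c) * (α / γ) by positivity)
      have i2 := mul_le_mul_of_nonneg_left (le_max_right (γ * x) (b * M ω))
        (show 0 ≤ α / b by positivity)
      have i3 := mul_le_mul_of_nonneg_right h3.le
        (show 0 ≤ max (γ * x) (b * M ω) from le_max_of_le_left (by positivity))
      linarith
    have e3 : Real.exp (max (γ * x) (b * M ω)) ≤ Real.exp (γ * x) + Real.exp (b * M ω) := by
      rcases max_choice (γ * x) (b * M ω) with h | h <;> rw [h]
      · exact le_add_of_nonneg_right (Real.exp_pos _).le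
      · exact le_add_of_nonneg_left (Real.exp_pos _).le
    calc _ ≤ Real.exp (2 * α * K * T) * Real.exp (max (γ * x) (b * M ω)) := by
          rw [← Real.exp_add]
          exact Real.exp_le_exp.2 (e1.trans (by linarith))
      _ ≤ _ := mul_le_mul_of_nonneg_left e3 (Real.exp_pos _).le
  have hint : Integrable (fun ω => Real.exp (α * maxGradDiss ζ lam ρ T N fun l => u l ω)) P := by
    refine ⟨hmeas.aestronglyMeasurable, ?_⟩
    rw [hasFiniteIntegral_iff_ofReal (ae_of_all _ fun ω => (Real.exp_pos _).le)]
    exact hbound.trans_lt ENNReal.ofReal_lt_top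
  refine ⟨hint, ?_⟩
  rw [integral_eq_lintegral_of_nonneg_ae (ae_of_all _ fun ω => (Real.exp_pos _).le)
    hint.aestronglyMeasurable]
  exact ENNReal.toReal_le_of_le_ofReal (by positivity) hbound

theorem maxGradDiss_zero (ζ : HilbertBasis ℕ ℝ (H L)) (lam : ℕ → ℝ) (T : ℝ≥0) (N : ℕ)
    (u : ℕ → H L) : maxGradDiss ζ lam 0 T N u = maxGrad ζ lam N u := by
  simp only [maxGradDiss, maxGrad, zero_mul, add_zero]

theorem maxGradDiss_nonneg (ζ : HilbertBasis ℕ ℝ (H L)) (lam : ℕ → ℝ) {ρ : ℝ} (hρ : 0 ≤ ρ)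
    (T : ℝ≥0) (N : ℕ) (u : ℕ → H L) : 0 ≤ maxGradDiss ζ lam ρ T N u := by
  refine le_trans ?_ (Finset.le_sup' _ (Finset.mem_range.2 (Nat.succ_pos N)))
  positivity

theorem gradExpMoment_of_lt (hL : 0 < L) (hν : 0 < ν) (hT : 0 < T)
    (hζ : IsEigenbasis ζ lam) (hq : ∀ j, 0 < q j) (hQ : Summable q)
    (hK : Summable fun j => lam j * q j) (hbm : IsBrownianSequence P ℱ bm) {α γ : ℝ}
    (hα : 0 < α) (hγ : 0 < γ) (hαγ : α / γ + α * (traceQ q / ν) < 1)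
    (hu₀ : Integrable (fun ω => Real.exp (γ * ‖sqrtStokes ζ lam (u₀ ω)‖ ^ 2)) P) :
    GradExpMoment ζ lam q ν T P ℱ bm u₀ α := by
  obtain ⟨C, hC, h⟩ := exists_expMoment_maxGradDiss_le hL hν hT hζ hq hQ hK hbm (ρ := 0)
    (by linarith) hα hγ (by rwa [sub_zero, mul_div_mul_left _ _ two_ne_zero]) hu₀
  refine ⟨C, hC, h.mono fun N hN u hu => ?_⟩
  have := (hN u hu).2
  simpa only [maxGradDiss_zero] using this

theorem gradDissExpMoment_of_lt (hL : 0 < L) (hν : 0 < ν) (hT : 0 < T)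
    (hζ : IsEigenbasis ζ lam) (hq : ∀ j, 0 < q j) (hQ : Summable q)
    (hK : Summable fun j => lam j * q j) (hbm : IsBrownianSequence P ℱ bm) {β γ : ℝ}
    (hβ : 0 < β) (hγ : 0 < γ) (hβγ : β / γ + 2 * β * (traceQ q / ν) < 1)
    (hu₀ : Integrable (fun ω => Real.exp (γ * ‖sqrtStokes ζ lam (u₀ ω)‖ ^ 2)) P) :
    GradDissExpMoment ζ lam q ν T P ℱ bm u₀ β :=
  exists_expMoment_maxGradDiss_le hL hν hT hζ hq hQ hK hbm (ρ := ν) (by linarith) hβ hγ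
    (by rwa [two_mul ν, add_sub_cancel_right, mul_div_assoc, ← mul_assoc, mul_comm β 2]) hu₀

/-- Orders `β ≤ 0` are covered by any positive order, as the energy is nonnegative. -/
theorem GradDissExpMoment.of_nonpos (hL : 0 < L) (hν : 0 < ν) (hT : 0 < T)
    (hζ : IsEigenbasis ζ lam) (hq : ∀ j, 0 ≤ q j) (hQ : Summable q)
    (hK : Summable fun j => lam j * q j) (hbm : IsBrownianSequence P ℱ bm) {β β' : ℝ}
    (h : GradDissExpMoment ζ lam q ν T P ℱ bm u₀ β') (hβ : β ≤ 0) :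
    GradDissExpMoment ζ lam q ν T P ℱ bm u₀ β := by
  obtain ⟨C, hC, h⟩ := h
  refine ⟨1, one_pos, h.mono fun N hN u hu => ⟨(hN u hu).1, ?_⟩⟩
  have hle : ∀ ω, Real.exp (β * maxGradDiss ζ lam ν T N fun l => u l ω) ≤ 1 := fun ω =>
    Real.exp_le_one_iff.2
      (mul_nonpos_of_nonpos_of_nonneg hβ (maxGradDiss_nonneg ζ lam hν.le T N _))
  have hint : Integrable (fun ω => Real.exp (β * maxGradDiss ζ lam ν T N fun l => u l ω)) P := by
    refine Integrable.mono' (integrable_const (1 : ℝ)) (Real.measurable_exp.comp_aemeasurable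
      ((hu.aemeasurable_maxGradDiss hL hν hT hζ hq hQ hK hbm ν).const_mul
        β)).aestronglyMeasurable (ae_of_all _ fun ω => ?_)
    rw [Real.norm_of_nonneg (Real.exp_pos _).le]
    exact hle ω
  refine ⟨hint, (integral_mono hint (integrable_const 1) hle).trans (by simp)⟩

end ExpMoment

end NavierStokes2D

end

theorem theorem3p2 {Ω : Type*} {mΩ : MeasurableSpace Ω} (P : Measure Ω) [IsProbabilityMeasure P]
    (ℱ : Filtration ℝ≥0 mΩ) (L ν : ℝ) (T : ℝ≥0) (hL : 0 < L) (hν : 0 < ν) (hT : 0 < T)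
    (ζ : HilbertBasis ℕ ℝ (NavierStokes2D.H L)) (lam : ℕ → ℝ)
    (hζ : NavierStokes2D.IsEigenbasis ζ lam)
    (q : ℕ → ℝ) (hq : ∀ j, 0 < q j) (hQ : Summable q) (hK : Summable fun j => lam j * q j)
    (bm : ℕ → ℝ≥0 → Ω → ℝ) (hbm : NavierStokes2D.IsBrownianSequence P ℱ bm)
    (α₀ : ℝ) (hα₀ : α₀ = ν / NavierStokes2D.traceQ q) :
    -- deterministic initial condition
    (∀ u₀ ∈ NavierStokes2D.V L,
      (∀ α : ℝ, 0 < α → α < α₀ →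
        NavierStokes2D.GradExpMoment ζ lam q ν T P ℱ bm (fun _ => u₀) α) ∧
      (∀ β : ℝ, β < α₀ / 2 →
        NavierStokes2D.GradDissExpMoment ζ lam q ν T P ℱ bm (fun _ => u₀) β)) ∧
    -- random initial condition with exponential moments of order `γ₀`
    (∀ u₀ : Ω → NavierStokes2D.H L, StronglyMeasurable[ℱ 0] u₀ →
      (∀ᵐ ω ∂P, u₀ ω ∈ NavierStokes2D.V L) →
      ∀ γ₀ : ℝ, 0 < γ₀ →
      Integrable (fun ω => Real.exp (γ₀ * ‖NavierStokes2D.sqrtStokes ζ lam (u₀ ω)‖ ^ 2)) P →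
      (∀ α : ℝ, 0 < α → α < α₀ * γ₀ / (γ₀ + α₀) →
        NavierStokes2D.GradExpMoment ζ lam q ν T P ℱ bm u₀ α) ∧
      (∀ β : ℝ, 0 < β → β < α₀ * γ₀ / (2 * γ₀ + α₀) →
        NavierStokes2D.GradDissExpMoment ζ lam q ν T P ℱ bm u₀ β)) := by
  open NavierStokes2D in
  have hQ0 : 0 < traceQ q := hQ.tsum_pos (fun j => (hq j).le) 0 (hq 0)
  have hα₀0 : 0 < α₀ := hα₀ ▸ div_pos hν hQ0
  have hinv : NavierStokes2D.traceQ q / ν = 1 / α₀ := by rw [hα₀, one_div_div]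
  -- every multiple of `1 / γ` is small for suitable `γ`
  have hex : ∀ α s : ℝ, 0 < α → s < 1 → ∃ γ : ℝ, 0 < γ ∧ α / γ + s < 1 := fun α s hα hs => by
    refine ⟨2 * α / (1 - s), by have := sub_pos.2 hs; positivity, ?_⟩
    have := sub_pos.2 hs
    have e : α / (2 * α / (1 - s)) = (1 - s) / 2 := by field_simp
    rw [e]
    linarith
  have hpos : ∀ u₀ : NavierStokes2D.H L, ∀ β : ℝ, 0 < β → β < α₀ / 2 →
      NavierStokes2D.GradDissExpMoment ζ lam q ν T P ℱ bm (fun _ => u₀) β := by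
    intro u₀ β hβ hβ'
    have h1 : 2 * β * (NavierStokes2D.traceQ q / ν) < 1 := by
      rw [hinv, mul_one_div, div_lt_one hα₀0]
      linarith
    obtain ⟨γ, hγ, h⟩ := hex β _ hβ h1
    exact NavierStokes2D.gradDissExpMoment_of_lt hL hν hT hζ hq hQ hK hbm hβ hγ h
      (integrable_const _)
  refine ⟨fun u₀ _ => ⟨fun α hα hα' => ?_, fun β hβ => ?_⟩,
    fun u₀ _ _ γ₀ hγ₀ hint => ⟨fun α hα hα' => ?_, fun β hβ hβ' => ?_⟩⟩
  · have h1 : α * (NavierStokes2D.traceQ q / ν) < 1 := by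
      rwa [hinv, mul_one_div, div_lt_one hα₀0]
    obtain ⟨γ, hγ, h⟩ := hex α _ hα h1
    exact NavierStokes2D.gradExpMoment_of_lt hL hν hT hζ hq hQ hK hbm hα hγ h
      (integrable_const _)
  · rcases le_or_gt β 0 with hβ0 | hβ0
    · exact (hpos u₀ (α₀ / 4) (by positivity) (by linarith)).of_nonpos hL hν hT hζ
        (fun j => (hq j).le) hQ hK hbm hβ0
    · exact hpos u₀ β hβ0 hβ
  · refine NavierStokes2D.gradExpMoment_of_lt hL hν hT hζ hq hQ hK hbm hα hγ₀ ?_ hint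
    rw [lt_div_iff₀ (by positivity)] at hα'
    rw [hinv, mul_one_div, div_add_div _ _ hγ₀.ne' hα₀0.ne', div_lt_one (by positivity)]
    linarith
  · refine NavierStokes2D.gradDissExpMoment_of_lt hL hν hT hζ hq hQ hK hbm hβ hγ₀ ?_ hint
    rw [lt_div_iff₀ (by positivity)] at hβ'
    rw [hinv, mul_one_div, div_add_div _ _ hγ₀.ne' hα₀0.ne', div_lt_one (by positivity)]
    linarith
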